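/- A finite automaton $A=(\Sigma,Q,E,I,F)$ has a finite alphabet $\Sigma$, a finite set $Q$ of states, sets $I,F\subseteq Q$ of initial and final states, and a set $E\subseteq Q\times(\Sigma\cup\{\epsilon\})\times Q$ of transitions; $|A|_E$ denotes $|E|$. For $x\in\Sigma^*$ let $\mathrm{da}(A,x)\in\mathbb N\cup\{\infty\}$ be the number of successful paths (paths from an initial to a final state) labeled by $x$. The automaton $A$ is finitely ambiguous if $\sup_x \mathrm{da}(A,x)<\infty$; polynomially ambiguous if there is a polynomial $h\in\mathbb N[X]$ with $\mathrm{da}(A,x)\le h(|x|)$ for all $x\in\Sigma^*$; and exponentially ambiguous if it is neither finitely nor polynomially ambiguous. It is trim if every state lies on a successful path, and $\epsilon$-cycle free if it has no nonempty cycle labeled by $\epsilon$. Theorem. It is decidable in time $O(|A|_E^3)$ whether a trim $\epsilon$-cycle free finite automaton $A$ is finitely, polynomially, or exponentially ambiguous. Precisely: there are a program for the unit-cost random access machine (with addition and subtraction, but no multiplication, of natural numbers) and a constant $C$, both independent of $A$ and $\Sigma$, such that, given the list of the numbers $|Q|$, $|\Sigma|$, $|E|$, the transitions, the initial states and the final states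 of any trim $\epsilon$-cycle free finite automaton $A$ (states and letters being numbered and listed in any order) in its memory, the program halts after at most $C(|A|_E^3+1)$ steps and reports which of the following holds: $A$ is finitely ambiguous; $A$ is polynomially but not finitely ambiguous; $A$ is exponentially ambiguous. -/

import Mathlib

/-!
# Ambiguity of finite automata and a unit-cost random access machine

Finite automata with `ε`-transitions are Mathlib's `εNFA α σ` over a finite alphabet `α` and a
finite state set `σ`; the transition set is the set of triples `(p, a, q)` with `q ∈ step p a`,
where the label `a : Option α` is `none` for an `ε`-transition.
-/

namespace εNFA

variable {α σ : Type*}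

/-- The set of transitions of the automaton `A`. -/
def transitions (A : εNFA α σ) : Set (σ × Option α × σ) :=
  {e | e.2.2 ∈ A.step e.1 e.2.1}

/-- The number of transitions of `A`. -/
noncomputable def numTransitions (A : εNFA α σ) : ℕ :=
  A.transitions.ncard

/-- `A.IsTransitionPath p π q`: the list `π` of transitions is a path of `A` from `p` to `q`. -/
def IsTransitionPath (A : εNFA α σ) : σ → List (σ × Option α × σ) → σ → Prop
  | p, [], q => p = q
  | p, e :: π, q => e ∈ A.transitions ∧ e.1 = p ∧ A.IsTransitionPath e.2.2 π q

/-- The label of a path: the word of its labels, with the `ε`s erased. -/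
def pathLabel (π : List (σ × Option α × σ)) : List α :=
  π.filterMap fun e => e.2.1

/-- The successful paths of `A` labeled by `x`. A path is given by its origin (needed for the empty
path) and its list of transitions. -/
def successfulPaths (A : εNFA α σ) (x : List α) : Set (σ × List (σ × Option α × σ)) :=
  {π | π.1 ∈ A.start ∧ (∃ f ∈ A.accept, A.IsTransitionPath π.1 π.2 f) ∧ pathLabel π.2 = x}

/-- Every state of `A` lies on a successful path. -/
def IsTrim (A : εNFA α σ) : Prop :=
  ∀ q, (∃ i ∈ A.start, ∃ π, A.IsTransitionPath i π q) ∧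
    (∃ f ∈ A.accept, ∃ π, A.IsTransitionPath q π f)

/-- `A` has no nonempty cycle labeled by the empty word. -/
def IsEpsCycleFree (A : εNFA α σ) : Prop :=
  ¬ ∃ (q : σ) (π : List (σ × Option α × σ)),
    π ≠ [] ∧ A.IsTransitionPath q π q ∧ pathLabel π = []

/-- The degree of ambiguity of the word `x` in `A`. -/
noncomputable def wordAmbiguity (A : εNFA α σ) (x : List α) : ℕ∞ :=
  (A.successfulPaths x).encard

/-- The degree of ambiguity of `A`. -/
noncomputable def ambiguity (A : εNFA α σ) : ℕ∞ :=
  ⨆ x : List α, A.wordAmbiguity x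

def FinitelyAmbiguous (A : εNFA α σ) : Prop :=
  A.ambiguity < ⊤

def PolynomiallyAmbiguous (A : εNFA α σ) : Prop :=
  ∃ h : Polynomial ℕ, ∀ x : List α, A.wordAmbiguity x ≤ ((h.eval x.length : ℕ) : ℕ∞)

/-- Infinitely, but not polynomially, ambiguous. -/
def ExponentiallyAmbiguous (A : εNFA α σ) : Prop :=
  ¬ A.FinitelyAmbiguous ∧ ¬ A.PolynomiallyAmbiguous

/-- `w` is a presentation of the finite automaton `A` as a sequence of natural numbers: for some
numbering of the states by `0, …, |Q| - 1`, some numbering of the letters by `1, …, |Σ|` (with `0`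
standing for `ε`), and some order of the transitions, of the initial and of the final states
(each listed exactly once), `w` consists of `|Q|`, `|Σ|`, the number of transitions, the transitions
(three numbers each), the number of initial states, the initial states, the number of final states
and the final states. -/
def IsEncoding [Fintype α] [Fintype σ] (A : εNFA α σ) (w : List ℕ) : Prop :=
  ∃ (st : σ ≃ Fin (Fintype.card σ)) (lt : α ≃ Fin (Fintype.card α))
    (T : List (σ × Option α × σ)) (I F : List σ),
    (T.Nodup ∧ ∀ e, e ∈ T ↔ e ∈ A.transitions) ∧
    (I.Nodup ∧ ∀ q, q ∈ I ↔ q ∈ A.start) ∧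
    (F.Nodup ∧ ∀ q, q ∈ F ↔ q ∈ A.accept) ∧
    w = [Fintype.card σ, Fintype.card α, T.length] ++
      T.flatMap (fun e =>
        [(st e.1 : ℕ), e.2.1.elim 0 (fun a => (lt a : ℕ) + 1), (st e.2.2 : ℕ)]) ++
      [I.length] ++ I.map (fun q => (st q : ℕ)) ++
      [F.length] ++ F.map (fun q => (st q : ℕ))

end εNFA

/-!
The machine model is the unit-cost random access machine with addition and subtraction, with
structured programs. The memory consists of registers and of arrays, every cell of which holds a
natural number. Registers and arrays are named by literals in the program, so that a program uses
finitely many of each, and only array indices are computed. There is no multiplication. Every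
elementary instruction and every evaluation of a test costs one step.
-/
namespace RAM

/-- A memory configuration. -/
structure Config where
  reg : ℕ → ℕ
  arr : ℕ → ℕ → ℕ

/-- Programs. -/
inductive Program where
  /-- `R[x] := n` -/
  | const (x n : ℕ)
  /-- `R[x] := R[y]` -/
  | copy (x y : ℕ)
  /-- `R[x] := R[y] + R[z]` -/
  | add (x y z : ℕ)
  /-- `R[x] := R[y] - R[z]`, or `0` if `R[y] < R[z]` -/
  | sub (x y z : ℕ)
  /-- `R[x] := M_a[R[y]]` -/
  | load (x a y : ℕ)
  /-- `M_a[R[y]] := R[x]` -/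
  | store (a y x : ℕ)
  /-- `P; P'` -/
  | seq (P P' : Program)
  /-- `if R[x] ≠ 0 then P else P'` -/
  | cond (x : ℕ) (P P' : Program)
  /-- `while R[x] ≠ 0 do P` -/
  | loop (x : ℕ) (P : Program)

/-- Write the value `v` into register `x`. -/
def Config.setReg (s : Config) (x v : ℕ) : Config :=
  { s with reg := Function.update s.reg x v }

/-- Write the value `v` into cell `i` of array `a`. -/
def Config.setArr (s : Config) (a i v : ℕ) : Config :=
  { s with arr := Function.update s.arr a (Function.update (s.arr a) i v) }

/-- `Exec P s s' t`: started in the configuration `s`, the program `P` halts in the configuration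
`s'` after exactly `t` steps. -/
inductive Exec : Program → Config → Config → ℕ → Prop where
  | const (x n : ℕ) (s : Config) : Exec (.const x n) s (s.setReg x n) 1
  | copy (x y : ℕ) (s : Config) : Exec (.copy x y) s (s.setReg x (s.reg y)) 1
  | add (x y z : ℕ) (s : Config) : Exec (.add x y z) s (s.setReg x (s.reg y + s.reg z)) 1
  | sub (x y z : ℕ) (s : Config) : Exec (.sub x y z) s (s.setReg x (s.reg y - s.reg z)) 1
  | load (x a y : ℕ) (s : Config) : Exec (.load x a y) s (s.setReg x (s.arr a (s.reg y))) 1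
  | store (a y x : ℕ) (s : Config) : Exec (.store a y x) s (s.setArr a (s.reg y) (s.reg x)) 1
  | seq {P P' : Program} {s s' s'' : Config} {t t' : ℕ} :
      Exec P s s' t → Exec P' s' s'' t' → Exec (.seq P P') s s'' (t + t')
  | cond_true {x : ℕ} {P P' : Program} {s s' : Config} {t : ℕ} :
      s.reg x ≠ 0 → Exec P s s' t → Exec (.cond x P P') s s' (t + 1)
  | cond_false {x : ℕ} {P P' : Program} {s s' : Config} {t : ℕ} :
      s.reg x = 0 → Exec P' s s' t → Exec (.cond x P P') s s' (t + 1)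
  | loop_true {x : ℕ} {P : Program} {s s' s'' : Config} {t t' : ℕ} :
      s.reg x ≠ 0 → Exec P s s' t → Exec (.loop x P) s' s'' t' →
        Exec (.loop x P) s s'' (t + t' + 1)
  | loop_false {x : ℕ} {P : Program} {s : Config} :
      s.reg x = 0 → Exec (.loop x P) s s 1

/-- The initial configuration on input `w`: the word `w` stands at the beginning of array `0`, and
all other cells hold `0`. -/
def input (w : List ℕ) : Config where
  reg := fun _ => 0
  arr := fun a i => if a = 0 then w.getD i 0 else 0

end RAM

/-! ### Letter-ended paths and the two cycle criteria -/

namespace εNFA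

variable {α σ : Type*} {A : εNFA α σ} {p q r : σ} {π ρ : List (σ × Option α × σ)} {u v : List α}

/-! Two patterns of cycles decide the growth. A trim ε-cycle free automaton is exponentially
ambiguous iff some state has two distinct cycles with the same label. Failing that, it is infinitely
ambiguous iff some word labels (letter-ended) paths p → p, p → q and q → q with p ≠ q. Trimness
makes these patterns independent of the initial and final states, so the program never reads those.

Because of ε-transitions, paths are mostly taken letter-ended. Distinct letter-ended paths with the
same label are incomparable in the prefix order, so concatenations of them can be decoded; they
split along every factorisation of the label; and putting the final ε-segment back costs only a
bounded factor (`wordAmbiguity_le`).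

The lower bounds are pumping arguments (`HasTwinCycles.not_polynomiallyAmbiguous`,
`HasBridgedCycles.not_finitelyAmbiguous`). For the upper bounds, `encard_letterPaths_le` follows a
path through the strongly connected components. Without twin cycles there is at most one path with
given label and ends inside a component, so the count is governed by the number of positions at
which a given step can leave a component. At most |v| positions exist, which gives a polynomial;
without bridged cycles a Ramsey argument (`exists_encard_stepPositions_le`) gives a constant.

For the decision procedure, both patterns become cycles through a marked edge in a graph of pairs
and triples of states (`ProductEdge`). Its edges come from two or three transitions with a common
label, hence there are O(|E|³) of them. Mark 2 is put where two paths fork, mark 1 where a triple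
(p, q, q) is closed up to (p, p, q). The answer is the largest mark on a cycle. It is found in
linear time by two depth-first searches (`maxCycleMark_spec`): the second takes the vertices in the
finishing order of the first, searches from the targets of their marked edges without ever clearing
its visited set, and checks whether the source of the edge has been visited.

The time analysis is amortised: a fixed number of steps is set aside for every edge when it is
created. -/

theorem isTransitionPath_append :
    A.IsTransitionPath p (π ++ ρ) q ↔ ∃ r, A.IsTransitionPath p π r ∧ A.IsTransitionPath r ρ q := by
  induction π generalizing p with
  | nil => simp [IsTransitionPath]
  | cons e π ih => simp [IsTransitionPath, ih, and_assoc]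

theorem IsTransitionPath.target_unique (hq : A.IsTransitionPath p π q)
    (hr : A.IsTransitionPath p π r) : q = r := by
  induction π generalizing p with
  | nil => exact hq.symm.trans hr
  | cons e π ih => exact ih hq.2.2 hr.2.2

theorem pathLabel_append : pathLabel (π ++ ρ) = pathLabel π ++ pathLabel ρ :=
  List.filterMap_append

/-- A path is letter-ended if it is empty or its last transition is labeled by a letter. -/
def LetterEnded (π : List (σ × Option α × σ)) : Prop :=
  ∀ e ∈ π.getLast?, e.2.1 ≠ none

theorem LetterEnded.append (hπ : LetterEnded π) (hρ : LetterEnded ρ) : LetterEnded (π ++ ρ) := by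
  intro e he
  rw [List.getLast?_append, Option.mem_def, Option.or_eq_some_iff] at he
  rcases he with h | h
  · exact hρ e h
  · exact hπ e h.2

theorem LetterEnded.of_append (h : LetterEnded (π ++ ρ)) : LetterEnded ρ := by
  intro e he
  apply h e
  rw [List.getLast?_append, Option.mem_def, he]
  rfl

theorem LetterEnded.append_of_ne_nil (hρ : LetterEnded ρ) (h : ρ ≠ []) :
    LetterEnded (π ++ ρ) := by
  intro e he
  rw [List.getLast?_append_of_ne_nil _ h] at he
  exact hρ e he

theorem LetterEnded.eq_nil_of_pathLabel (h : LetterEnded π) (hl : pathLabel π = []) : π = [] := by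
  rcases List.eq_nil_or_concat π with rfl | ⟨π, e, rfl⟩
  · rfl
  · have := h e (by simp)
    rw [List.concat_eq_append, pathLabel_append] at hl
    obtain ⟨a, ha⟩ := Option.ne_none_iff_exists'.1 this
    simp [pathLabel, ha] at hl

theorem LetterEnded.nil : LetterEnded ([] : List (σ × Option α × σ)) := by simp [LetterEnded]

theorem LetterEnded.singleton (p q : σ) (a : α) : LetterEnded [(p, some a, q)] := by
  simp [LetterEnded]

/-- Distinct letter-ended paths with the same label are incomparable in the prefix order. -/
theorem LetterEnded.eq_of_prefix (hρ : LetterEnded ρ) (hl : pathLabel π = pathLabel ρ)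
    (h : π <+: ρ) : π = ρ := by
  obtain ⟨τ, rfl⟩ := h
  rw [pathLabel_append] at hl
  have : pathLabel τ = [] := by simpa using hl
  rw [hρ.of_append.eq_nil_of_pathLabel this, List.append_nil]

variable (A) in
/-- The letter-ended paths from `p` to `q` labeled by `v`. -/
def letterPaths (v : List α) (p q : σ) : Set (List (σ × Option α × σ)) :=
  {π | A.IsTransitionPath p π q ∧ pathLabel π = v ∧ LetterEnded π}

theorem append_mem_letterPaths (hπ : π ∈ A.letterPaths u p q) (hρ : ρ ∈ A.letterPaths v q r) :
    π ++ ρ ∈ A.letterPaths (u ++ v) p r :=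
  ⟨isTransitionPath_append.2 ⟨q, hπ.1, hρ.1⟩, by rw [pathLabel_append, hπ.2.1, hρ.2.1],
    hπ.2.2.append hρ.2.2⟩

theorem letterPaths_nil : A.letterPaths [] p q = {π | π = [] ∧ p = q} := by
  ext π
  constructor
  · rintro ⟨h1, h2, h3⟩
    obtain rfl := h3.eq_nil_of_pathLabel h2
    exact ⟨rfl, h1⟩
  · rintro ⟨rfl, rfl⟩
    exact ⟨rfl, rfl, LetterEnded.nil⟩

/-- The cut is made right after the transition that reads `a`; the ε-transitions before it go to the
first factor, so both factors are letter-ended. -/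
theorem exists_split_letterPaths_cons {a : α} (h : π ∈ A.letterPaths (a :: v) p q) :
    ∃ r, ∃ π₁ ∈ A.letterPaths [a] p r, ∃ π₂ ∈ A.letterPaths v r q, π = π₁ ++ π₂ := by
  induction π generalizing p with
  | nil => simp [letterPaths, pathLabel] at h
  | cons e π ih =>
    obtain ⟨⟨h0, rfl, h1⟩, h2, h3⟩ := h
    have h3' : LetterEnded π := LetterEnded.of_append (π := [e]) h3
    rcases e with ⟨p, _ | b, s⟩
    · obtain ⟨r, π₁, hπ₁, π₂, hπ₂, rfl⟩ := ih ⟨h1, by simpa [pathLabel] using h2, h3'⟩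
      refine ⟨r, (p, none, s) :: π₁, ⟨⟨h0, rfl, hπ₁.1⟩, ?_, ?_⟩, π₂, hπ₂, rfl⟩
      · simpa [pathLabel] using hπ₁.2.1
      · refine hπ₁.2.2.append_of_ne_nil (π := [(p, none, s)]) ?_
        rintro rfl
        simpa [pathLabel] using hπ₁.2.1
    · obtain ⟨rfl, hv⟩ := List.cons.inj (show b :: pathLabel π = a :: v from h2)
      exact ⟨s, [(p, some b, s)], ⟨⟨h0, rfl, rfl⟩, rfl, LetterEnded.singleton _ _ _⟩, π,
        ⟨h1, hv, h3'⟩, rfl⟩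

theorem exists_split_letterPaths (h : π ∈ A.letterPaths (u ++ v) p q) :
    ∃ r, ∃ π₁ ∈ A.letterPaths u p r, ∃ π₂ ∈ A.letterPaths v r q, π = π₁ ++ π₂ := by
  induction u generalizing p π with
  | nil => exact ⟨p, [], by simp [letterPaths_nil], π, h, rfl⟩
  | cons a u ih =>
    obtain ⟨s, π₁, h1, π₂, h2, rfl⟩ := exists_split_letterPaths_cons h
    obtain ⟨r, π₃, h3, π₄, h4, rfl⟩ := ih h2
    exact ⟨r, π₁ ++ π₃, append_mem_letterPaths h1 h3, π₄, h4, by simp⟩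

variable (A) in
/-- Two distinct cycles at some state have the same label. -/
def HasTwinCycles : Prop :=
  ∃ p π ρ, π ≠ ρ ∧ A.IsTransitionPath p π p ∧ A.IsTransitionPath p ρ p ∧ pathLabel π = pathLabel ρ

variable (A) in
/-- Two distinct letter-ended cycles at some state have the same label. -/
def HasLetterTwinCycles : Prop :=
  ∃ v p, (A.letterPaths v p p).Nontrivial

variable (A) in
/-- A word labels a cycle at `p`, a path from `p` to `q ≠ p` and a cycle at `q`. -/
def HasBridgedCycles : Prop :=
  ∃ v p q, p ≠ q ∧ (A.letterPaths v p p).Nonempty ∧ (A.letterPaths v p q).Nonempty ∧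
    (A.letterPaths v q q).Nonempty

/-! ### Lower bounds -/

/-- Trimness supplies a fixed access path to `p` and a fixed exit path from `q`, and gluing them on
is injective. Since `x` and `y` do not depend on `v`, growth of path counts between two states
carries over to the ambiguity. -/
theorem encard_le_wordAmbiguity (hA : A.IsTrim) (p q : σ) :
    ∃ x y : List α, ∀ v, {π | A.IsTransitionPath p π q ∧ pathLabel π = v}.encard ≤
      A.wordAmbiguity (x ++ v ++ y) := by
  obtain ⟨i, hi, π₁, h1⟩ := (hA p).1
  obtain ⟨f, hf, π₂, h2⟩ := (hA q).2
  refine ⟨pathLabel π₁, pathLabel π₂, fun v ↦ ?_⟩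
  refine Set.encard_le_encard_of_injOn (f := fun π ↦ (i, π₁ ++ π ++ π₂)) ?_ ?_
  · rintro π ⟨h, rfl⟩
    exact ⟨hi, ⟨f, hf, isTransitionPath_append.2 ⟨q, isTransitionPath_append.2 ⟨p, h1, h⟩, h2⟩⟩,
      by simp [pathLabel_append]⟩
  · intro π _ ρ _ h
    simpa using h

theorem isTransitionPath_flatten_replicate (h : A.IsTransitionPath p π p) (k : ℕ) :
    A.IsTransitionPath p (List.replicate k π).flatten p := by
  induction k with
  | zero => rfl
  | succ k ih =>
    rw [List.replicate_succ, List.flatten_cons]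
    exact isTransitionPath_append.2 ⟨p, h, ih⟩

theorem pathLabel_flatten (l : List (List (σ × Option α × σ))) :
    pathLabel l.flatten = (l.map pathLabel).flatten := by
  induction l with
  | nil => rfl
  | cons π l ih => rw [List.flatten_cons, pathLabel_append, ih, List.map_cons, List.flatten_cons]

/-- Unique decoding for the prefix code `{x, y}`. -/
theorem flatMap_bool_injOn {β : Type*} {x y : List β} (hxy : ¬ x <+: y) (hyx : ¬ y <+: x) (k : ℕ) :
    Set.InjOn (fun l : List Bool ↦ l.flatMap fun b ↦ if b then x else y) {l | l.length = k} := by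
  induction k with
  | zero =>
    intro l hl m hm _
    rw [List.length_eq_zero_iff.1 hl, List.length_eq_zero_iff.1 hm]
  | succ k ih =>
    rintro (_ | ⟨b, l⟩) hl (_ | ⟨c, m⟩) hm h
    · rfl
    · simp at hl
    · simp at hm
    · simp only [List.flatMap_cons] at h
      have key : b = c := by
        by_contra hbc
        have h1 := (List.prefix_append (if b then x else y) (l.flatMap fun b ↦ if b then x else y))
        have h2 := (List.prefix_append (if c then x else y) (m.flatMap fun b ↦ if b then x else y))
        rw [h] at h1
        have := List.prefix_or_prefix_of_prefix h1 h2
        cases b <;> cases c <;> simp_all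
      subst key
      have := ih (by simpa using hl) (by simpa using hm) (List.append_cancel_left h)
      rw [this]

/-- If one of the two cycles were a prefix of the other, the remainder would be a nonempty cycle
labeled by ε. So they form a prefix code, and the `2 ^ k` products of `k` factors are distinct with
the same label. -/
theorem HasTwinCycles.two_pow_le (h : A.HasTwinCycles) (hε : A.IsEpsCycleFree) :
    ∃ (p : σ) (v : List α), ∀ k : ℕ, (2 ^ k : ℕ) ≤
      {π | A.IsTransitionPath p π p ∧ pathLabel π = (List.replicate k v).flatten}.encard := by
  obtain ⟨p, π, ρ, hne, hπ, hρ, hl⟩ := h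
  have key : ∀ {π ρ : List (σ × Option α × σ)}, A.IsTransitionPath p π p →
      A.IsTransitionPath p ρ p → pathLabel π = pathLabel ρ → π ≠ ρ → ¬ π <+: ρ := by
    rintro π _ hπ hρ hl hne ⟨τ, rfl⟩
    obtain ⟨q, h1, h2⟩ := isTransitionPath_append.1 hρ
    have hq : p = q := hπ.target_unique h1
    subst hq
    refine hε ⟨p, τ, ?_, h2, ?_⟩
    · rintro rfl
      simp at hne
    · rw [pathLabel_append] at hl
      simpa using hl
  refine ⟨p, pathLabel π, fun k ↦ ?_⟩
  have hcard : ({l : List Bool | l.length = k}).encard = (2 ^ k : ℕ) := by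
    have h : ({l : List Bool | l.length = k}).encard = ENat.card (List.Vector Bool k) := rfl
    rw [h, ENat.card_eq_coe_fintype_card]
    simp
  rw [← hcard]
  refine Set.encard_le_encard_of_injOn ?_
    (flatMap_bool_injOn (key hπ hρ hl hne) (key hρ hπ hl.symm hne.symm) k)
  rintro l rfl
  clear hcard
  induction l with
  | nil => exact ⟨rfl, rfl⟩
  | cons b l ih =>
    obtain ⟨h1, h2⟩ := ih
    simp only [List.flatMap_cons, List.length_cons, List.replicate_succ,
      List.flatten_cons] at h1 h2 ⊢
    cases b
    · exact ⟨isTransitionPath_append.2 ⟨p, hρ, h1⟩, by rw [pathLabel_append, h2, hl]; simp⟩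
    · exact ⟨isTransitionPath_append.2 ⟨p, hπ, h1⟩, by rw [pathLabel_append, h2]; simp⟩

theorem HasTwinCycles.not_polynomiallyAmbiguous (h : A.HasTwinCycles) (hε : A.IsEpsCycleFree)
    (hA : A.IsTrim) : ¬ A.PolynomiallyAmbiguous := by
  rintro ⟨f, hf⟩
  obtain ⟨p, v, hv⟩ := h.two_pow_le hε
  obtain ⟨x, y, hxy⟩ := encard_le_wordAmbiguity hA p p
  have key : ∀ k : ℕ, 2 ^ k ≤ f.eval (x.length + k * v.length + y.length) := by
    intro k
    have := ((hv k).trans (hxy _)).trans (hf _)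
    simpa [mul_comm, add_assoc] using ENat.natCast_le_natCast.1 this
  -- Pumping `2 * k` times gives `4 ^ k ≥ exp k` paths, so `g / exp` stays above 1, while a
  -- polynomial divided by `exp` tends to 0.
  let g : Polynomial ℕ := f.comp (Polynomial.C (x.length + y.length) +
    Polynomial.X * Polynomial.C (2 * v.length))
  have hg : ∀ k : ℕ, 1 ≤ (g.map (Nat.castRingHom ℝ)).eval (k : ℝ) / Real.exp k := by
    intro k
    have h1 := key (2 * k)
    have h2 : g.eval k = f.eval (x.length + 2 * k * v.length + y.length) := by
      simp only [g, Polynomial.eval_comp, Polynomial.eval_add, Polynomial.eval_mul,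
        Polynomial.eval_C, Polynomial.eval_X]
      congr 1
      ring
    rw [← h2] at h1
    have h3 : (g.map (Nat.castRingHom ℝ)).eval (k : ℝ) = (g.eval k : ℕ) :=
      Polynomial.eval_map_apply (f := Nat.castRingHom ℝ) (p := g) k
    rw [h3, one_le_div (Real.exp_pos _)]
    calc Real.exp k = Real.exp 1 ^ k := by rw [← Real.exp_nat_mul, mul_one]
      _ ≤ (2 ^ 2) ^ k := by
        have := Real.exp_one_lt_d9
        gcongr
        linarith
      _ = 2 ^ (2 * k) := by rw [pow_mul]
      _ ≤ _ := by exact_mod_cast h1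
  have lim := (g.map (Nat.castRingHom ℝ)).tendsto_div_exp_atTop.comp
    (tendsto_natCast_atTop_atTop (R := ℝ))
  have := ge_of_tendsto' lim hg
  linarith

/-- The word `v ^ k` is read by going `j` times around `p`, crossing to `q`, and going around `q`
for the rest. The `k` choices of `j` give distinct paths. -/
theorem HasBridgedCycles.not_finitelyAmbiguous (h : A.HasBridgedCycles) (hA : A.IsTrim) :
    ¬ A.FinitelyAmbiguous := by
  obtain ⟨v, p, q, hpq, ⟨π₁, h1⟩, ⟨π₂, h2⟩, ⟨π₃, h3⟩⟩ := h
  obtain ⟨x, y, hxy⟩ := encard_le_wordAmbiguity hA p q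
  have hne : π₁ ≠ π₂ := by
    rintro rfl
    exact hpq (h1.1.target_unique h2.1)
  have key : ∀ k : ℕ, (k : ℕ∞) ≤ A.wordAmbiguity (x ++ (List.replicate k v).flatten ++ y) := by
    intro k
    refine le_trans ?_ (hxy _)
    have hcard : (k : ℕ∞) = (Finset.range k : Set ℕ).encard := by
      rw [Set.encard_coe_eq_coe_finsetCard, Finset.card_range]
    rw [hcard]
    refine Set.encard_le_encard_of_injOn (f := fun j ↦ (List.replicate j π₁).flatten ++ (π₂ ++
      (List.replicate (k - 1 - j) π₃).flatten)) ?_ ?_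
    · intro j hj
      have hj : j < k := by simpa using hj
      refine ⟨isTransitionPath_append.2 ⟨p, isTransitionPath_flatten_replicate h1.1 j,
        isTransitionPath_append.2 ⟨q, h2.1, isTransitionPath_flatten_replicate h3.1 _⟩⟩, ?_⟩
      simp only [pathLabel_append, pathLabel_flatten, List.map_replicate, h1.2.1, h2.2.1, h3.2.1]
      obtain ⟨m, rfl⟩ : ∃ m, k = j + (m + 1) := ⟨k - 1 - j, by omega⟩
      rw [List.replicate_add, List.flatten_append, List.replicate_succ, List.flatten_cons]
      congr 4
      omega
    -- After cancelling `i` copies of `π₁`, one path continues with `π₂` and the other with `π₁`;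
    -- these are distinct letter-ended paths with one label, hence prefix-incomparable.
    · have aux : ∀ i j : ℕ, i < j → ∀ τ τ' : List (σ × Option α × σ),
          (List.replicate i π₁).flatten ++ (π₂ ++ τ) ≠ (List.replicate j π₁).flatten ++ τ' := by
        intro i j hij τ τ' h
        obtain ⟨m, rfl⟩ : ∃ m, j = i + (m + 1) := ⟨j - i - 1, by omega⟩
        rw [List.replicate_add, List.flatten_append, List.append_assoc, List.replicate_succ,
          List.flatten_cons, List.append_assoc] at h
        have h := List.append_cancel_left h
        have hp1 : π₂ <+: π₂ ++ τ := List.prefix_append _ _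
        have hp2 := List.prefix_append π₁ ((List.replicate m π₁).flatten ++ τ')
        rw [← h] at hp2
        rcases List.prefix_or_prefix_of_prefix hp1 hp2 with h' | h'
        · exact hne (h1.2.2.eq_of_prefix (h2.2.1.trans h1.2.1.symm) h').symm
        · exact hne (h2.2.2.eq_of_prefix (h1.2.1.trans h2.2.1.symm) h')
      intro i _ j _ h
      rcases lt_trichotomy i j with hij | hij | hij
      · exact absurd h (aux i j hij _ _)
      · exact hij
      · exact absurd h.symm (aux j i hij _ _)
  intro hfin
  obtain ⟨n, hn⟩ := ENat.ne_top_iff_exists.1 (ne_of_lt hfin)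
  have h := (key (n + 1)).trans (le_iSup A.wordAmbiguity _)
  change _ ≤ A.ambiguity at h
  rw [← hn, ENat.natCast_le_natCast] at h
  omega

theorem FinitelyAmbiguous.polynomiallyAmbiguous (h : A.FinitelyAmbiguous) :
    A.PolynomiallyAmbiguous := by
  obtain ⟨n, hn⟩ := ENat.ne_top_iff_exists.1 (ne_of_lt h)
  refine ⟨Polynomial.C n, fun x ↦ ?_⟩
  rw [Polynomial.eval_C, hn]
  exact le_iSup A.wordAmbiguity x

end εNFA

/-! ### Combinatorial tools: a Ramsey lemma, idempotent relations, unions -/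

/-- Induction on the number of colours. By pigeonhole many elements `j` have the same colour `χ`
towards the least element; either two of them are joined by `χ`, which closes a triangle, or `χ`
does not occur among them and one colour is lost. -/
theorem exists_monochromatic_triangle (κ : Type*) (c : ℕ) :
    ∃ N : ℕ, ∀ (f : ℕ → ℕ → κ) (K : Finset κ) (J : Finset ℕ), K.card ≤ c →
      (∀ i ∈ J, ∀ j ∈ J, i < j → f i j ∈ K) → N ≤ J.card →
      ∃ i ∈ J, ∃ j ∈ J, ∃ k ∈ J, i < j ∧ j < k ∧ f i j = f j k ∧ f i k = f j k := by
  classical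
  induction c with
  | zero =>
    refine ⟨2, fun f K J hK hf hJ ↦ ?_⟩
    obtain rfl : K = ∅ := by simpa using hK
    obtain ⟨i, hi, j, hj, hij⟩ := Finset.one_lt_card.1 hJ
    rcases lt_or_gt_of_ne hij with h | h
    · simpa using hf i hi j hj h
    · simpa using hf j hj i hi h
  | succ c ih =>
    obtain ⟨N, hN⟩ := ih
    refine ⟨(c + 1) * N + 2, fun f K J hK hf hJ ↦ ?_⟩
    have hne : J.Nonempty := Finset.card_pos.1 (by omega)
    set i₀ := J.min' hne
    have hi₀ : i₀ ∈ J := Finset.min'_mem _ _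
    have hlt : ∀ j ∈ J.erase i₀, i₀ < j := fun j hj ↦
      lt_of_le_of_ne (Finset.min'_le _ _ (Finset.mem_of_mem_erase hj))
        (Finset.ne_of_mem_erase hj).symm
    obtain ⟨χ, hχ, hfib⟩ := Finset.exists_lt_card_fiber_of_mul_lt_card_of_maps_to
      (s := J.erase i₀) (t := K) (f := f i₀) (n := N)
      (fun j hj ↦ hf i₀ hi₀ j (Finset.mem_of_mem_erase hj) (hlt j hj)) (by
        rw [Finset.card_erase_of_mem hi₀]
        have := Nat.mul_le_mul_right N hK
        omega)
    set J' := (J.erase i₀).filter fun j ↦ f i₀ j = χ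
    have hJ' : ∀ j ∈ J', j ∈ J ∧ i₀ < j ∧ f i₀ j = χ := fun j hj ↦
      ⟨Finset.mem_of_mem_erase (Finset.mem_filter.1 hj).1, hlt j (Finset.mem_filter.1 hj).1,
        (Finset.mem_filter.1 hj).2⟩
    by_cases h : ∃ j ∈ J', ∃ k ∈ J', j < k ∧ f j k = χ
    · obtain ⟨j, hj, k, hk, hjk, hχ'⟩ := h
      exact ⟨i₀, hi₀, j, (hJ' j hj).1, k, (hJ' k hk).1, (hJ' j hj).2.1, hjk,
        (hJ' j hj).2.2.trans hχ'.symm, (hJ' k hk).2.2.trans hχ'.symm⟩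
    · push Not at h
      obtain ⟨i, hi, j, hj, k, hk, hh⟩ := hN f (K.erase χ) J'
        (by rw [Finset.card_erase_of_mem hχ]; omega)
        (fun i hi j hj hij ↦ Finset.mem_erase.2
          ⟨h i hi j hj hij, hf i (hJ' i hi).1 j (hJ' j hj).1 hij⟩) hfib.le
      exact ⟨i, (hJ' i hi).1, j, (hJ' j hj).1, k, (hJ' k hk).1, hh⟩

/-- In a transitive and dense relation on a finite type, related elements have a reflexive element
between them. -/
theorem exists_refl_between {β : Type*} [Finite β] {R : β → β → Prop}
    (trans : ∀ x y z, R x y → R y z → R x z) (dense : ∀ x z, R x z → ∃ y, R x y ∧ R y z)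
    {x z : β} (h : R x z) : ∃ y, R x y ∧ R y y ∧ R y z := by
  by_contra! hc
  -- Without reflexive elements, `R` is a strict order on the finite interval between `x` and `z`;
  -- density puts an element below a minimal one.
  let S : {y // R x y ∧ R y z} → {y // R x y ∧ R y z} → Prop := fun a b ↦ R a.1 b.1
  have : IsTrans _ S := ⟨fun a b c ↦ trans _ _ _⟩
  have : Std.Irrefl S := ⟨fun a ha ↦ hc _ a.2.1 ha a.2.2⟩
  have wf : WellFounded S := Finite.wellFounded_of_trans_of_irrefl S
  obtain ⟨y, hy⟩ := dense x z h
  obtain ⟨m, -, hm⟩ := wf.has_min Set.univ ⟨⟨y, hy⟩, trivial⟩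
  obtain ⟨y', h1, h2⟩ := dense x m.1 m.2.1
  exact hm ⟨y', h1, trans _ _ _ h2 m.2.2⟩ trivial h2

theorem Set.encard_biUnion_le_mul {ι β : Type*} {t : Set ι} (ht : t.Finite) {s : ι → Set β}
    {B : ℕ∞} (h : ∀ i ∈ t, (s i).encard ≤ B) : (⋃ i ∈ t, s i).encard ≤ t.encard * B := by
  have := ht.toFinset.set_encard_biUnion_le s
  simp only [Set.Finite.mem_toFinset] at this
  refine this.trans ((Finset.sum_le_sum (g := fun _ ↦ B) fun i hi ↦
    h i (by simpa using hi)).trans ?_)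
  rw [Finset.sum_const, nsmul_eq_mul, ht.encard_eq_coe_toFinset_card]

/-! ### Counting letter-ended paths along strongly connected components -/

namespace εNFA

variable {α σ : Type*} {A : εNFA α σ} {p q r s t : σ} {π ρ : List (σ × Option α × σ)}
  {u v : List α}

variable (A) in
/-- The states that can be reached from `p` by a letter-ended path. -/
def letterReach (p : σ) : Set σ := {q | ∃ v, (A.letterPaths v p q).Nonempty}

theorem mem_letterReach_of_mem (h : π ∈ A.letterPaths v p q) : q ∈ A.letterReach p := ⟨v, π, h⟩

theorem mem_letterReach_self (p : σ) : p ∈ A.letterReach p := ⟨[], [], by simp [letterPaths_nil]⟩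

theorem mem_letterReach_trans (h : q ∈ A.letterReach p) (h' : r ∈ A.letterReach q) :
    r ∈ A.letterReach p := by
  obtain ⟨u, π, hπ⟩ := h
  obtain ⟨v, ρ, hρ⟩ := h'
  exact ⟨_, _, append_mem_letterPaths hπ hρ⟩

/-- A common return path from `q` to `p` would turn two such paths into letter-ended twin cycles. -/
theorem encard_letterPaths_le_one (h : ¬ A.HasLetterTwinCycles) (hp : p ∈ A.letterReach q) :
    (A.letterPaths v p q).encard ≤ 1 := by
  rw [Set.encard_le_one_iff]
  intro π ρ hπ hρ
  obtain ⟨u, τ, hτ⟩ := hp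
  by_contra hne
  exact h ⟨v ++ u, p, π ++ τ, append_mem_letterPaths hπ hτ, ρ ++ τ, append_mem_letterPaths hρ hτ,
    fun h ↦ hne (List.append_cancel_right h)⟩

variable (A) in
/-- The positions at which a path from `p` to `q` labeled by `v` may step from `s` to `t`. -/
def stepPositions (v : List α) (p s t q : σ) : Set ℕ :=
  {i | ∃ v₁ a v₂, v = v₁ ++ a :: v₂ ∧ v₁.length = i ∧ (A.letterPaths v₁ p s).Nonempty ∧
    (A.letterPaths [a] s t).Nonempty ∧ (A.letterPaths v₂ t q).Nonempty}

theorem stepPositions_subset : A.stepPositions v p s t q ⊆ Finset.range v.length := by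
  rintro _ ⟨v₁, a, v₂, rfl, rfl, -⟩
  simp

/-- Only the states reached right after a letter count: the exit is the first letter whose segment,
including the ε-transitions before it, ends outside `X`. -/
theorem exists_exit {X : Set σ} (hp : p ∈ X) (hq : q ∉ X) (hπ : π ∈ A.letterPaths v p q) :
    ∃ v₁ a v₂ s t π₁ π₂ π₃, v = v₁ ++ a :: v₂ ∧ s ∈ X ∧ t ∉ X ∧ π₁ ∈ A.letterPaths v₁ p s ∧
      π₂ ∈ A.letterPaths [a] s t ∧ π₃ ∈ A.letterPaths v₂ t q ∧ π = π₁ ++ (π₂ ++ π₃) := by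
  induction v generalizing p π with
  | nil =>
    rw [letterPaths_nil] at hπ
    exact absurd (hπ.2 ▸ hp) hq
  | cons a v ih =>
    obtain ⟨r, π₁, h1, π₂, h2, rfl⟩ := exists_split_letterPaths_cons hπ
    by_cases hr : r ∈ X
    · obtain ⟨v₁, b, v₂, s, t, ρ₁, ρ₂, ρ₃, rfl, hs, ht, g1, g2, g3, rfl⟩ := ih hr h2
      exact ⟨a :: v₁, b, v₂, s, t, π₁ ++ ρ₁, ρ₂, ρ₃, rfl, hs, ht,
        append_mem_letterPaths h1 g1, g2, g3, by simp⟩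
    · exact ⟨[], a, v, p, r, [], π₁, π₂, rfl, hp, hr, by simp [letterPaths_nil], h1, h2, rfl⟩

/-- A path that leaves the component of `p` is determined by the exit step `(s, t)` (at most |Q|²
choices), its position (at most `K`), the path up to `s` (unique), the segment from `s` to `t` (at
most `M`), and the rest from `t`. The induction is on the size of the reachable set, which is
strictly smaller for `t`. Keeping `K` abstract serves both the polynomial and the constant bound. -/
theorem encard_letterPaths_le [Fintype σ] (hA : ¬ A.HasLetterTwinCycles) {M : ℕ} {K : ℕ → ℕ}
    (hM : ∀ a p q, (A.letterPaths [a] p q).encard ≤ M) (hK : Monotone K)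
    (hs : ∀ v p s t q, p ∈ A.letterReach s → s ∈ A.letterReach p → p ∉ A.letterReach t →
      (A.stepPositions v p s t q).encard ≤ K v.length) (n : ℕ) :
    ∀ p v q, (A.letterReach p).ncard ≤ n →
      (A.letterPaths v p q).encard ≤
        (((Fintype.card σ) ^ 2 * K v.length * M + 1) ^ n : ℕ) := by
  induction n with
  | zero =>
    intro p v q h
    rw [Nat.le_zero, Set.ncard_eq_zero] at h
    exact absurd (mem_letterReach_self p) (h ▸ Set.notMem_empty p)
  | succ n ih =>
    intro p v q hn
    by_cases hq : q ∈ A.letterReach p ∧ p ∈ A.letterReach q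
    · exact (encard_letterPaths_le_one hA hq.2).trans
        (by exact_mod_cast Nat.one_le_pow _ _ (Nat.succ_pos _))
    set B := ((Fintype.card σ) ^ 2 * K v.length * M + 1) ^ n
    let Z : σ × σ → ℕ → Set (List (σ × Option α × σ)) := fun x i ↦ {π | ∃ v₁ a v₂ π₁ π₂ π₃,
      v = v₁ ++ a :: v₂ ∧ v₁.length = i ∧ π₁ ∈ A.letterPaths v₁ p x.1 ∧
      π₂ ∈ A.letterPaths [a] x.1 x.2 ∧ π₃ ∈ A.letterPaths v₂ x.2 q ∧ π = π₁ ++ (π₂ ++ π₃)}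
    let T : Set (σ × σ) := {x | x.1 ∈ A.letterReach p ∧ p ∈ A.letterReach x.1 ∧
      p ∉ A.letterReach x.2}
    have hsub : A.letterPaths v p q ⊆ ⋃ x ∈ T, ⋃ i ∈ A.stepPositions v p x.1 x.2 q, Z x i := by
      intro π hπ
      obtain ⟨v₁, a, v₂, s, t, π₁, π₂, π₃, hv, hs, ht, h1, h2, h3, rfl⟩ :=
        exists_exit (X := {q | q ∈ A.letterReach p ∧ p ∈ A.letterReach q})
          ⟨mem_letterReach_self p, mem_letterReach_self p⟩ hq hπ
      simp only [Set.mem_iUnion]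
      refine ⟨(s, t), ⟨hs.1, hs.2, fun h ↦ ht ⟨?_, h⟩⟩, v₁.length,
        ⟨v₁, a, v₂, hv, rfl, ⟨_, h1⟩, ⟨_, h2⟩, ⟨_, h3⟩⟩,
        ⟨v₁, a, v₂, π₁, π₂, π₃, hv, rfl, h1, h2, h3, rfl⟩⟩
      exact mem_letterReach_trans hs.1 (mem_letterReach_of_mem h2)
    have hZ : ∀ x ∈ T, ∀ i, (Z x i).encard ≤ (M * B : ℕ) := by
      rintro ⟨s, t⟩ ⟨hx1, hx2, hx3⟩ i
      rcases Set.eq_empty_or_nonempty (Z (s, t) i) with h0 | ⟨π, v₁, a, v₂, π₁, π₂, π₃, hv, rfl,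
        h1, h2, h3, rfl⟩
      · simp [h0]
      have hsub : Z (s, t) v₁.length ⊆ (fun x : _ × _ × _ ↦ x.1 ++ (x.2.1 ++ x.2.2)) ''
          (A.letterPaths v₁ p s ×ˢ (A.letterPaths [a] s t ×ˢ A.letterPaths v₂ t q)) := by
        rintro _ ⟨w₁, b, w₂, ρ₁, ρ₂, ρ₃, hw, hlen, g1, g2, g3, rfl⟩
        rw [hv] at hw
        obtain ⟨rfl, hw'⟩ := List.append_inj hw hlen.symm
        obtain ⟨rfl, rfl⟩ := List.cons.inj hw'
        exact ⟨(ρ₁, ρ₂, ρ₃), ⟨g1, g2, g3⟩, rfl⟩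
      refine (Set.encard_le_encard hsub).trans ((Set.encard_image_le _ _).trans ?_)
      rw [Set.encard_prod, Set.encard_prod, Nat.cast_mul]
      have hlt : (A.letterReach t).ncard ≤ n := by
        have : A.letterReach t ⊂ A.letterReach p := by
          refine ⟨fun x hx ↦ mem_letterReach_trans hx1 (mem_letterReach_trans
            (mem_letterReach_of_mem h2) hx), fun h ↦ hx3 (h (mem_letterReach_self p))⟩
        have := Set.ncard_lt_ncard this
        omega
      have hB : (A.letterPaths v₂ t q).encard ≤ B := by
        refine (ih t v₂ q hlt).trans ?_
        have : K v₂.length ≤ K v.length := hK (by rw [hv]; simp; omega)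
        simp only [B]
        gcongr
      calc _ ≤ 1 * ((M : ℕ∞) * (B : ℕ∞)) := by
            gcongr
            · exact encard_letterPaths_le_one hA hx2
            · exact hM _ _ _
        _ = _ := one_mul _
    have hT : T.encard ≤ ((Fintype.card σ) ^ 2 : ℕ) := by
      refine (Set.encard_le_encard (Set.subset_univ T)).trans ?_
      rw [Set.encard_univ, ENat.card_eq_coe_fintype_card, Fintype.card_prod, sq]
    calc _ ≤ _ := Set.encard_le_encard hsub
      _ ≤ T.encard * ((K v.length : ℕ) * (M * B : ℕ)) := by
        refine Set.encard_biUnion_le_mul T.toFinite fun x hx ↦ ?_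
        refine (Set.encard_biUnion_le_mul ((Finset.finite_toSet _).subset stepPositions_subset)
          fun i _ ↦ hZ x hx i).trans ?_
        gcongr
        exact hs _ _ _ _ _ hx.2.1 hx.1 hx.2.2
      _ ≤ ((Fintype.card σ) ^ 2 : ℕ) * ((K v.length : ℕ) * (M * B : ℕ)) := by gcongr
      _ ≤ _ := by
        norm_cast
        rw [pow_succ]
        change _ ≤ B * _
        nlinarith [Nat.zero_le B]

/-- With too many positions for the step `s → t`, colour a pair `i < j` of them by the relation on
states defined by reading the factor of `v` between them. A monochromatic triangle yields an
idempotent relation `R`, so related states have a reflexive state in between. One such state `p'` is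
found before the step, in the component of `p`, and one such state `q'` after it, beyond `t`;
together they form bridged cycles. -/
theorem exists_encard_stepPositions_le [Fintype σ] (hA : ¬ A.HasBridgedCycles) :
    ∃ K : ℕ, ∀ v p s t q, p ∈ A.letterReach s → s ∈ A.letterReach p → p ∉ A.letterReach t →
      (A.stepPositions v p s t q).encard ≤ K := by
  classical
  obtain ⟨N, hN⟩ := exists_monochromatic_triangle (Set (σ × σ)) (Fintype.card (Set (σ × σ)))
  refine ⟨N, fun v p s t q hps hsp hpt ↦ ?_⟩
  by_contra! hlt
  have hfin : (A.stepPositions v p s t q).Finite :=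
    (Finset.finite_toSet _).subset stepPositions_subset
  rw [hfin.encard_eq_coe_toFinset_card, Nat.cast_lt] at hlt
  let sub : ℕ → ℕ → List α := fun i j ↦ (v.drop i).take (j - i)
  have sub_append : ∀ i j k, i ≤ j → j ≤ k → sub i k = sub i j ++ sub j k := by
    intro i j k hij hjk
    obtain ⟨d, rfl⟩ := Nat.exists_eq_add_of_le hij
    obtain ⟨d', rfl⟩ := Nat.exists_eq_add_of_le hjk
    simp only [sub]
    rw [← List.drop_drop, show i + d + d' - i = d + d' by omega, Nat.add_sub_cancel_left,
      Nat.add_sub_cancel_left, List.take_add]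
  have take_eq : ∀ i j, i ≤ j → v.take j = v.take i ++ sub i j := by
    intro i j hij
    obtain ⟨d, rfl⟩ := Nat.exists_eq_add_of_le hij
    simp only [sub]
    rw [Nat.add_sub_cancel_left, List.take_add]
  have drop_eq : ∀ i j, i ≤ j → v.drop i = sub i j ++ v.drop j := by
    intro i j hij
    obtain ⟨d, rfl⟩ := Nat.exists_eq_add_of_le hij
    simp only [sub]
    rw [Nat.add_sub_cancel_left, ← List.drop_drop, List.take_append_drop]
  have step : ∀ i ∈ A.stepPositions v p s t q, ∃ a, v.drop i = a :: v.drop (i + 1) ∧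
      (A.letterPaths (v.take i) p s).Nonempty ∧ (A.letterPaths [a] s t).Nonempty ∧
      (A.letterPaths (v.drop (i + 1)) t q).Nonempty := by
    rintro _ ⟨v₁, a, v₂, rfl, rfl, h1, h2, h3⟩
    refine ⟨a, ?_⟩
    rw [← List.drop_drop, List.drop_left, List.take_left]
    exact ⟨rfl, h1, h2, h3⟩
  let f : ℕ → ℕ → Set (σ × σ) := fun i j ↦ {x | (A.letterPaths (sub i j) x.1 x.2).Nonempty}
  obtain ⟨i, hi, j, hj, k, hk, hij, hjk, e1, e2⟩ := hN f Finset.univ hfin.toFinset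
    (Finset.card_le_univ _) (fun _ _ _ _ _ ↦ Finset.mem_univ _) hlt.le
  rw [Set.Finite.mem_toFinset] at hi hj hk
  obtain ⟨a, hia, ⟨π₁, h1⟩, ⟨π₂, h2⟩, ⟨π₃, h3⟩⟩ := step i hi
  obtain ⟨_, _, ⟨π₄, h4⟩, _, _⟩ := step j hj
  let R : σ → σ → Prop := fun x y ↦ (A.letterPaths (sub i k) x y).Nonempty
  have eij : ∀ {x y}, (A.letterPaths (sub i j) x y).Nonempty ↔ R x y := fun {x y} ↦ by
    have := Set.ext_iff.1 (e1.trans e2.symm) (x, y)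
    exact this
  have ejk : ∀ {x y}, (A.letterPaths (sub j k) x y).Nonempty ↔ R x y := fun {x y} ↦ by
    have := Set.ext_iff.1 e2.symm (x, y)
    exact this
  have trans : ∀ x y z, R x y → R y z → R x z := by
    intro x y z hxy hyz
    obtain ⟨ρ, hρ⟩ := eij.2 hxy
    obtain ⟨τ, hτ⟩ := ejk.2 hyz
    have := append_mem_letterPaths hρ hτ
    rw [← sub_append i j k hij.le hjk.le] at this
    exact ⟨_, this⟩
  have dense : ∀ x z, R x z → ∃ y, R x y ∧ R y z := by
    rintro x z ⟨ρ, hρ⟩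
    rw [sub_append i j k hij.le hjk.le] at hρ
    obtain ⟨y, ρ₁, g1, ρ₂, g2, -⟩ := exists_split_letterPaths hρ
    exact ⟨y, eij.1 ⟨_, g1⟩, ejk.1 ⟨_, g2⟩⟩
  have reach : ∀ {x y}, R x y → y ∈ A.letterReach x := fun {x y} h ↦ ⟨_, h⟩
  -- before the step
  rw [take_eq i j hij.le] at h4
  obtain ⟨x, ρ₁, g1, ρ₂, g2, -⟩ := exists_split_letterPaths h4
  have hxs : R x s := eij.1 ⟨_, g2⟩
  obtain ⟨p', hxp, hpp, hp's⟩ := exists_refl_between trans dense hxs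
  have hp' : p' ∈ A.letterReach p :=
    mem_letterReach_trans (mem_letterReach_of_mem g1) (reach hxp)
  -- after the step
  rw [drop_eq (i + 1) j hij] at h3
  obtain ⟨y, ρ₃, g3, ρ₄, g4, -⟩ := exists_split_letterPaths h3
  rw [drop_eq j k hjk.le] at g4
  obtain ⟨z, ρ₅, g5, ρ₆, g6, -⟩ := exists_split_letterPaths g4
  -- The step occurs at position `i` too, so the factor from `i` to `j` leads from `s` through `t`
  -- to `y`; this links both sides of the step within `R`.
  have hsy : R s y := by
    refine eij.1 ?_
    have := append_mem_letterPaths h2 g3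
    have heq : sub i j = [a] ++ sub (i + 1) j := by
      simp only [sub]
      rw [hia, show j - i = (j - (i + 1)) + 1 by omega, List.take_succ_cons]
      rfl
    rw [← heq] at this
    exact ⟨_, this⟩
  have hyz : R y z := ejk.1 ⟨_, g5⟩
  obtain ⟨q', hyq, hqq, hq'z⟩ := exists_refl_between trans dense hyz
  refine hA ⟨_, p', q', ?_, hpp, trans _ _ _ (trans _ _ _ hp's hsy) hyq, hqq⟩
  -- If `p'` and `q'` coincided, one could go from `t` to `q' = p'`, on to `s` and back to `p`,
  -- although `t` lies outside the component.
  rintro rfl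
  refine hpt (mem_letterReach_trans (mem_letterReach_of_mem g3) ?_)
  exact mem_letterReach_trans (reach hyq) (mem_letterReach_trans (reach hp's) hps)

/-! ### Upper bounds -/

variable (A) in
/-- The paths from `p` to `q` labeled by the empty word. -/
def emptyPaths (p q : σ) : Set (List (σ × Option α × σ)) :=
  {π | A.IsTransitionPath p π q ∧ pathLabel π = []}

/-- The second factor is the maximal final segment of ε-transitions. -/
theorem exists_split_emptyPaths (h : A.IsTransitionPath p π q) :
    ∃ r, ∃ π₁ ∈ A.letterPaths (pathLabel π) p r, ∃ π₂ ∈ A.emptyPaths r q, π = π₁ ++ π₂ := by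
  induction π using List.reverseRecOn generalizing q with
  | nil => exact ⟨p, [], ⟨rfl, rfl, LetterEnded.nil⟩, [], ⟨h, rfl⟩, rfl⟩
  | append_singleton π e ih =>
    obtain ⟨s, h1, h2⟩ := isTransitionPath_append.1 h
    obtain ⟨s, _ | a, t⟩ := e
    · obtain ⟨r, π₁, g1, π₂, g2, h⟩ := ih h1
      refine ⟨r, π₁, ?_, π₂ ++ [(s, none, t)], ⟨isTransitionPath_append.2 ⟨_, g2.1, h2⟩, ?_⟩, ?_⟩
      · rw [pathLabel_append]
        simpa [pathLabel] using g1
      · rw [pathLabel_append, g2.2]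
        rfl
      · rw [h, List.append_assoc]
    · refine ⟨q, _, ⟨h, rfl, ?_⟩, [], ⟨rfl, rfl⟩, (List.append_nil _).symm⟩
      exact (LetterEnded.singleton s t a).append_of_ne_nil (by simp)

/-- Without ε-cycles, being reachable by a nonempty ε-path is a strict order on a finite set, so one
can recurse on the first transition. -/
theorem IsEpsCycleFree.finite_emptyPaths [Finite σ] (hε : A.IsEpsCycleFree) (p q : σ) :
    (A.emptyPaths p q).Finite := by
  let S : σ → σ → Prop := fun q p ↦ ∃ π, π ≠ [] ∧ A.IsTransitionPath p π q ∧ pathLabel π = []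
  have : IsTrans _ S := ⟨by
    rintro a b c ⟨π, h1, h2, h3⟩ ⟨ρ, g1, g2, g3⟩
    exact ⟨ρ ++ π, by simp [h1], isTransitionPath_append.2 ⟨b, g2, h2⟩,
      by rw [pathLabel_append, h3, g3]; rfl⟩⟩
  have : Std.Irrefl S := ⟨fun a ⟨π, h⟩ ↦ hε ⟨a, π, h⟩⟩
  have wf : WellFounded S := Finite.wellFounded_of_trans_of_irrefl S
  induction p using wf.induction with
  | h p ih =>
    have hsub : A.emptyPaths p q ⊆ {[]} ∪ ⋃ r ∈ {r | S r p},
        ((p, none, r) :: ·) '' A.emptyPaths r q := by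
      rintro (_ | ⟨e, π⟩) ⟨h, hl⟩
      · simp
      right
      obtain ⟨h0, rfl, h1⟩ := h
      rcases e with ⟨p, _ | a, r⟩
      · simp only [Set.mem_iUnion]
        exact ⟨r, ⟨[(p, none, r)], by simp, ⟨h0, rfl, rfl⟩, rfl⟩, π, ⟨h1, hl⟩, rfl⟩
      · exact absurd (show a :: pathLabel π = [] from hl) (by simp)
    exact ((Set.finite_singleton _).union ((Set.toFinite _).biUnion fun r hr ↦
      (ih r hr).image _)).subset hsub

theorem IsEpsCycleFree.finite_letterPaths_singleton [Finite σ] (hε : A.IsEpsCycleFree) (a : α)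
    (p q : σ) : (A.letterPaths [a] p q).Finite := by
  have hsub : A.letterPaths [a] p q ⊆ ⋃ r, (· ++ [(r, some a, q)]) '' A.emptyPaths p r := by
    rintro π ⟨h1, h2, h3⟩
    rcases List.eq_nil_or_concat' π with rfl | ⟨π, e, rfl⟩
    · simp [pathLabel] at h2
    obtain ⟨r, g1, g2, rfl, rfl⟩ := isTransitionPath_append.1 h1
    obtain ⟨b, hb⟩ := Option.ne_none_iff_exists'.1 (h3 e (by simp))
    rw [pathLabel_append, show pathLabel [e] = [b] by simp [pathLabel, hb]] at h2
    obtain ⟨h2', rfl⟩ : pathLabel π = [] ∧ b = a := by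
      simpa [List.append_eq_singleton_iff] using h2
    simp only [Set.mem_iUnion]
    exact ⟨e.1, π, ⟨g1, h2'⟩, by rw [← hb]⟩
  exact (Set.finite_iUnion fun r ↦ (hε.finite_emptyPaths p r).image _).subset hsub

theorem exists_encard_le {ι β : Type*} [Finite ι] {f : ι → Set β} (hf : ∀ i, (f i).Finite) :
    ∃ M : ℕ, ∀ i, (f i).encard ≤ M := by
  obtain ⟨M, hM⟩ := (Set.finite_range fun i ↦ (f i).ncard).bddAbove
  refine ⟨M, fun i ↦ ?_⟩
  rw [← (hf i).cast_ncard_eq]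
  exact_mod_cast hM ⟨i, rfl⟩

/-- A successful path is a letter-ended path followed by an ε-path, and the number of ε-paths
between two states is bounded. -/
theorem wordAmbiguity_le [Fintype σ] (hε : A.IsEpsCycleFree) :
    ∃ M : ℕ, ∀ (x : List α) (B : ℕ), (∀ p q, (A.letterPaths x p q).encard ≤ B) →
      A.wordAmbiguity x ≤ (M * B : ℕ) := by
  obtain ⟨M, hM⟩ := exists_encard_le (f := fun x : σ × σ ↦ A.emptyPaths x.1 x.2)
    fun x ↦ hε.finite_emptyPaths _ _
  refine ⟨(Fintype.card σ) ^ 3 * M, fun x B hB ↦ ?_⟩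
  have hsub : A.successfulPaths x ⊆ ⋃ y ∈ (Set.univ : Set (σ × σ × σ)),
      (fun π : _ × _ ↦ (y.1, π.1 ++ π.2)) ''
        (A.letterPaths x y.1 y.2.1 ×ˢ A.emptyPaths y.2.1 y.2.2) := by
    rintro ⟨i, π⟩ ⟨-, ⟨f, -, h⟩, rfl⟩
    obtain ⟨r, π₁, h1, π₂, h2, h⟩ := exists_split_emptyPaths h
    simp only [Set.mem_iUnion]
    exact ⟨(i, r, f), trivial, (π₁, π₂), ⟨h1, h2⟩, Prod.ext rfl h.symm⟩
  refine (Set.encard_le_encard hsub).trans ((Set.encard_biUnion_le_mul Set.finite_univ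
    (B := (B * M : ℕ)) fun y _ ↦ ?_).trans ?_)
  · refine (Set.encard_image_le _ _).trans ?_
    rw [Set.encard_prod, Nat.cast_mul]
    exact mul_le_mul' (hB _ _) (hM (y.2.1, y.2.2))
  · rw [Set.encard_univ, ENat.card_eq_coe_fintype_card, Fintype.card_prod, Fintype.card_prod]
    apply le_of_eq
    norm_cast
    ring

theorem exists_encard_letterPaths_le [Fintype α] [Fintype σ] (hε : A.IsEpsCycleFree)
    (hA : ¬ A.HasLetterTwinCycles) {K : ℕ → ℕ} (hK : Monotone K)
    (hs : ∀ v p s t q, p ∈ A.letterReach s → s ∈ A.letterReach p → p ∉ A.letterReach t →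
      (A.stepPositions v p s t q).encard ≤ K v.length) :
    ∃ M : ℕ, ∀ v p q, (A.letterPaths v p q).encard ≤
      (((Fintype.card σ) ^ 2 * K v.length * M + 1) ^ Fintype.card σ : ℕ) := by
  obtain ⟨M, hM⟩ := exists_encard_le (f := fun x : α × σ × σ ↦ A.letterPaths [x.1] x.2.1 x.2.2)
    fun x ↦ hε.finite_letterPaths_singleton _ _ _
  refine ⟨M, fun v p q ↦ encard_letterPaths_le hA (fun a p q ↦ hM (a, p, q)) hK hs _ _ _ _ ?_⟩
  rw [← Nat.card_eq_fintype_card, ← Set.ncard_univ]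
  exact Set.ncard_le_ncard (Set.subset_univ _)

theorem polynomiallyAmbiguous_of_not_hasLetterTwinCycles [Fintype α] [Fintype σ]
    (hε : A.IsEpsCycleFree) (hA : ¬ A.HasLetterTwinCycles) : A.PolynomiallyAmbiguous := by
  obtain ⟨M, hM⟩ := exists_encard_letterPaths_le hε hA (K := id) monotone_id
    fun v p s t q _ _ _ ↦ (Set.encard_le_encard stepPositions_subset).trans (by
      rw [Set.encard_coe_eq_coe_finsetCard, Finset.card_range]
      rfl)
  obtain ⟨N, hN⟩ := wordAmbiguity_le hε
  refine ⟨.C N * (.C (Fintype.card σ ^ 2) * .X * .C M + 1) ^ Fintype.card σ, fun x ↦ ?_⟩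
  refine (hN x _ fun p q ↦ hM x p q).trans ?_
  simp

theorem finitelyAmbiguous_of_not_hasBridgedCycles [Fintype α] [Fintype σ] (hε : A.IsEpsCycleFree)
    (hA : ¬ A.HasLetterTwinCycles) (hA' : ¬ A.HasBridgedCycles) : A.FinitelyAmbiguous := by
  obtain ⟨K, hK⟩ := exists_encard_stepPositions_le hA'
  obtain ⟨M, hM⟩ := exists_encard_letterPaths_le hε hA (K := fun _ ↦ K) monotone_const
    fun v ↦ hK v
  obtain ⟨N, hN⟩ := wordAmbiguity_le hε
  refine lt_of_le_of_lt (iSup_le fun x ↦ hN x _ fun p q ↦ hM x p q) ?_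
  exact ENat.natCast_lt_top _

end εNFA

namespace RAM

/-! ### Program logic -/

infixr:60 " ⨟ " => Program.seq

@[simp] theorem Config.reg_setReg (s : Config) (x v y : ℕ) :
    (s.setReg x v).reg y = if y = x then v else s.reg y := by
  simp [Config.setReg, Function.update_apply]

@[simp] theorem Config.arr_setReg (s : Config) (x v : ℕ) : (s.setReg x v).arr = s.arr := rfl

@[simp] theorem Config.reg_setArr (s : Config) (a i v : ℕ) : (s.setArr a i v).reg = s.reg := rfl

@[simp] theorem Config.arr_setArr (s : Config) (a i v b : ℕ) :
    (s.setArr a i v).arr b = if b = a then Function.update (s.arr a) i v else s.arr b := by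
  simp [Config.setArr, Function.update_apply]

/-- The effect of a program without loops. -/
@[simp] def Program.run : Program → Config → Config
  | .const x n, s => s.setReg x n
  | .copy x y, s => s.setReg x (s.reg y)
  | .add x y z, s => s.setReg x (s.reg y + s.reg z)
  | .sub x y z, s => s.setReg x (s.reg y - s.reg z)
  | .load x a y, s => s.setReg x (s.arr a (s.reg y))
  | .store a y x, s => s.setArr a (s.reg y) (s.reg x)
  | .seq P P', s => P'.run (P.run s)
  | .cond x P P', s => if s.reg x = 0 then P'.run s else P.run s
  | .loop _ _, s => s

/-- A bound for the running time of a program without loops. -/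
@[simp] def Program.cost : Program → ℕ
  | .seq P P' => P.cost + P'.cost
  | .cond _ P P' => max P.cost P'.cost + 1
  | .loop _ _ => 0
  | _ => 1

@[simp] def Program.LoopFree : Program → Prop
  | .seq P P' => P.LoopFree ∧ P'.LoopFree
  | .cond _ P P' => P.LoopFree ∧ P'.LoopFree
  | .loop _ _ => False
  | _ => True

theorem Program.LoopFree.exec_run {P : Program} (h : P.LoopFree) (s : Config) :
    ∃ t ≤ P.cost, Exec P s (P.run s) t := by
  induction P generalizing s with
  | const => exact ⟨1, le_rfl, .const ..⟩
  | copy => exact ⟨1, le_rfl, .copy ..⟩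
  | add => exact ⟨1, le_rfl, .add ..⟩
  | sub => exact ⟨1, le_rfl, .sub ..⟩
  | load => exact ⟨1, le_rfl, .load ..⟩
  | store => exact ⟨1, le_rfl, .store ..⟩
  | seq P P' ih ih' =>
    obtain ⟨t, ht, h1⟩ := ih h.1 s
    obtain ⟨t', ht', h2⟩ := ih' h.2 (P.run s)
    exact ⟨t + t', Nat.add_le_add ht ht', .seq h1 h2⟩
  | cond x P P' ih ih' =>
    by_cases hx : s.reg x = 0
    · obtain ⟨t, ht, h1⟩ := ih' h.2 s
      refine ⟨t + 1, ?_, by simpa [hx] using Exec.cond_false hx h1⟩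
      simp only [cost]
      omega
    · obtain ⟨t, ht, h1⟩ := ih h.1 s
      refine ⟨t + 1, ?_, by simpa [hx] using Exec.cond_true hx h1⟩
      simp only [cost]
      omega
  | loop => exact h.elim

/-- Started in `s` with `c` units of time, the program `P` halts and the final configuration
satisfies `Φ` together with (a lower bound of) the remaining time. -/
def Wp (P : Program) (s : Config) (c : ℕ) (Φ : Config → ℕ → Prop) : Prop :=
  ∃ s' t c', Exec P s s' t ∧ t + c' ≤ c ∧ Φ s' c'

variable {P P' : Program} {s : Config} {c : ℕ} {Φ Ψ : Config → ℕ → Prop}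

theorem Wp.mono (h : Wp P s c Φ) (hΦ : ∀ s' c', Φ s' c' → Ψ s' c') : Wp P s c Ψ := by
  obtain ⟨s', t, c', h1, h2, h3⟩ := h
  exact ⟨s', t, c', h1, h2, hΦ _ _ h3⟩

theorem Wp.seq (h : Wp P s c fun s' c' ↦ Wp P' s' c' Φ) : Wp (P ⨟ P') s c Φ := by
  obtain ⟨s', t, c', h1, h2, s'', t', c'', h3, h4, h5⟩ := h
  exact ⟨s'', t + t', c'', .seq h1 h3, by omega, h5⟩

theorem Wp.of_loopFree (hP : P.LoopFree) (hc : P.cost ≤ c) (h : Φ (P.run s) (c - P.cost)) :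
    Wp P s c Φ := by
  obtain ⟨t, ht, h1⟩ := hP.exec_run s
  exact ⟨_, t, _, h1, by omega, h⟩

/-- The remaining time is itself the termination measure, since every turn costs at least its test.
Invariants that mention it thus prove termination and the time bound at once. -/
theorem Wp.loop {x : ℕ} (Inv : Config → ℕ → Prop) (hs : Inv s c)
    (step : ∀ s c, Inv s c → s.reg x ≠ 0 → 1 ≤ c ∧ Wp P s (c - 1) Inv)
    (fin : ∀ s c, Inv s c → s.reg x = 0 → 1 ≤ c ∧ Φ s (c - 1)) : Wp (.loop x P) s c Φ := by
  induction c using Nat.strong_induction_on generalizing s with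
  | _ c ih =>
    by_cases hx : s.reg x = 0
    · obtain ⟨h1, h2⟩ := fin s c hs hx
      exact ⟨s, 1, c - 1, .loop_false hx, by omega, h2⟩
    · obtain ⟨h1, s', t, c', h2, h3, h4⟩ := step s c hs hx
      obtain ⟨s'', t', c'', h5, h6, h7⟩ := ih c' (by omega) h4
      exact ⟨s'', t + t' + 1, c'', .loop_true hx h2 h5, by omega, h7⟩

/-! ### Depth-first search in graphs stored as linked adjacency lists -/

/-- A directed multigraph with edges `1, …, numEdges`; the edges with source `u` form a linked list
with first entry `head u` and decreasing edge numbers. -/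
structure LinkedGraph where
  numEdges : ℕ
  src : ℕ → ℕ
  tgt : ℕ → ℕ
  mark : ℕ → ℕ
  next : ℕ → ℕ
  head : ℕ → ℕ

namespace LinkedGraph

variable (g : LinkedGraph)

/-- The two `max` fields say that the lists skip no edge. As the numbers decrease along a list, a
single pointer separates the scanned edges of a vertex from the others. -/
structure Wf : Prop where
  next_lt : ∀ e, 1 ≤ e → e ≤ g.numEdges → g.next e < e
  next_src : ∀ e, 1 ≤ e → e ≤ g.numEdges → g.next e ≠ 0 → g.src (g.next e) = g.src e
  next_max : ∀ e, 1 ≤ e → e ≤ g.numEdges → ∀ e', g.next e < e' → e' < e → g.src e' ≠ g.src e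
  head_le : ∀ u, g.head u ≤ g.numEdges
  head_src : ∀ u, g.head u ≠ 0 → g.src (g.head u) = u
  head_max : ∀ u e, g.head u < e → e ≤ g.numEdges → g.src e ≠ u

def Adj (u v : ℕ) : Prop := ∃ e, 1 ≤ e ∧ e ≤ g.numEdges ∧ g.src e = u ∧ g.tgt e = v

def Reach : ℕ → ℕ → Prop := Relation.ReflTransGen g.Adj

/-- The invariant of depth-first search: `vis` marks the visited vertices, `cur u` is the next
edge of `u` to be scanned, `stk` holds the stack of `sp` active vertices and `ord` the `n` finished
vertices in the order of finishing. All edges that remain to be scanned are in `U`, and all visited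
vertices satisfy `Q`. -/
structure Search (Q : ℕ → Prop) (vis cur stk ord : ℕ → ℕ) (sp n : ℕ) (U : Finset ℕ) : Prop where
  vis_iff : ∀ v, vis v ≠ 0 ↔ (∃ i < sp, stk i = v) ∨ ∃ i < n, ord i = v
  stk_inj : ∀ i < sp, ∀ j < sp, stk i = stk j → i = j
  ord_inj : ∀ i < n, ∀ j < n, ord i = ord j → i = j
  disj : ∀ i < sp, ∀ j < n, stk i ≠ ord j
  stk_reach : ∀ i j, i ≤ j → j < sp → g.Reach (stk i) (stk j)
  cur_zero : ∀ i < n, cur (ord i) = 0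
  cur_edge : ∀ u, vis u ≠ 0 → cur u ≠ 0 → cur u ≤ g.numEdges ∧ g.src (cur u) = u
  scanned : ∀ e, 1 ≤ e → e ≤ g.numEdges → vis (g.src e) ≠ 0 → cur (g.src e) < e →
    vis (g.tgt e) ≠ 0
  order : ∀ i j y, i ≤ j → j < n → g.Adj (ord i) y → (∃ k ≤ j, ord k = y) ∨ g.Reach y (ord j)
  unscanned : ∀ e, 1 ≤ e → e ≤ g.numEdges → (vis (g.src e) = 0 ∨ e ≤ cur (g.src e)) → e ∈ U
  inv : ∀ v, vis v ≠ 0 → Q v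

variable {g} {Q : ℕ → Prop} {vis cur stk ord : ℕ → ℕ} {sp n : ℕ} {U : Finset ℕ}

/-- Being unvisited, `v` occurs neither on the stack nor among the finished vertices; `htop` keeps
the stack a chain for reachability. -/
theorem Search.push (h : g.Search Q vis cur stk ord sp n U) (hg : g.Wf) {v : ℕ} (hv : vis v = 0)
    (hQ : Q v) (htop : ∀ i, i + 1 = sp → g.Reach (stk i) v) :
    g.Search Q (Function.update vis v 1) (Function.update cur v (g.head v))
      (Function.update stk sp v) ord (sp + 1) n U where
  vis_iff w := by
    have := h.vis_iff w
    simp only [Function.update_apply]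
    by_cases hw : w = v
    · subst hw
      simp only [if_true]
      refine ⟨fun _ ↦ Or.inl ⟨sp, by omega, by simp⟩, fun _ ↦ by simp⟩
    · rw [if_neg hw, this]
      refine or_congr ⟨?_, ?_⟩ Iff.rfl
      · rintro ⟨i, hi, rfl⟩
        exact ⟨i, by omega, by rw [if_neg hi.ne]⟩
      · rintro ⟨i, hi, hi'⟩
        split_ifs at hi' with h1
        · exact absurd hi'.symm hw
        · exact ⟨i, by omega, hi'⟩
  stk_inj i hi j hj hij := by
    have h1 : ∀ i < sp, stk i ≠ v := fun i hi h' ↦ (h.vis_iff v).2 (Or.inl ⟨i, hi, h'⟩) hv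
    have := h.stk_inj i
    simp only [Function.update_apply] at hij
    grind
  ord_inj := h.ord_inj
  disj i hi j hj := by
    have h1 : ∀ i < n, ord i ≠ v := fun i hi h' ↦ (h.vis_iff v).2 (Or.inr ⟨i, hi, h'⟩) hv
    have := h.disj i
    simp only [Function.update_apply]
    grind
  stk_reach i j hij hj := by
    simp only [Function.update_apply]
    rcases Nat.lt_or_ge j sp with hj' | hj'
    · rw [if_neg (by omega), if_neg (by omega)]
      exact h.stk_reach i j hij hj'
    · obtain rfl : j = sp := by omega
      rw [if_pos rfl]
      split_ifs with hi
      · exact .refl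
      · obtain ⟨k, rfl⟩ : ∃ k, j = k + 1 := ⟨j - 1, by omega⟩
        exact (h.stk_reach i k (by omega) (by omega)).trans (htop k rfl)
  cur_zero i hi := by
    have h1 : ord i ≠ v := fun h' ↦ (h.vis_iff v).2 (Or.inr ⟨i, hi, h'⟩) hv
    rw [Function.update_of_ne h1]
    exact h.cur_zero i hi
  cur_edge u hu hu' := by
    simp only [Function.update_apply] at hu hu' ⊢
    by_cases huv : u = v
    · rw [if_pos huv] at hu' ⊢
      rw [huv]
      exact ⟨hg.head_le v, hg.head_src v hu'⟩
    · rw [if_neg huv] at hu hu' ⊢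
      exact h.cur_edge u hu hu'
  scanned e h1 h2 h3 h4 := by
    simp only [Function.update_apply] at h3 h4 ⊢
    by_cases huv : g.src e = v
    · rw [if_pos huv] at h4
      exact absurd huv (hg.head_max v e h4 h2)
    · rw [if_neg huv] at h3 h4
      split_ifs
      · simp
      · exact h.scanned e h1 h2 h3 h4
  order := h.order
  unscanned e h1 h2 h3 := by
    simp only [Function.update_apply] at h3
    by_cases huv : g.src e = v
    · exact h.unscanned e h1 h2 (Or.inl (huv ▸ hv))
    · rw [if_neg huv, if_neg huv] at h3
      exact h.unscanned e h1 h2 h3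
  inv w hw := by
    simp only [Function.update_apply] at hw
    split_ifs at hw with h1
    · exact h1 ▸ hQ
    · exact h.inv w hw

theorem Search.cur_mem (h : g.Search Q vis cur stk ord sp n U) {u : ℕ} (hu : vis u ≠ 0)
    (hc : cur u ≠ 0) : cur u ∈ U := by
  obtain ⟨h1, h2⟩ := h.cur_edge u hu hc
  exact h.unscanned _ (by omega) h1 (Or.inr (by rw [h2]))

theorem Search.scan (h : g.Search Q vis cur stk ord sp n U) (hg : g.Wf) {u : ℕ} (hu : vis u ≠ 0)
    (hc : cur u ≠ 0) (ht : vis (g.tgt (cur u)) ≠ 0) :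
    g.Search Q vis (Function.update cur u (g.next (cur u))) stk ord sp n (U.erase (cur u)) := by
  obtain ⟨hM, hsrc⟩ := h.cur_edge u hu hc
  have hlt := hg.next_lt (cur u) (by omega) hM
  exact
  { h with
    cur_zero := fun i hi ↦ by
      have h0 := h.cur_zero i hi
      rw [Function.update_of_ne]
      · exact h0
      · rintro rfl
        exact hc h0
    cur_edge := fun w hw hw' ↦ by
      simp only [Function.update_apply] at hw' ⊢
      split_ifs at hw' ⊢ with h1
      · exact ⟨by omega, (hg.next_src _ (by omega) hM hw').trans (hsrc.trans h1.symm)⟩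
      · exact h.cur_edge w hw hw'
    scanned := fun e h1 h2 h3 h4 ↦ by
      simp only [Function.update_apply] at h4
      split_ifs at h4 with h5
      · rcases lt_trichotomy e (cur u) with h6 | h6 | h6
        · exact absurd (h5.trans hsrc.symm) (hg.next_max _ (by omega) hM e h4 h6)
        · rw [h6]
          exact ht
        · exact h.scanned e h1 h2 h3 (by rwa [h5])
      · exact h.scanned e h1 h2 h3 h4
    unscanned := fun e h1 h2 h3 ↦ by
      simp only [Function.update_apply] at h3
      rw [Finset.mem_erase]
      by_cases h5 : g.src e = u
      · rw [if_pos h5, h5] at h3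
        rcases h3 with h3 | h3
        · exact absurd h3 hu
        · exact ⟨by omega, h.unscanned e h1 h2 (Or.inr (by rw [h5]; omega))⟩
      · rw [if_neg h5] at h3
        refine ⟨?_, h.unscanned e h1 h2 h3⟩
        rintro rfl
        exact h5 hsrc }

/-- The field `order` is established here. All edges of finished vertices have been scanned, so
their targets are visited: each is finished already, or is on the stack and therefore reaches the
top, which is the vertex being finished. -/
theorem Search.pop (h : g.Search Q vis cur stk ord (sp + 1) n U) (hc : cur (stk sp) = 0) :
    g.Search Q vis cur stk (Function.update ord n (stk sp)) sp (n + 1) U where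
  vis_iff w := by
    rw [h.vis_iff w]
    simp only [Function.update_apply]
    constructor
    · rintro (⟨i, hi, rfl⟩ | ⟨i, hi, rfl⟩)
      · rcases Nat.lt_or_ge i sp with h1 | h1
        · exact Or.inl ⟨i, h1, rfl⟩
        · obtain rfl : i = sp := by omega
          exact Or.inr ⟨n, by omega, by simp⟩
      · exact Or.inr ⟨i, by omega, by rw [if_neg hi.ne]⟩
    · rintro (⟨i, hi, rfl⟩ | ⟨i, hi, rfl⟩)
      · exact Or.inl ⟨i, by omega, rfl⟩
      · split_ifs with h1
        · exact Or.inl ⟨sp, by omega, rfl⟩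
        · exact Or.inr ⟨i, by omega, rfl⟩
  stk_inj i hi j hj := h.stk_inj i (by omega) j (by omega)
  ord_inj i hi j hj hij := by
    have h1 := h.disj sp (by omega)
    have h2 := h.ord_inj i
    simp only [Function.update_apply] at hij
    grind
  disj i hi j hj := by
    have h1 := h.disj i (by omega) j
    have h2 := h.stk_inj i (by omega) sp (by omega)
    simp only [Function.update_apply]
    grind
  stk_reach i j hij hj := h.stk_reach i j hij (by omega)
  cur_zero i hi := by
    simp only [Function.update_apply]
    split_ifs with h1
    · exact hc
    · exact h.cur_zero i (by omega)
  cur_edge := h.cur_edge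
  scanned := h.scanned
  order i j y hij hj hy := by
    rcases Nat.lt_or_ge j n with hjn | hjn
    · rw [Function.update_of_ne (by omega : i ≠ n)] at hy
      rw [Function.update_of_ne (by omega : j ≠ n)]
      refine (h.order i j y hij hjn hy).imp ?_ id
      rintro ⟨k, hk, h'⟩
      exact ⟨k, hk, by rwa [Function.update_of_ne (by omega : k ≠ n)]⟩
    obtain rfl : j = n := by omega
    have hy' : vis y ≠ 0 := by
      obtain ⟨e, h1, h2, h3, rfl⟩ := hy
      have h4 : vis (g.src e) ≠ 0 ∧ cur (g.src e) = 0 := by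
        rw [h3]
        simp only [Function.update_apply]
        split_ifs with h5
        · exact ⟨(h.vis_iff _).2 (Or.inl ⟨sp, by omega, rfl⟩), hc⟩
        · exact ⟨(h.vis_iff _).2 (Or.inr ⟨i, by omega, rfl⟩), h.cur_zero i (by omega)⟩
      exact h.scanned e h1 h2 h4.1 (by omega)
    rcases (h.vis_iff y).1 hy' with ⟨k, hk, rfl⟩ | ⟨k, hk, rfl⟩
    · right
      rw [Function.update_self]
      exact h.stk_reach k sp (by omega) (by omega)
    · exact Or.inl ⟨k, hk.le, by rw [Function.update_of_ne hk.ne]⟩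
  unscanned := h.unscanned
  inv := h.inv

/-- The set of visited vertices is closed at the end of a search. -/
theorem Search.vis_of_reach (h : g.Search Q vis cur stk ord 0 n U) {u v : ℕ} (hu : vis u ≠ 0)
    (huv : g.Reach u v) : vis v ≠ 0 := by
  induction huv with
  | refl => exact hu
  | tail _ hadj ih =>
    obtain ⟨e, h1, h2, rfl, rfl⟩ := hadj
    have : cur (g.src e) = 0 := by
      rcases (h.vis_iff _).1 ih with ⟨i, hi, -⟩ | ⟨i, hi, h'⟩
      · omega
      · rw [← h']
        exact h.cur_zero i hi
    exact h.scanned e h1 h2 ih (by omega)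

/-- If a vertex can be reached from the target of an edge `e` whose source was finished before (or
is equal to) that vertex, then `e` lies on a cycle. -/
theorem Search.reach_of_order (h : g.Search Q vis cur stk ord sp n U) {i j t : ℕ} (hji : j ≤ i)
    (hi : i < n) (ht : g.Adj (ord j) t) (hr : g.Reach t (ord i)) : g.Reach t (ord j) := by
  rcases hji.eq_or_lt with rfl | hji
  · exact hr
  -- A walk from `t` either stays among the vertices finished up to `j` or leaves them at a vertex
  -- that reaches `ord j`. As `ord i` was finished later than `ord j`, a walk to it must leave.
  have key : ∀ w, g.Reach t w → (∃ k ≤ j, ord k = w) ∨ g.Reach t (ord j) := by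
    intro w hw
    induction hw with
    | refl => exact h.order j j t le_rfl (by omega) ht
    | tail h1 h2 ih =>
      rcases ih with ⟨k, hk, rfl⟩ | ih
      · refine (h.order k j _ hk (by omega) h2).imp id fun h3 ↦ ?_
        exact (h1.tail h2).trans h3
      · exact Or.inr ih
  rcases key _ hr with ⟨k, hk, h'⟩ | h'
  · have := h.ord_inj k (by omega) i hi h'
    omega
  · exact h'

theorem Search.mono_inv {Q' : ℕ → Prop} (h : g.Search Q vis cur stk ord sp n U)
    (hQ : ∀ v, Q v → Q' v) : g.Search Q' vis cur stk ord sp n U :=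
  { h with inv := fun v hv ↦ hQ v (h.inv v hv) }

theorem search_empty (g : LinkedGraph) (Q : ℕ → Prop) :
    g.Search Q (fun _ ↦ 0) (fun _ ↦ 0) (fun _ ↦ 0) (fun _ ↦ 0) 0 0 (Finset.Icc 1 g.numEdges) := by
  constructor <;> simp
  omega

end LinkedGraph

end RAM

/-! ### The depth-first search program and its running time -/

namespace RAM

open LinkedGraph
open Program hiding cond

/-- The graph stored in register `30` and arrays `10` to `14`. -/
def Config.graph (s : Config) : LinkedGraph where
  numEdges := s.reg 30
  head := s.arr 10
  src := s.arr 11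
  tgt := s.arr 12
  mark := s.arr 13
  next := s.arr 14

def skip : Program := const 49 0

/-- Visit the vertex in register `42`. -/
def visit (b : ℕ) : Program :=
  const 45 1 ⨟ store (b + 20) 42 45 ⨟ load 48 10 42 ⨟ store (b + 21) 42 48 ⨟
  store (b + 22) 40 42 ⨟ add 40 40 45

def dfsStep (b : ℕ) : Program :=
  const 45 1 ⨟ sub 43 40 45 ⨟ load 44 (b + 22) 43 ⨟ load 46 (b + 21) 44 ⨟
  .cond 46
    (load 42 12 46 ⨟ load 47 (b + 20) 42 ⨟ .cond 47 skip (visit b) ⨟ load 47 14 46 ⨟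
      store (b + 21) 44 47)
    (store (b + 23) 41 44 ⨟ add 41 41 45 ⨟ copy 40 43)

/-- Depth-first search with the arrays `b + 20, …, b + 23`. -/
def dfs (b : ℕ) : Program := loop 40 (dfsStep b)

def Config.Searching (b : ℕ) (g : LinkedGraph) (Q : ℕ → Prop) (s : Config) (U : Finset ℕ) : Prop :=
  s.graph = g ∧
    g.Search Q (s.arr (b + 20)) (s.arr (b + 21)) (s.arr (b + 22)) (s.arr (b + 23))
      (s.reg 40) (s.reg 41) U

/-- `s'` agrees with `s` in the registers in `R` and the arrays in `A`. -/
def Config.SameOn (R A : ℕ → Prop) (s s' : Config) : Prop :=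
  (∀ r, R r → s'.reg r = s.reg r) ∧ ∀ a, A a → s'.arr a = s.arr a

/-- `s'` agrees with `s` in the registers below `k` and the arrays below `l`. -/
abbrev Config.SameBelow (k l : ℕ) (s s' : Config) : Prop :=
  s.SameOn (· < k) (· < l) s'

theorem Config.SameOn.refl (R A : ℕ → Prop) (s : Config) : s.SameOn R A s :=
  ⟨fun _ _ ↦ rfl, fun _ _ ↦ rfl⟩

theorem Config.SameOn.trans {R A : ℕ → Prop} {s s' s'' : Config} (h : s.SameOn R A s')
    (h' : s'.SameOn R A s'') : s.SameOn R A s'' :=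
  ⟨fun r hr ↦ (h'.1 r hr).trans (h.1 r hr), fun a ha ↦ (h'.2 a ha).trans (h.2 a ha)⟩

theorem Config.SameBelow.graph_eq {k l : ℕ} {s s' : Config} (h : s.SameBelow k l s') (hk : 30 < k)
    (hl : 14 < l) : s'.graph = s.graph := by
  simp only [Config.graph, h.1 30 hk, h.2 10 (by omega), h.2 11 (by omega), h.2 12 (by omega),
    h.2 13 (by omega), h.2 14 (by omega)]

/-- The program writes neither to the registers in `R` nor to the arrays in `A`. -/
@[simp] def Program.Preserves (R A : ℕ → Prop) : Program → Prop
  | .const x _ => ¬ R x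
  | .copy x _ => ¬ R x
  | .add x _ _ => ¬ R x
  | .sub x _ _ => ¬ R x
  | .load x _ _ => ¬ R x
  | .store a _ _ => ¬ A a
  | .seq P P' => P.Preserves R A ∧ P'.Preserves R A
  | .cond _ P P' => P.Preserves R A ∧ P'.Preserves R A
  | .loop _ P => P.Preserves R A

theorem Exec.sameOn {P : Program} {s s' : Config} {t : ℕ} {R A : ℕ → Prop} (h : Exec P s s' t)
    (hP : P.Preserves R A) : s.SameOn R A s' := by
  have hreg : ∀ (s : Config) (x v : ℕ), ¬ R x → s.SameOn R A (s.setReg x v) :=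
    fun s x v hx ↦ ⟨fun r hr ↦ by
      rw [Config.reg_setReg, if_neg]
      rintro rfl
      exact hx hr, fun _ _ ↦ rfl⟩
  have harr : ∀ (s : Config) (a i v : ℕ), ¬ A a → s.SameOn R A (s.setArr a i v) :=
    fun s a i v ha ↦ ⟨fun _ _ ↦ rfl, fun b hb ↦ by
      rw [Config.arr_setArr, if_neg]
      rintro rfl
      exact ha hb⟩
  induction h with
  | const => exact hreg _ _ _ hP
  | copy => exact hreg _ _ _ hP
  | add => exact hreg _ _ _ hP
  | sub => exact hreg _ _ _ hP
  | load => exact hreg _ _ _ hP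
  | store => exact harr _ _ _ _ hP
  | seq _ _ ih ih' => exact (ih hP.1).trans (ih' hP.2)
  | cond_true _ _ ih => exact ih hP.1
  | cond_false _ _ ih => exact ih hP.2
  | loop_true _ _ _ ih ih' => exact (ih hP).trans (ih' hP)
  | loop_false => exact .refl _ _ _

theorem Wp.sameOn {P : Program} {s : Config} {c : ℕ} {R A : ℕ → Prop} {Φ : Config → ℕ → Prop}
    (hP : P.Preserves R A) (h : Wp P s c Φ) :
    Wp P s c fun s' c' ↦ s.SameOn R A s' ∧ Φ s' c' := by
  obtain ⟨s', t, c', h1, h2, h3⟩ := h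
  exact ⟨s', t, c', h1, h2, h1.sameOn hP, h3⟩

theorem Program.LoopFree.run_sameOn {P : Program} (h : P.LoopFree) {R A : ℕ → Prop}
    (hP : P.Preserves R A) (s : Config) : s.SameOn R A (P.run s) := by
  obtain ⟨t, -, h1⟩ := h.exec_run s
  exact h1.sameOn hP

variable {b : ℕ} {g : LinkedGraph} {Q : ℕ → Prop} {s : Config} {U : Finset ℕ} {c : ℕ}

theorem visit_spec (h : s.Searching b g Q U) (hg : g.Wf) (hv : s.arr (b + 20) (s.reg 42) = 0)
    (hQ : Q (s.reg 42))
    (htop : ∀ i, i + 1 = s.reg 40 → g.Reach (s.arr (b + 22) i) (s.reg 42)) :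
    ((visit b).run s).Searching b g Q U ∧ ((visit b).run s).reg 40 = s.reg 40 + 1 ∧
      ((visit b).run s).reg 41 = s.reg 41 ∧
      ((visit b).run s).reg 44 = s.reg 44 ∧ ((visit b).run s).reg 46 = s.reg 46 ∧
      ((visit b).run s).arr (b + 20) = Function.update (s.arr (b + 20)) (s.reg 42) 1 ∧
      ((visit b).run s).arr (b + 21) =
        Function.update (s.arr (b + 21)) (s.reg 42) (g.head (s.reg 42)) := by
  obtain ⟨h0, h1⟩ := h
  have := h1.push hg hv hQ htop
  have hh : s.arr 10 = g.head := by rw [← h0]; rfl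
  refine ⟨⟨?_, ?_⟩, ?_⟩
  · rw [← h0]
    refine Config.SameBelow.graph_eq (k := 40) (l := 20) ?_ (by norm_num) (by norm_num)
    exact LoopFree.run_sameOn (by simp [visit]) (by simp [visit]) _
  · simpa [visit, hh] using this
  · simp [visit, hh]

/-- The potential charges 150 per unscanned edge, 90 per active and 60 per finished vertex. Scanning
an edge frees 150, of which at most 90 pay for a new vertex; finishing a vertex frees 30. So every
step frees at least 30, enough for its own cost and the loop test. -/
theorem dfsStep_spec (h : s.Searching b g Q U) (hg : g.Wf) (hQ : ∀ u v, Q u → g.Adj u v → Q v)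
    (hsp : s.reg 40 ≠ 0) :
    ∃ U', ((dfsStep b).run s).Searching b g Q U' ∧
      (∀ v, s.arr (b + 20) v ≠ 0 → ((dfsStep b).run s).arr (b + 20) v ≠ 0) ∧
      150 * U'.card + 90 * ((dfsStep b).run s).reg 40 + 60 * ((dfsStep b).run s).reg 41 + 30 ≤
        150 * U.card + 90 * s.reg 40 + 60 * s.reg 41 := by
  obtain ⟨k, hk⟩ := Nat.exists_eq_succ_of_ne_zero hsp
  set u := s.arr (b + 22) k with hu
  have hgr : ∀ s', s.SameBelow 40 20 s' → s'.graph = g := fun s' h' ↦ by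
    rw [h'.graph_eq (by norm_num) (by norm_num), h.1]
  have hvis : s.arr (b + 20) u ≠ 0 := (h.2.vis_iff u).2 (Or.inl ⟨k, by omega, rfl⟩)
  have htg : s.arr 12 = g.tgt := by rw [← h.1]; rfl
  have hnx : s.arr 14 = g.next := by rw [← h.1]; rfl
  have hhd : s.arr 10 = g.head := by rw [← h.1]; rfl
  have hsame : s.SameBelow 40 20 ((dfsStep b).run s) :=
    LoopFree.run_sameOn (by simp [dfsStep, visit, skip]) (by simp [dfsStep, visit, skip]) _
  have hgr := hgr _ hsame
  by_cases hc : s.arr (b + 21) u = 0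
  · have h2 := h.2
    rw [hk] at h2
    have := h2.pop hc
    refine ⟨U, ⟨hgr, ?_⟩, ?_, ?_⟩
    · simpa [dfsStep, hk, ← hu, hc] using this
    · intro v hv
      simpa [dfsStep, hk, ← hu, hc] using hv
    · simp [dfsStep, hk, ← hu, hc]
      omega
  · have hadj : g.Adj u (g.tgt (s.arr (b + 21) u)) := by
      obtain ⟨h1, h2⟩ := h.2.cur_edge u hvis hc
      exact ⟨_, by omega, h1, h2, rfl⟩
    have hmem := h.2.cur_mem hvis hc
    have hcard : (U.erase (s.arr (b + 21) u)).card + 1 = U.card :=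
      Finset.card_erase_add_one hmem
    refine ⟨U.erase (s.arr (b + 21) u), ⟨hgr, ?_⟩, ?_⟩
    · by_cases ht : s.arr (b + 20) (g.tgt (s.arr (b + 21) u)) = 0
      · have h1 := h.2.push hg ht (hQ _ _ (h.2.inv u hvis) hadj) (fun i hi ↦ by
          obtain rfl : i = k := by omega
          exact .single hadj)
        have hne : u ≠ g.tgt (s.arr (b + 21) u) := fun h' ↦ hvis (by rw [h', ht])
        have h2 := h1.scan hg (u := u) (by
          rw [Function.update_of_ne hne]; exact hvis) (by
          rw [Function.update_of_ne hne]; exact hc) (by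
          rw [Function.update_of_ne hne, Function.update_self]; simp)
        rw [Function.update_of_ne hne] at h2
        simpa [dfsStep, visit, hk, ← hu, hc, htg, hhd, hnx, ht] using h2
      · simpa [dfsStep, skip, hk, ← hu, hc, htg, ht, hhd, hnx] using h.2.scan hg hvis hc ht
    · by_cases ht : s.arr (b + 20) (g.tgt (s.arr (b + 21) u)) = 0
      · constructor
        · intro v hv
          simp [dfsStep, visit, hk, ← hu, hc, htg, ht, Function.update_apply]
          split_ifs
          · simp
          · exact hv
        · simp [dfsStep, visit, hk, ← hu, hc, htg, ht]
          omega
      · constructor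
        · intro v hv
          simpa [dfsStep, skip, hk, ← hu, hc, htg, ht] using hv
        · simp [dfsStep, skip, hk, ← hu, hc, htg, ht]
          omega

/-- The 60 units per finished vertex are not spent by the search; they later pay for the loop over
the finishing order. `rest` is time reserved by the caller. -/
theorem dfs_spec (h : s.Searching b g Q U) (hg : g.Wf) (hQ : ∀ u v, Q u → g.Adj u v → Q v)
    (rest : ℕ) (hc : 150 * U.card + 90 * s.reg 40 + 60 * s.reg 41 + 1 + rest ≤ c) :
    Wp (dfs b) s c fun s' c' ↦ s.SameBelow 40 (b + 20) s' ∧ ∃ U', s'.Searching b g Q U' ∧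
      s'.reg 40 = 0 ∧ (∀ v, s.arr (b + 20) v ≠ 0 → s'.arr (b + 20) v ≠ 0) ∧
      150 * U'.card + 60 * s'.reg 41 + rest ≤ c' := by
  refine Wp.sameOn (by simp [dfs, dfsStep, visit, skip]) ?_
  refine Wp.loop (fun s' c' ↦ ∃ U', s'.Searching b g Q U' ∧
    (∀ v, s.arr (b + 20) v ≠ 0 → s'.arr (b + 20) v ≠ 0) ∧
    150 * U'.card + 90 * s'.reg 40 + 60 * s'.reg 41 + 1 + rest ≤ c') ⟨U, h, fun _ ↦ id, hc⟩ ?_ ?_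
  · rintro s' c' ⟨U', h1, h2, h3⟩ hx
    obtain ⟨U'', h4, h5, h6⟩ := dfsStep_spec h1 hg hQ hx
    refine ⟨by omega, Wp.of_loopFree (by simp [dfsStep, visit, skip]) ?_ ⟨U'', h4,
      fun v hv ↦ h5 v (h2 v hv), ?_⟩⟩
    · simp [dfsStep, visit, skip]
      omega
    · simp only [dfsStep, visit, skip, cost]
      simp only [dfsStep, visit, skip] at h6
      omega
  · rintro s' c' ⟨U', h1, h2, h3⟩ hx
    exact ⟨by omega, U', h1, hx, h2, by omega⟩

end RAM

/-! ### The second search: the largest mark on a cycle -/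

namespace RAM

open LinkedGraph
open Program hiding cond

/-- Handle the edge in register `35`, with source in register `34`: if it is marked, visit its
target in a second search; if this search has reached the source, increase register `0` to the
mark. -/
def scanEdge : Program :=
  (load 36 13 35 ⨟ load 42 12 35 ⨟ load 37 24 42 ⨟ .cond 36 (.cond 37 skip (visit 4)) skip) ⨟
  dfs 4 ⨟
  (load 37 24 34 ⨟ .cond 37 (sub 37 36 0 ⨟ add 0 0 37) skip ⨟ load 35 14 35)

/-- Array `23` holds the finishing order of the first search, register `32` the current rank and
register `33` the number of vertices left. -/
def scanVertex : Program :=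
  (load 34 23 32 ⨟ load 35 10 34) ⨟ loop 35 scanEdge ⨟ (const 38 1 ⨟ add 32 32 38 ⨟ sub 33 33 38)

/-- Compute the maximal mark of an edge on a cycle. -/
def maxCycleMark : Program :=
  (const 42 0 ⨟ visit 0) ⨟ dfs 0 ⨟ (copy 33 41 ⨟ const 41 0 ⨟ const 32 0) ⨟ loop 33 scanVertex

namespace LinkedGraph

variable (g : LinkedGraph)

/-- `e` is a marked edge on a cycle. -/
structure OnCycle (e : ℕ) : Prop where
  pos : 1 ≤ e
  le : e ≤ g.numEdges
  mark : g.mark e ≠ 0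
  reach : g.Reach (g.tgt e) (g.src e)

/-- `m` is zero or the mark of an edge reachable from a cycle with a marked edge. -/
def Attained (m : ℕ) : Prop :=
  m = 0 ∨ ∃ e₀ e, 1 ≤ e₀ ∧ e₀ ≤ g.numEdges ∧ g.mark e₀ = m ∧ g.OnCycle e ∧
    g.Reach (g.tgt e) (g.src e₀)

/-- `w` can be reached through a marked edge with source among the first `i` vertices of `x`. -/
def MarkReach (x : ℕ → ℕ) (i w : ℕ) : Prop :=
  ∃ e, 1 ≤ e ∧ e ≤ g.numEdges ∧ g.mark e ≠ 0 ∧ (∃ j < i, x j = g.src e) ∧ g.Reach (g.tgt e) w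

variable {g} in
theorem MarkReach.succ {x : ℕ → ℕ} {i w : ℕ} (h : g.MarkReach x i w) : g.MarkReach x (i + 1) w := by
  obtain ⟨e, h1, h2, h3, ⟨j, hj, h4⟩, h5⟩ := h
  exact ⟨e, h1, h2, h3, ⟨j, by omega, h4⟩, h5⟩

end LinkedGraph

/-- The part of the invariant common to both loops of the second search. -/
structure Config.Scanning (g : LinkedGraph) (x : ℕ → ℕ) (n i i' : ℕ) (U : Finset ℕ) (s : Config) :
    Prop where
  searching : s.Searching 4 g (g.MarkReach x i') U
  reg_40 : s.reg 40 = 0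
  arr_23 : s.arr 23 = x
  reg_32 : s.reg 32 = i
  reg_33 : s.reg 33 + i = n
  attained : g.Attained (s.reg 0)

variable {g : LinkedGraph} {x : ℕ → ℕ} {n i : ℕ} {s : Config} {c : ℕ}

/-- The invariant of the loop over the edges with source `x i`. -/
def Config.ScanningEdges (g : LinkedGraph) (x : ℕ → ℕ) (n i rest : ℕ) (s : Config) (c : ℕ) : Prop :=
  ∃ U V : Finset ℕ, s.Scanning g x n i (i + 1) U ∧ s.reg 34 = x i ∧
    (s.reg 35 ≠ 0 → s.reg 35 ≤ g.numEdges ∧ g.src (s.reg 35) = x i) ∧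
    (∀ e, g.OnCycle e → (∃ j < i, x j = g.src e) ∨ (g.src e = x i ∧ s.reg 35 < e) →
      g.mark e ≤ s.reg 0) ∧
    (∀ e, 1 ≤ e → e ≤ g.numEdges →
      (∃ j, i < j ∧ j < n ∧ x j = g.src e) ∨ (g.src e = x i ∧ e ≤ s.reg 35) → e ∈ V) ∧
    150 * U.card + 60 * s.reg 41 + 150 * V.card + rest ≤ c

/-- Completeness: if the marked edge lies on a cycle, its target is visited and the visited set is
closed, so its source is visited too. Soundness is weaker: a visited source may be due to an earlier
edge, but the finishing order then puts that edge on a cycle, which is what `Attained` records. -/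
theorem scanEdge_spec {Q₁ : ℕ → Prop} {vis cur stk : ℕ → ℕ} {U₁ : Finset ℕ} {rest : ℕ}
    (h₁ : g.Search Q₁ vis cur stk x 0 n U₁) (hg : g.Wf) (hi : i < n)
    (h : s.ScanningEdges g x n i rest c) (h35 : s.reg 35 ≠ 0) :
    1 ≤ c ∧ Wp scanEdge s (c - 1) (Config.ScanningEdges g x n i rest) := by
  obtain ⟨U, V, hs, h34, hptr, hdone, hV, hc⟩ := h
  obtain ⟨hle, hsrc⟩ := hptr h35
  set e := s.reg 35 with he
  have hmem : e ∈ V := hV e (by omega) hle (Or.inr ⟨hsrc, le_rfl⟩)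
  have hcard := Finset.card_erase_add_one hmem
  have htg : s.arr 12 = g.tgt := by rw [← hs.searching.1]; rfl
  have hmk : s.arr 13 = g.mark := by rw [← hs.searching.1]; rfl
  refine ⟨by omega, Wp.seq (Wp.of_loopFree (by simp [visit, skip]) (by simp [visit, skip]; omega)
    ?_)⟩
  set B := load 36 13 35 ⨟ load 42 12 35 ⨟ load 37 24 42 ⨟
    Program.cond 36 (.cond 37 skip (visit 4)) skip with hB
  have hcost : B.cost = 11 := by simp [hB, visit, skip]
  have hBs : s.SameBelow 36 20 (B.run s) :=
    LoopFree.run_sameOn (by simp [hB, visit, skip]) (by simp [hB, visit, skip]) _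
  have hBa : ∀ a < 24, (B.run s).arr a = s.arr a := fun a ha ↦
    (LoopFree.run_sameOn (R := (· < 36)) (A := (· < 24)) (by simp [hB, visit, skip])
      (by simp [hB, visit, skip]) s).2 a ha
  have key : (B.run s).Searching 4 g (g.MarkReach x (i + 1)) U ∧ (B.run s).reg 40 ≤ 1 ∧
      (B.run s).reg 41 = s.reg 41 ∧ (B.run s).reg 36 = g.mark e ∧
      (g.mark e ≠ 0 → (B.run s).arr 24 (g.tgt e) ≠ 0) := by
    set s₁ := ((s.setReg 36 (g.mark e)).setReg 42 (g.tgt e)).setReg 37 (s.arr 24 (g.tgt e))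
      with hs₁
    have hs₁' : s₁.Searching 4 g (g.MarkReach x (i + 1)) U := by
      obtain ⟨h1, h2⟩ := hs.searching
      refine ⟨h1, ?_⟩
      simpa [hs₁] using h2
    have h40 : s₁.reg 40 = 0 := by simp [hs₁, hs.reg_40]
    have hskip : s₁.Searching 4 g (g.MarkReach x (i + 1)) U →
        (s₁.setReg 49 0).Searching 4 g (g.MarkReach x (i + 1)) U := by
      rintro ⟨h1, h2⟩
      exact ⟨h1, by simpa using h2⟩
    by_cases hm : g.mark e = 0
    · have : B.run s = s₁.setReg 49 0 := by simp [hB, hs₁, ← he, htg, hmk, hm, skip]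
      rw [this]
      refine ⟨hskip hs₁', by simp [h40], by simp [hs₁], by simp [hs₁], fun h ↦ absurd hm h⟩
    by_cases ht : s.arr 24 (g.tgt e) = 0
    · have : B.run s = (visit 4).run s₁ := by simp [hB, hs₁, ← he, htg, hmk, hm, ht]
      rw [this]
      obtain ⟨h1, h2, h3, -, -, h6, -⟩ := visit_spec (s := s₁) hs₁' hg (by simpa [hs₁] using ht)
        (by
          simp only [hs₁, Config.reg_setReg]
          exact ⟨e, by omega, hle, hm, ⟨i, by omega, hsrc.symm⟩, .refl⟩)
        (fun j hj ↦ by omega)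
      refine ⟨h1, by omega, ?_, ?_, fun _ ↦ ?_⟩
      · rw [h3]
        simp [hs₁]
      · simp [visit, hs₁]
      · rw [show (24 : ℕ) = 4 + 20 from rfl, h6]
        simp [hs₁]
    · have : B.run s = s₁.setReg 49 0 := by simp [hB, hs₁, ← he, htg, hmk, hm, ht, skip]
      rw [this]
      exact ⟨hskip hs₁', by simp [h40], by simp [hs₁], by simp [hs₁], fun _ ↦ by
        simpa [hs₁] using ht⟩
  obtain ⟨k1, k2, k3, k4, k5⟩ := key
  have hQ : ∀ u v, g.MarkReach x (i + 1) u → g.Adj u v → g.MarkReach x (i + 1) v := by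
    rintro u v ⟨e, h1, h2, h3, h4, h5⟩ hadj
    exact ⟨e, h1, h2, h3, h4, h5.tail hadj⟩
  -- Removing `e` from `V` frees 150 units: 12 for the test and the first block, 90 for a vertex
  -- pushed as root, 1 for the last test of the search and 5 for the final block.
  refine Wp.seq (Wp.mono (dfs_spec k1 hg hQ (150 * (V.erase e).card + rest + 5) ?_) ?_)
  · rw [hcost, k3]
    omega
  rintro s₂ c₂ ⟨hss, U', hs', h40, hmono, hc₂⟩
  have h36 : s₂.reg 36 = g.mark e := by rw [hss.1 36 (by norm_num), k4]
  have h35' : s₂.reg 35 = e := by rw [hss.1 35 (by norm_num), hBs.1 35 (by norm_num)]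
  have h34' : s₂.reg 34 = x i := by rw [hss.1 34 (by norm_num), hBs.1 34 (by norm_num), h34]
  have h33 : s₂.reg 33 = s.reg 33 := by rw [hss.1 33 (by norm_num), hBs.1 33 (by norm_num)]
  have h32 : s₂.reg 32 = s.reg 32 := by rw [hss.1 32 (by norm_num), hBs.1 32 (by norm_num)]
  have h0 : s₂.reg 0 = s.reg 0 := by rw [hss.1 0 (by norm_num), hBs.1 0 (by norm_num)]
  have h23 : s₂.arr 23 = x := by rw [hss.2 23 (by norm_num), hBa 23 (by norm_num), hs.arr_23]
  have hnx : s₂.arr 14 = g.next := by rw [← hs'.1]; rfl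
  have hvis : g.mark e ≠ 0 → s₂.arr 24 (g.tgt e) ≠ 0 := fun h ↦ hmono _ (k5 h)
  have hsearch := hs'.2
  rw [h40] at hsearch
  set B' := load 37 24 34 ⨟ Program.cond 37 (sub 37 36 0 ⨟ add 0 0 37) skip ⨟ load 35 14 35 with hB'
  obtain ⟨r0, r1, r2, r3, r4, r5, r6, r7⟩ : (B'.run s₂).reg 30 = s₂.reg 30 ∧
      (B'.run s₂).arr = s₂.arr ∧ (B'.run s₂).reg 32 = s₂.reg 32 ∧
      (B'.run s₂).reg 33 = s₂.reg 33 ∧ (B'.run s₂).reg 34 = s₂.reg 34 ∧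
      (B'.run s₂).reg 40 = s₂.reg 40 ∧ (B'.run s₂).reg 41 = s₂.reg 41 ∧
      (B'.run s₂).reg 35 = g.next e := by
    by_cases hv : s₂.arr 24 (x i) = 0 <;> simp [hB', skip, h34', h35', hv, hnx]
  have hg' : (B'.run s₂).graph = g := by
    simp only [Config.graph, r0, r1]
    exact hs'.1
  obtain ⟨ha, ha', hv⟩ : ((B'.run s₂).reg 0 = s.reg 0 ∨
      (s₂.arr 24 (x i) ≠ 0 ∧ (B'.run s₂).reg 0 = g.mark e)) ∧
      s.reg 0 ≤ (B'.run s₂).reg 0 ∧ (s₂.arr 24 (x i) ≠ 0 → g.mark e ≤ (B'.run s₂).reg 0) := by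
    by_cases hv : s₂.arr 24 (x i) = 0
    · simp [hB', skip, h34', h0, hv]
    · simp [hB', skip, h34', h0, hv, h36]
      omega
  refine Wp.of_loopFree (by simp [hB', skip]) (by simp [hB', skip]; omega) ?_
  have hcost' : B'.cost = 5 := by simp [hB', skip]
  refine ⟨U', V.erase e, ⟨⟨hg', ?_⟩, by omega, by rw [r1, h23], by rw [r2, h32, hs.reg_32],
    by rw [r3, h33, hs.reg_33], ?_⟩, by rw [r4, h34'], ?_, ?_, ?_, ?_⟩
  · rw [r1, r5, r6]
    exact hs'.2
  · rcases ha with ha | ⟨hv', ha⟩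
    · rw [ha]
      exact hs.attained
    · rw [ha]
      refine Or.inr ⟨e, ?_⟩
      -- The edge `e'` through which `x i` was reached has a source finished no later than `x i`, so
      -- `reach_of_order` puts `e'` on a cycle.
      obtain ⟨e', h1, h2, h3, ⟨j, hj, h4⟩, h5⟩ := hs'.2.inv (x i) hv'
      refine ⟨e', by omega, hle, rfl, ⟨h1, h2, h3, ?_⟩, by rw [hsrc]; exact h5⟩
      rw [← h4]
      exact h₁.reach_of_order (by omega) hi ⟨e', h1, h2, h4.symm, rfl⟩ h5
  · rw [r7]
    intro h'
    have h1 := hg.next_src e (by omega) hle h'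
    have h2 := hg.next_lt e (by omega) hle
    exact ⟨by omega, by rw [h1, hsrc]⟩
  · intro e' hc' h'
    rcases h' with h' | ⟨h', hlt⟩
    · exact (hdone e' hc' (Or.inl h')).trans ha'
    · rw [r7] at hlt
      rcases lt_trichotomy e e' with h'' | rfl | h''
      · exact (hdone e' hc' (Or.inr ⟨h', h''⟩)).trans ha'
      · refine hv ?_
        rw [← h']
        exact hsearch.vis_of_reach (hvis hc'.mark) hc'.reach
      · exact absurd (h'.trans hsrc.symm) (hg.next_max e (by omega) hle e' hlt h'')
  · intro e' h1 h2 h3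
    rw [r7] at h3
    have hlt := hg.next_lt e (by omega) hle
    rw [Finset.mem_erase]
    rcases h3 with ⟨j, hj, hjn, h3⟩ | ⟨h3, h4⟩
    · refine ⟨?_, hV e' h1 h2 (Or.inl ⟨j, hj, hjn, h3⟩)⟩
      rintro rfl
      have := h₁.ord_inj j hjn i hi (h3.trans hsrc)
      omega
    · exact ⟨by omega, hV e' h1 h2 (Or.inr ⟨h3, by omega⟩)⟩
  · rw [r6, hcost']
    omega

/-- The invariant of the loop over the vertices. -/
def Config.ScanningVertices (g : LinkedGraph) (x : ℕ → ℕ) (n : ℕ) (s : Config) (c : ℕ) : Prop :=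
  ∃ i, ∃ U V : Finset ℕ, s.Scanning g x n i i U ∧
    (∀ e, g.OnCycle e → (∃ j < i, x j = g.src e) → g.mark e ≤ s.reg 0) ∧
    (∀ e, 1 ≤ e → e ≤ g.numEdges → (∃ j, i ≤ j ∧ j < n ∧ x j = g.src e) → e ∈ V) ∧
    150 * U.card + 60 * s.reg 41 + 150 * V.card + 30 * s.reg 33 + 1 ≤ c

theorem scanVertex_spec {Q₁ : ℕ → Prop} {vis cur stk : ℕ → ℕ} {U₁ : Finset ℕ}
    (h₁ : g.Search Q₁ vis cur stk x 0 n U₁) (hg : g.Wf)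
    (h : s.ScanningVertices g x n c) (h33 : s.reg 33 ≠ 0) :
    1 ≤ c ∧ Wp scanVertex s (c - 1) (Config.ScanningVertices g x n) := by
  obtain ⟨i, U, V, hs, hdone, hV, hc⟩ := h
  have hi : i < n := by have := hs.reg_33; omega
  have hhd : s.arr 10 = g.head := by rw [← hs.searching.1]; rfl
  refine ⟨by omega, Wp.seq (Wp.of_loopFree (by simp) (by simp; omega) ?_)⟩
  refine Wp.seq (Wp.loop (Config.ScanningEdges g x n i (30 * (s.reg 33 - 1) + 10)) ?_
    (fun s c h h35 ↦ scanEdge_spec h₁ hg hi h h35) ?_)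
  · refine ⟨U, V, ⟨⟨hs.searching.1, ?_⟩, ?_, hs.arr_23, ?_, ?_, ?_⟩, ?_, ?_, ?_, ?_, ?_⟩
    · simpa using (hs.searching.2.mono_inv fun v hv ↦ hv.succ)
    · simpa using hs.reg_40
    · simpa using hs.reg_32
    · simpa using hs.reg_33
    · simpa using hs.attained
    · simp [hs.arr_23, hs.reg_32]
    · simp only [run, Config.reg_setReg, Config.arr_setReg, hs.arr_23, hs.reg_32, hhd]
      exact fun h ↦ ⟨hg.head_le _, hg.head_src _ h⟩
    · simp only [run, Config.reg_setReg, Config.arr_setReg, hs.arr_23, hs.reg_32, hhd]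
      rintro e he (h | ⟨h, h'⟩)
      · exact hdone e he h
      · exact absurd h (hg.head_max _ _ (by simpa using h') he.le)
    · rintro e h1 h2 (⟨j, h3, h4⟩ | ⟨h3, -⟩)
      · exact hV e h1 h2 ⟨j, h3.le, h4⟩
      · exact hV e h1 h2 ⟨i, le_rfl, hi, h3.symm⟩
    · simp
      omega
  · rintro s' c' ⟨U', V', hs', h34, -, hdone', hV', hc'⟩ h35
    have h33' := hs'.reg_33
    have h33'' := hs.reg_33
    refine ⟨by omega, Wp.of_loopFree (by simp) (by simp; omega) ⟨i + 1, U', V',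
      ⟨⟨hs'.searching.1, ?_⟩, ?_, hs'.arr_23, ?_, ?_, ?_⟩, ?_, ?_, ?_⟩⟩
    · simpa using hs'.searching.2
    · simpa using hs'.reg_40
    · simp [hs'.reg_32]
    · simp
      omega
    · simpa using hs'.attained
    · rintro e he ⟨j, hj, h⟩
      simp only [run, Config.reg_setReg]
      refine hdone' e he ?_
      rcases Nat.lt_succ_iff_lt_or_eq.1 hj with hj | rfl
      · exact Or.inl ⟨j, hj, h⟩
      · exact Or.inr ⟨h.symm, by rw [h35]; exact he.pos⟩
    · rintro e h1 h2 ⟨j, h3, h4⟩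
      exact hV' e h1 h2 (Or.inl ⟨j, h3, h4⟩)
    · simp
      omega

/-- Each edge is charged 150 in the first search, 150 in the second and 150 in the scan of the
adjacency lists. By `hroot` a single search from vertex `0` finds every source, so vertices need not
be enumerated. -/
theorem maxCycleMark_spec (hg : s.graph.Wf) (h0 : s.reg 0 = 0) (h40 : s.reg 40 = 0)
    (h41 : s.reg 41 = 0) (harr : ∀ a, 20 ≤ a → s.arr a = fun _ ↦ 0)
    (hroot : ∀ e, 1 ≤ e → e ≤ s.graph.numEdges → s.graph.Reach 0 (s.graph.src e))
    (hc : 450 * s.graph.numEdges + 200 ≤ c) :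
    Wp maxCycleMark s c fun s' _ ↦ s.graph.Attained (s'.reg 0) ∧
      ∀ e, s.graph.OnCycle e → s.graph.mark e ≤ s'.reg 0 := by
  set g := s.graph with hgdef
  have hinit : ∀ Q, g.Search Q (fun _ ↦ 0) (fun _ ↦ 0) (fun _ ↦ 0) (fun _ ↦ 0) 0 0
    (Finset.Icc 1 g.numEdges) := search_empty g
  have hcard : (Finset.Icc 1 g.numEdges).card = g.numEdges := by simp
  refine Wp.seq (Wp.of_loopFree (by simp [visit]) (by simp [visit]; omega) ?_)
  obtain ⟨k1, k2, k3, -, -, k6, -⟩ := visit_spec (b := 0) (s := s.setReg 42 0) (g := g)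
    (Q := fun _ ↦ True) (U := Finset.Icc 1 g.numEdges) ⟨rfl, by
      simpa [h40, h41, harr] using hinit _⟩ hg
    (by simp [harr]) trivial (fun i hi ↦ by simp [h40] at hi)
  have hcost : (const 42 0 ⨟ visit 0).cost = 7 := by simp [visit]
  have ksame : s.SameBelow 40 20 ((visit 0).run (s.setReg 42 0)) :=
    LoopFree.run_sameOn (P := const 42 0 ⨟ visit 0) (by simp [visit]) (by simp [visit]) s
  have kzero : ∀ a, 24 ≤ a → ((visit 0).run (s.setReg 42 0)).arr a = fun _ ↦ 0 := by
    intro a ha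
    rw [← harr a (by omega)]
    simp [visit]
    split_ifs <;> first | omega | rfl
  refine Wp.seq (Wp.mono (Wp.sameOn (R := fun _ ↦ False) (A := (24 ≤ ·))
    (by simp [dfs, dfsStep, visit, skip])
    (dfs_spec k1 hg (fun _ _ _ _ ↦ trivial) (300 * g.numEdges + 50) ?_)) ?_)
  · rw [hcost, k2, k3, hcard]
    simp [h40, h41]
    omega
  rintro s₂ c₂ ⟨⟨-, hz⟩, hss, U', hs₂, h40', hmono, hc₂⟩
  have hzero : ∀ a, 24 ≤ a → s₂.arr a = fun _ ↦ 0 := fun a ha ↦ (hz a ha).trans (kzero a ha)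
  have h0' : s₂.reg 0 = 0 := by rw [hss.1 0 (by norm_num), ksame.1 0 (by norm_num), h0]
  have hsearch := hs₂.2
  rw [h40'] at hsearch
  refine Wp.seq (Wp.of_loopFree (by simp) (by simp; omega) ?_)
  refine Wp.loop (Config.ScanningVertices g (s₂.arr 23) (s₂.reg 41)) ?_
    (fun s c h h33 ↦ scanVertex_spec hsearch hg h h33) ?_
  · refine ⟨0, Finset.Icc 1 g.numEdges, Finset.Icc 1 g.numEdges, ⟨⟨hs₂.1, ?_⟩, ?_, rfl, ?_, ?_, ?_⟩,
      ?_, ?_, ?_⟩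
    · simpa [h40', hzero] using hinit _
    · simp [h40']
    · simp
    · simp
    · exact Or.inl (by simp [h0'])
    · rintro e - ⟨j, hj, -⟩
      omega
    · intro e h1 h2 _
      simp [h1, h2]
    · simp
      omega
  · rintro s' c' ⟨i, U, V, hs, hdone, -, hc'⟩ h33
    refine ⟨by omega, hs.attained, fun e he ↦ hdone e he ?_⟩
    have hi := hs.reg_33
    have hv : s₂.arr 20 (g.src e) ≠ 0 := by
      refine hsearch.vis_of_reach (hmono 0 ?_) (hroot e he.pos he.le)
      rw [k6]
      simp
    rcases (hsearch.vis_iff _).1 hv with ⟨j, hj, -⟩ | ⟨j, hj, h⟩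
    · omega
    · exact ⟨j, by omega, h⟩

end RAM

namespace RAM

open LinkedGraph
open Program hiding cond

/-! ### Building graphs -/

namespace LinkedGraph

/-- Add the edge `numEdges + 1` from `u` to `v` with mark `m`. -/
def addEdge (g : LinkedGraph) (u v m : ℕ) : LinkedGraph where
  numEdges := g.numEdges + 1
  src := Function.update g.src (g.numEdges + 1) u
  tgt := Function.update g.tgt (g.numEdges + 1) v
  mark := Function.update g.mark (g.numEdges + 1) m
  next := Function.update g.next (g.numEdges + 1) (g.head u)
  head := Function.update g.head u (g.numEdges + 1)

/-- The edges as triples of source, target and mark. -/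
def edges (g : LinkedGraph) : Set (ℕ × ℕ × ℕ) :=
  {x | ∃ e, 1 ≤ e ∧ e ≤ g.numEdges ∧ (g.src e, g.tgt e, g.mark e) = x}

variable {g : LinkedGraph} {E : Set (ℕ × ℕ × ℕ)}

/-- The new edge has the largest number and becomes the head of its list, so the lists stay
decreasing. -/
theorem Wf.addEdge (hg : g.Wf) (u v m : ℕ) : (g.addEdge u v m).Wf where
  next_lt e h1 h2 := by
    have := hg.head_le u
    simp only [LinkedGraph.addEdge, Function.update_apply] at h2 ⊢
    split_ifs
    · omega
    · exact hg.next_lt e h1 (by omega)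
  next_src e h1 h2 h3 := by
    have := hg.head_le u
    simp only [LinkedGraph.addEdge, Function.update_apply] at h2 h3 ⊢
    by_cases he : e = g.numEdges + 1
    · rw [if_pos he] at h3 ⊢
      rw [if_neg (by omega), if_pos he]
      exact hg.head_src u h3
    · rw [if_neg he] at h3 ⊢
      have := hg.next_lt e h1 (by omega)
      rw [if_neg (by omega), if_neg he]
      exact hg.next_src e h1 (by omega) h3
  next_max e h1 h2 e' h3 h4 := by
    simp only [LinkedGraph.addEdge, Function.update_apply] at h2 h3 ⊢
    by_cases he : e = g.numEdges + 1
    · rw [if_pos he] at h3 ⊢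
      rw [if_neg (by omega)]
      exact hg.head_max u e' h3 (by omega)
    · rw [if_neg he] at h3 ⊢
      rw [if_neg (by omega)]
      exact hg.next_max e h1 (by omega) e' h3 h4
  head_le w := by
    have := hg.head_le w
    simp only [LinkedGraph.addEdge, Function.update_apply]
    split_ifs <;> omega
  head_src w h := by
    simp only [LinkedGraph.addEdge, Function.update_apply] at h ⊢
    by_cases hw : w = u
    · rw [if_pos hw, if_pos rfl, hw]
    · have := hg.head_le w
      rw [if_neg hw] at h ⊢
      rw [if_neg (by omega)]
      exact hg.head_src w h
  head_max w e h1 h2 := by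
    simp only [LinkedGraph.addEdge, Function.update_apply] at h1 h2 ⊢
    by_cases hw : w = u
    · rw [if_pos hw] at h1
      omega
    · rw [if_neg hw] at h1
      split_ifs
      · exact Ne.symm hw
      · exact hg.head_max w e h1 (by omega)

theorem edges_addEdge (g : LinkedGraph) (u v m : ℕ) :
    (g.addEdge u v m).edges = insert (u, v, m) g.edges := by
  ext x
  simp only [edges, LinkedGraph.addEdge, Set.mem_insert_iff]
  constructor
  · rintro ⟨e, h1, h2, rfl⟩
    by_cases he : e = g.numEdges + 1
    · subst he
      left
      simp
    · right
      exact ⟨e, h1, by omega, by simp [Function.update_of_ne he]⟩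
  · rintro (rfl | ⟨e, h1, h2, rfl⟩)
    · exact ⟨g.numEdges + 1, by omega, le_rfl, by simp⟩
    · exact ⟨e, h1, by omega, by simp [Function.update_of_ne (by omega : e ≠ g.numEdges + 1)]⟩

/-- The edges of `g` are those in `E` and an edge from `0` to every source of an edge in `E`. -/
structure Stores (g : LinkedGraph) (E : Set (ℕ × ℕ × ℕ)) : Prop where
  wf : g.Wf
  edges_eq : g.edges = E ∪ (fun x ↦ (0, x.1, 0)) '' E

/-- Add an edge from `u` to `v` and an edge from `0` to `u`. -/
def addRootedEdge (g : LinkedGraph) (u v m : ℕ) : LinkedGraph :=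
  (g.addEdge u v m).addEdge 0 u 0

theorem Stores.add (h : g.Stores E) (u v m : ℕ) :
    (g.addRootedEdge u v m).Stores (insert (u, v, m) E) where
  wf := (h.wf.addEdge _ _ _).addEdge _ _ _
  edges_eq := by
    rw [addRootedEdge, edges_addEdge, edges_addEdge, h.edges_eq, Set.image_insert_eq,
      Set.insert_union, Set.union_insert, Set.insert_comm]

theorem numEdges_addRootedEdge (g : LinkedGraph) (u v m : ℕ) :
    (g.addRootedEdge u v m).numEdges = g.numEdges + 2 := rfl

end LinkedGraph

/-- Add an edge with source, target and mark in the registers `u`, `v` and `m`. -/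
def addEdge (u v m : ℕ) : Program :=
  const 31 1 ⨟ add 30 30 31 ⨟ store 11 30 u ⨟ store 12 30 v ⨟ store 13 30 m ⨟ load 31 10 u ⨟
  store 14 30 31 ⨟ store 10 u 30

/-- Add an edge from the vertex in register `u` to the vertex in register `v` with mark `m`, and an
edge from `0` to the former. -/
def addRootedEdge (u v m : ℕ) : Program :=
  const 28 m ⨟ addEdge u v 28 ⨟ const 29 0 ⨟ addEdge 29 u 29

/-- Set register `t` to a nonzero value if and only if the registers `x` and `y` differ. -/
def ne (t x y : ℕ) : Program := sub t x y ⨟ sub 27 y x ⨟ add t t 27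

variable {s : Config} {u v m : ℕ}

theorem graph_addEdge (hu : u < 30) (hv : v < 30) (hm : m < 30) :
    ((addEdge u v m).run s).graph = s.graph.addEdge (s.reg u) (s.reg v) (s.reg m) := by
  have h1 : u ≠ 30 := by omega
  have h2 : v ≠ 30 := by omega
  have h3 : m ≠ 30 := by omega
  have h4 : u ≠ 31 := by omega
  have h5 : v ≠ 31 := by omega
  have h6 : m ≠ 31 := by omega
  simp [addEdge, Config.graph, LinkedGraph.addEdge, h1, h2, h3, h4, h5, h6]

theorem reg_addEdge {r : ℕ} (h : r < 30 ∨ 31 < r) : ((addEdge u v m).run s).reg r = s.reg r := by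
  have h1 : r ≠ 30 := by omega
  have h2 : r ≠ 31 := by omega
  simp [addEdge, h1, h2]

theorem graph_setReg {x w : ℕ} (hx : 30 ≠ x) : (s.setReg x w).graph = s.graph := by
  simp [Config.graph, hx]

theorem graph_addRootedEdge (hu : u < 28) (hv : v < 28) :
    ((addRootedEdge u v m).run s).graph = s.graph.addRootedEdge (s.reg u) (s.reg v) m := by
  have h1 : u ≠ 28 := by omega
  have h2 : v ≠ 28 := by omega
  have h3 : u ≠ 29 := by omega
  simp only [addRootedEdge, Program.run]
  rw [graph_addEdge (by norm_num) (by omega) (by norm_num), graph_setReg (by norm_num),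
    graph_addEdge (by omega) (by omega) (by norm_num), graph_setReg (by norm_num)]
  simp [h1, h2, h3, LinkedGraph.addRootedEdge, reg_addEdge (by omega : u < 30 ∨ 31 < u)]

theorem reg_addRootedEdge {r : ℕ} (h : r < 28) :
    ((addRootedEdge u v m).run s).reg r = s.reg r := by
  have h1 : r ≠ 28 := by omega
  have h2 : r ≠ 29 := by omega
  simp only [addRootedEdge, Program.run]
  rw [reg_addEdge (by omega), Config.reg_setReg, if_neg h2, reg_addEdge (by omega),
    Config.reg_setReg, if_neg h1]

theorem arr_addRootedEdge {a : ℕ} (h : a < 10) :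
    ((addRootedEdge u v m).run s).arr a = s.arr a := by
  have h1 : a ≠ 10 := by omega
  have h2 : a ≠ 11 := by omega
  have h3 : a ≠ 12 := by omega
  have h4 : a ≠ 13 := by omega
  have h5 : a ≠ 14 := by omega
  simp [addRootedEdge, addEdge, h1, h2, h3, h4, h5]

/-- The value computed by `ne`. -/
def neq (a b : ℕ) : ℕ := a - b + (b - a)

theorem neq_eq_zero_iff {a b : ℕ} : neq a b = 0 ↔ a = b := by
  unfold neq
  omega

theorem reg_ne {t x y r : ℕ} (hx : t ≠ x) (hy : t ≠ y) (ht : t ≠ 27) (hr : r ≠ 27) :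
    ((ne t x y).run s).reg r = if r = t then neq (s.reg x) (s.reg y) else s.reg r := by
  by_cases hrt : r = t <;> simp [ne, neq, hx.symm, hy.symm, ht, hr, hrt]

theorem arr_ne {t x y : ℕ} : ((ne t x y).run s).arr = s.arr := rfl

theorem graph_ne {t x y : ℕ} (ht : 30 ≠ t) : ((ne t x y).run s).graph = s.graph := by
  simp [ne, Config.graph, ht]

/-! ### The product graphs -/

/-- A number for the triple `(x, y, z)` of numbers below `B`. -/
def code (B x y z : ℕ) : ℕ := x * (B * B) + y * B + z

/-- The edges of the pair graph obtained from two transitions with the same label `a`. -/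
def pairEdges (B a s₁ d₁ s₂ d₂ : ℕ) : Set (ℕ × ℕ × ℕ) :=
  {x | x = (code B s₁ s₂ 0, code B d₁ d₂ 0, 0) ∨
    (a ≠ 0 ∧ (x = (code B s₁ s₂ 1, code B d₁ d₂ 0, 0) ∨
      (s₁ = s₂ ∧ d₁ ≠ d₂ ∧ x = (code B s₁ s₂ 0, code B d₁ d₂ 0, 2)))) ∨
    (a = 0 ∧ s₂ ≠ d₂ ∧ s₁ = s₂ ∧ d₁ ≠ d₂ ∧ s₁ ≠ d₁ ∧
      x = (code B s₁ s₂ 0, code B d₁ d₂ 0, 2)) ∨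
    (a = 0 ∧ s₂ = d₂ ∧ (x = (code B s₁ s₂ 1, code B d₁ d₂ 1, 0) ∨
      (s₁ = s₂ ∧ s₁ ≠ d₁ ∧ x = (code B s₁ s₂ 0, code B d₁ d₂ 1, 2))))}

/-- The edges of the triple graph obtained from three transitions with the same label `a`. -/
def tripleEdges (B a s₁ d₁ s₂ d₂ s₃ d₃ : ℕ) : Set (ℕ × ℕ × ℕ) :=
  {x | x = (code B s₁ s₂ s₃, code B d₁ d₂ d₃, 0) ∨
    (a ≠ 0 ∧ d₂ = d₃ ∧ d₁ ≠ d₃ ∧ x = (code B s₁ s₂ s₃, code B d₁ d₁ d₃, 1))}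

/-- Registers `22` and `24` hold the code of the source pair with flag `0` and `1`, registers `23`
and `26` that of the target pair; the products are looked up in arrays `5` and `6`. -/
def addPairEdges : Program :=
  load 22 6 11 ⨟ load 25 5 15 ⨟ add 22 22 25 ⨟ load 23 6 13 ⨟ load 25 5 17 ⨟ add 23 23 25 ⨟
  const 25 1 ⨟ add 24 22 25 ⨟ add 26 23 25 ⨟ addRootedEdge 22 23 0 ⨟
  .cond 12
    (addRootedEdge 24 23 0 ⨟ ne 25 11 15 ⨟ .cond 25 skip
      (ne 25 13 17 ⨟ .cond 25 (addRootedEdge 22 23 2) skip))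
    (ne 25 15 17 ⨟ .cond 25
      (ne 25 11 15 ⨟ .cond 25 skip (ne 25 13 17 ⨟ .cond 25
        (ne 25 11 13 ⨟ .cond 25 (addRootedEdge 22 23 2) skip) skip))
      (addRootedEdge 24 26 0 ⨟ ne 25 11 15 ⨟ .cond 25 skip
        (ne 25 11 13 ⨟ .cond 25 (addRootedEdge 22 26 2) skip)))

def addTripleEdges : Program :=
  load 22 6 11 ⨟ load 25 5 15 ⨟ add 22 22 25 ⨟ add 22 22 19 ⨟
  load 23 6 13 ⨟ load 25 5 17 ⨟ add 23 23 25 ⨟ add 23 23 21 ⨟ addRootedEdge 22 23 0 ⨟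
  .cond 12
    (ne 25 17 21 ⨟ .cond 25 skip (ne 25 13 21 ⨟ .cond 25
      (load 24 6 13 ⨟ load 25 5 13 ⨟ add 24 24 25 ⨟ add 24 24 21 ⨟ addRootedEdge 22 24 1) skip))
    skip

/-- The data from which the product graphs are built: `K` transitions with sources `S`, labels `L`
and targets `D`, and tables of the multiples of `B` and of `B * B`. -/
structure Config.HasData (K B : ℕ) (S L D : ℕ → ℕ) (s : Config) : Prop where
  reg_2 : s.reg 2 = K
  arr_2 : s.arr 2 = S
  arr_3 : s.arr 3 = L
  arr_4 : s.arr 4 = D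
  arr_5 : ∀ x < B, s.arr 5 x = x * B
  arr_6 : ∀ x < B, s.arr 6 x = x * (B * B)
  src_lt : ∀ k < K, S k < B
  tgt_lt : ∀ k < K, D k < B

variable {K B : ℕ} {S L D : ℕ → ℕ} {E : Set (ℕ × ℕ × ℕ)}

/-- Every branch adds at most three rooted edges, that is six edges of the graph. -/
theorem addPairEdges_spec {a s₁ d₁ s₂ d₂ : ℕ} (h : s.HasData K B S L D) (hE : s.graph.Stores E)
    (h11 : s.reg 11 = s₁) (h12 : s.reg 12 = a) (h13 : s.reg 13 = d₁) (h15 : s.reg 15 = s₂)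
    (h17 : s.reg 17 = d₂) (hs₁ : s₁ < B) (hd₁ : d₁ < B) (hs₂ : s₂ < B) (hd₂ : d₂ < B) :
    (addPairEdges.run s).graph.Stores (E ∪ pairEdges B a s₁ d₁ s₂ d₂) ∧
      (addPairEdges.run s).graph.numEdges ≤ s.graph.numEdges + 6 := by
  have e1 := h.arr_6 _ hs₁
  have e2 := h.arr_6 _ hd₁
  have e3 := h.arr_5 _ hs₂
  have e4 := h.arr_5 _ hd₂
  have key : ∀ {g : LinkedGraph} {F F' : Set (ℕ × ℕ × ℕ)}, g.Stores F → F = F' → g.Stores F' := by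
    rintro g F _ h rfl
    exact h
  simp only [addPairEdges, skip, Program.run]
  simp [reg_ne, h11, h12, h13, h15, h17, e1, e2, e3, e4, reg_addRootedEdge,
    neq_eq_zero_iff]
  split_ifs
  all_goals
    simp [graph_ne, reg_ne, graph_addRootedEdge, reg_addRootedEdge, graph_setReg,
      numEdges_addRootedEdge]
    refine key (by repeat' first | exact hE | apply Stores.add) ?_
    ext x
    simp [pairEdges, code]
    tauto

end RAM

/-! ### The loops over pairs and triples of transitions -/

namespace RAM

open LinkedGraph
open Program hiding cond

variable {s : Config} {c : ℕ} {K B : ℕ} {S L D : ℕ → ℕ} {E : Set (ℕ × ℕ × ℕ)}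

theorem addTripleEdges_spec {a s₁ d₁ s₂ d₂ s₃ d₃ : ℕ} (h : s.HasData K B S L D)
    (hE : s.graph.Stores E) (h11 : s.reg 11 = s₁) (h12 : s.reg 12 = a) (h13 : s.reg 13 = d₁)
    (h15 : s.reg 15 = s₂) (h17 : s.reg 17 = d₂) (h19 : s.reg 19 = s₃) (h21 : s.reg 21 = d₃)
    (hs₁ : s₁ < B) (hd₁ : d₁ < B) (hs₂ : s₂ < B) (hd₂ : d₂ < B) :
    (addTripleEdges.run s).graph.Stores (E ∪ tripleEdges B a s₁ d₁ s₂ d₂ s₃ d₃) ∧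
      (addTripleEdges.run s).graph.numEdges ≤ s.graph.numEdges + 4 := by
  have e1 := h.arr_6 _ hs₁
  have e2 := h.arr_6 _ hd₁
  have e3 := h.arr_5 _ hs₂
  have e4 := h.arr_5 _ hd₂
  have e5 := h.arr_5 _ hd₁
  have key : ∀ {g : LinkedGraph} {F F' : Set (ℕ × ℕ × ℕ)}, g.Stores F → F = F' → g.Stores F' := by
    rintro g F _ h rfl
    exact h
  simp only [addTripleEdges, skip, Program.run]
  simp [reg_ne, arr_ne, arr_addRootedEdge, h11, h12, h13, h15, h17, h19, h21, e1, e2, e3, e4, e5,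
    reg_addRootedEdge, neq_eq_zero_iff]
  split_ifs
  all_goals
    simp [graph_ne, reg_ne, graph_addRootedEdge, reg_addRootedEdge, graph_setReg,
      numEdges_addRootedEdge]
    refine key (by repeat' first | exact hE | apply Stores.add) ?_
    ext x
    simp [tripleEdges, code]
    tauto

def tripleStep : Program :=
  const 27 1 ⨟ sub 18 18 27 ⨟ load 19 2 18 ⨟ load 20 3 18 ⨟ load 21 4 18 ⨟ ne 25 12 20 ⨟
  .cond 25 skip addTripleEdges

/-- Setting register `18` to `0` when the labels differ skips the inner loop. -/
def pairStep : Program :=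
  (const 27 1 ⨟ sub 14 14 27 ⨟ load 15 2 14 ⨟ load 16 3 14 ⨟ load 17 4 14 ⨟ ne 25 12 16 ⨟
    .cond 25 (const 18 0) (addPairEdges ⨟ copy 18 2)) ⨟
  loop 18 tripleStep

def rowStep : Program :=
  (const 27 1 ⨟ sub 10 10 27 ⨟ load 11 2 10 ⨟ load 12 3 10 ⨟ load 13 4 10 ⨟ copy 14 2) ⨟
  loop 14 pairStep

def buildGraph : Program := copy 10 2 ⨟ loop 10 rowStep

/-- The edges obtained from the transitions `i`, `j` and `k`. -/
def tripleSet (B : ℕ) (S L D : ℕ → ℕ) (i j k : ℕ) : Set (ℕ × ℕ × ℕ) :=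
  {x | L i = L k ∧ x ∈ tripleEdges B (L i) (S i) (D i) (S j) (D j) (S k) (D k)}

/-- The edges obtained from the transitions `i` and `j`. -/
def pairSet (K B : ℕ) (S L D : ℕ → ℕ) (i j : ℕ) : Set (ℕ × ℕ × ℕ) :=
  {x | L i = L j ∧ (x ∈ pairEdges B (L i) (S i) (D i) (S j) (D j) ∨
    ∃ k < K, x ∈ tripleSet B S L D i j k)}

/-- All edges. -/
def productSet (K B : ℕ) (S L D : ℕ → ℕ) : Set (ℕ × ℕ × ℕ) :=
  {x | ∃ i < K, ∃ j < K, x ∈ pairSet K B S L D i j}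

theorem Config.HasData.of_sameOn {s' : Config} {R A : ℕ → Prop} (h : s.HasData K B S L D)
    (hs : s.SameOn R A s') (hR : ∀ r < 10, R r) (hA : ∀ a < 10, A a) : s'.HasData K B S L D where
  reg_2 := by rw [hs.1 2 (hR _ (by norm_num)), h.reg_2]
  arr_2 := by rw [hs.2 2 (hA _ (by norm_num)), h.arr_2]
  arr_3 := by rw [hs.2 3 (hA _ (by norm_num)), h.arr_3]
  arr_4 := by rw [hs.2 4 (hA _ (by norm_num)), h.arr_4]
  arr_5 := by rw [hs.2 5 (hA _ (by norm_num))]; exact h.arr_5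
  arr_6 := by rw [hs.2 6 (hA _ (by norm_num))]; exact h.arr_6
  src_lt := h.src_lt
  tgt_lt := h.tgt_lt

/-- The invariant of the loops that build the graph, with `E` the set of edges. -/
structure Config.Building (K B : ℕ) (S L D : ℕ → ℕ) (E : Set (ℕ × ℕ × ℕ)) (s : Config) : Prop where
  data : s.HasData K B S L D
  stores : s.graph.Stores E

theorem tripleStep_spec {i j k : ℕ} (h : s.Building K B S L D E) (hi : i < K) (hj : j < K)
    (h11 : s.reg 11 = S i) (h12 : s.reg 12 = L i) (h13 : s.reg 13 = D i)
    (h15 : s.reg 15 = S j) (h17 : s.reg 17 = D j) (h18 : s.reg 18 = k + 1) :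
    (tripleStep.run s).Building K B S L D (E ∪ tripleSet B S L D i j k) ∧
      (tripleStep.run s).reg 18 = k ∧
      (tripleStep.run s).graph.numEdges ≤ s.graph.numEdges + 4 ∧
      s.SameOn (· < 18) (fun a ↦ a < 10 ∨ 20 ≤ a) (tripleStep.run s) := by
  have hdata := h.data
  have hsame : s.SameOn (· < 18) (fun a ↦ a < 10 ∨ 20 ≤ a) (tripleStep.run s) :=
    LoopFree.run_sameOn (by simp [tripleStep, ne, skip, addTripleEdges, addRootedEdge, addEdge])
      (by simp [tripleStep, ne, skip, addTripleEdges, addRootedEdge, addEdge]) s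
  have hd := hdata.of_sameOn hsame (fun r hr ↦ by omega) (fun a ha ↦ Or.inl ha)
  set s₁ := (const 27 1 ⨟ sub 18 18 27 ⨟ load 19 2 18 ⨟ load 20 3 18 ⨟ load 21 4 18 ⨟
    ne 25 12 20).run s with hs₁
  have hrun : tripleStep.run s = (Program.cond 25 skip addTripleEdges).run s₁ := rfl
  have k18 : s₁.reg 18 = k := by simp [hs₁, reg_ne, h18]
  have k25 : s₁.reg 25 = neq (L i) (L k) := by simp [hs₁, reg_ne, h18, hdata.arr_3, h12]
  have k19 : s₁.reg 19 = S k := by simp [hs₁, reg_ne, h18, hdata.arr_2]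
  have k21 : s₁.reg 21 = D k := by simp [hs₁, reg_ne, h18, hdata.arr_4]
  have kg : s₁.graph = s.graph := by simp [hs₁, graph_ne, graph_setReg]
  have ksame : s.SameOn (· < 18) (fun _ ↦ True) s₁ :=
    LoopFree.run_sameOn (by simp [ne]) (by simp [ne]) s
  have kd := hdata.of_sameOn ksame (fun r hr ↦ by omega) (fun a ha ↦ trivial)
  by_cases hL : L i = L k
  · have hrun' : tripleStep.run s = addTripleEdges.run s₁ := by
      rw [hrun]
      simp [k25, neq_eq_zero_iff, hL]
    obtain ⟨h1, h2⟩ := addTripleEdges_spec kd (kg.symm ▸ h.stores)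
      ((ksame.1 _ (by norm_num)).trans h11) ((ksame.1 _ (by norm_num)).trans h12)
      ((ksame.1 _ (by norm_num)).trans h13) ((ksame.1 _ (by norm_num)).trans h15)
      ((ksame.1 _ (by norm_num)).trans h17) k19 k21
      (hdata.src_lt i hi) (hdata.tgt_lt i hi) (hdata.src_lt j hj) (hdata.tgt_lt j hj)
    have h18' : (addTripleEdges.run s₁).reg 18 = s₁.reg 18 :=
      (LoopFree.run_sameOn (R := (· < 19)) (A := fun _ ↦ False)
        (by simp [ne, skip, addTripleEdges, addRootedEdge, addEdge])
        (by simp [ne, skip, addTripleEdges, addRootedEdge, addEdge]) s₁).1 18 (by norm_num)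
    refine ⟨⟨hd, ?_⟩, by rw [hrun', h18', k18], by rw [hrun', ← kg]; exact h2, hsame⟩
    have heq : tripleSet B S L D i j k =
        tripleEdges B (L i) (S i) (D i) (S j) (D j) (S k) (D k) := by
      ext x
      simp [tripleSet, hL]
    rw [hrun', heq]
    exact h1
  · have hrun' : tripleStep.run s = s₁.setReg 49 0 := by
      rw [hrun]
      simp [k25, neq_eq_zero_iff, hL, skip]
    have heq : tripleSet B S L D i j k = ∅ := by
      ext x
      simp [tripleSet, hL]
    refine ⟨⟨hd, ?_⟩, by simp [hrun', k18], by rw [hrun', graph_setReg (by norm_num), kg]; omega,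
      hsame⟩
    rw [hrun', graph_setReg (by norm_num), kg, heq, Set.union_empty]
    exact h.stores

theorem Config.Building.of_eq {F F' : Set (ℕ × ℕ × ℕ)} (h : s.Building K B S L D F)
    (hF : F = F') : s.Building K B S L D F' := hF ▸ h

/-- A loop that adds the edges in `T k` for all `k < K`. -/
theorem buildLoop_spec {P : Program} {x w rest : ℕ} {R A : ℕ → Prop} {T : ℕ → Set (ℕ × ℕ × ℕ)}
    (hP : P.Preserves R A) (h : s.Building K B S L D E) (hx : s.reg x = K)
    (hc : 450 * s.graph.numEdges + (w + 1) * K + 1 + rest ≤ c)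
    (body : ∀ s' c' E k rest, s'.Building K B S L D E → s.SameOn R A s' → k < K →
      s'.reg x = k + 1 → 450 * s'.graph.numEdges + w + rest ≤ c' →
      Wp P s' c' fun s'' c'' ↦ s''.Building K B S L D (E ∪ T k) ∧ s''.reg x = k ∧
        450 * s''.graph.numEdges + rest ≤ c'') :
    Wp (loop x P) s c fun s' c' ↦ s'.Building K B S L D (E ∪ {y | ∃ k < K, y ∈ T k}) ∧
      450 * s'.graph.numEdges + rest ≤ c' := by
  -- The invariant keeps 450 units in reserve per edge already built; this is the amount that the
  -- two searches consume.
  refine Wp.loop (fun s' c' ↦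
    s'.Building K B S L D (E ∪ {y | ∃ k, s'.reg x ≤ k ∧ k < K ∧ y ∈ T k}) ∧
    s.SameOn R A s' ∧ s'.reg x ≤ K ∧
    450 * s'.graph.numEdges + (w + 1) * s'.reg x + 1 + rest ≤ c') ?_ ?_ ?_
  · refine ⟨h.of_eq ?_, .refl _ _ _, hx.le, by rw [hx]; exact hc⟩
    have : {y | ∃ k, s.reg x ≤ k ∧ k < K ∧ y ∈ T k} = ∅ := by
      ext y
      simp only [hx, Set.mem_empty_iff_false, iff_false]
      rintro ⟨k, h1, h2, -⟩
      omega
    rw [this, Set.union_empty]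
  · rintro s' c' ⟨hb, hs', hx', hc'⟩ hne
    obtain ⟨k, hk⟩ := Nat.exists_eq_succ_of_ne_zero hne
    rw [hk, Nat.mul_succ] at hc'
    refine ⟨by omega, (Wp.sameOn hP (body s' (c' - 1) _ k ((w + 1) * k + 1 + rest) hb hs' (by omega)
      hk (by omega))).mono ?_⟩
    rintro s'' c'' ⟨k0, k1, k2, k3⟩
    refine ⟨k1.of_eq ?_, hs'.trans k0, by omega, by rw [k2]; omega⟩
    rw [k2, Set.union_assoc]
    congr 1
    ext y
    constructor
    · rintro (⟨k', h1, h2, h3⟩ | h1)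
      · exact ⟨k', by omega, h2, h3⟩
      · exact ⟨k, le_rfl, by omega, h1⟩
    · rintro ⟨k', h1, h2, h3⟩
      rcases h1.eq_or_lt with rfl | h1
      · exact Or.inr h3
      · exact Or.inl ⟨k', by omega, h2, h3⟩
  · rintro s' c' ⟨hb, hs', hx', hc'⟩ h0
    refine ⟨by omega, hb.of_eq ?_, by omega⟩
    simp [h0]

/-- A turn costs at most 100 steps and adds at most four edges at 450 each, within the allowance of
1999 plus the loop test. -/
theorem tripleLoop_spec {i j rest : ℕ} (h : s.Building K B S L D E) (hi : i < K) (hj : j < K)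
    (h11 : s.reg 11 = S i) (h12 : s.reg 12 = L i) (h13 : s.reg 13 = D i)
    (h15 : s.reg 15 = S j) (h17 : s.reg 17 = D j) (h18 : s.reg 18 = K)
    (hc : 450 * s.graph.numEdges + 2000 * K + 1 + rest ≤ c) :
    Wp (loop 18 tripleStep) s c fun s' c' ↦
      s'.Building K B S L D (E ∪ {x | ∃ k < K, x ∈ tripleSet B S L D i j k}) ∧
      450 * s'.graph.numEdges + rest ≤ c' := by
  have hcost : tripleStep.cost ≤ 100 := by
    simp [tripleStep, ne, skip, addTripleEdges, addRootedEdge, addEdge]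
  refine buildLoop_spec (w := 1999) (R := (· < 18)) (A := fun a ↦ a < 10 ∨ 20 ≤ a)
    (by simp [tripleStep, ne, skip, addTripleEdges, addRootedEdge, addEdge]) h h18 hc ?_
  intro s' c' E' k rest' hb hs' hk h18' hc'
  obtain ⟨k1, k2, k3, -⟩ := tripleStep_spec hb hi hj (k := k)
    ((hs'.1 _ (by norm_num)).trans h11) ((hs'.1 _ (by norm_num)).trans h12)
    ((hs'.1 _ (by norm_num)).trans h13) ((hs'.1 _ (by norm_num)).trans h15)
    ((hs'.1 _ (by norm_num)).trans h17) h18'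
  exact Wp.of_loopFree (by simp [tripleStep, ne, skip, addTripleEdges, addRootedEdge, addEdge])
    (by omega) ⟨k1, k2, by omega⟩

/-- The constant 3999 covers the first block (at most 200), six edges at 450 each and the last test
of the inner loop. -/
theorem pairStep_spec {i j rest : ℕ} (h : s.Building K B S L D E) (hi : i < K) (hj : j < K)
    (h11 : s.reg 11 = S i) (h12 : s.reg 12 = L i) (h13 : s.reg 13 = D i) (h14 : s.reg 14 = j + 1)
    (hc : 450 * s.graph.numEdges + (2000 * K + 3999) + rest ≤ c) :
    Wp pairStep s c fun s' c' ↦ s'.Building K B S L D (E ∪ pairSet K B S L D i j) ∧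
      s'.reg 14 = j ∧ 450 * s'.graph.numEdges + rest ≤ c' := by
  have hdata := h.data
  set P₁ := const 27 1 ⨟ sub 14 14 27 ⨟ load 15 2 14 ⨟ load 16 3 14 ⨟ load 17 4 14 ⨟ ne 25 12 16 ⨟
    Program.cond 25 (const 18 0) (addPairEdges ⨟ copy 18 2) with hP₁
  have hcost : P₁.cost ≤ 200 := by
    simp [hP₁, ne, skip, addPairEdges, addRootedEdge, addEdge]
  have hfree : P₁.LoopFree := by simp [hP₁, ne, skip, addPairEdges, addRootedEdge, addEdge]
  set s₁ := (const 27 1 ⨟ sub 14 14 27 ⨟ load 15 2 14 ⨟ load 16 3 14 ⨟ load 17 4 14 ⨟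
    ne 25 12 16).run s with hs₁
  have hrun : P₁.run s = (Program.cond 25 (const 18 0) (addPairEdges ⨟ copy 18 2)).run s₁ := rfl
  have k14 : s₁.reg 14 = j := by simp [hs₁, reg_ne, h14]
  have k25 : s₁.reg 25 = neq (L i) (L j) := by simp [hs₁, reg_ne, h14, hdata.arr_3, h12]
  have k15 : s₁.reg 15 = S j := by simp [hs₁, reg_ne, h14, hdata.arr_2]
  have k17 : s₁.reg 17 = D j := by simp [hs₁, reg_ne, h14, hdata.arr_4]
  have kg : s₁.graph = s.graph := by simp [hs₁, graph_ne, graph_setReg]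
  have ksame : s.SameOn (· < 14) (fun _ ↦ True) s₁ :=
    LoopFree.run_sameOn (by simp [ne]) (by simp [ne]) s
  have kd := hdata.of_sameOn ksame (fun r hr ↦ by omega) (fun a ha ↦ trivial)
  have hmono : ∀ s' : Config, Wp (loop 18 tripleStep) s' (c - P₁.cost) (fun s'' c'' ↦
      s''.Building K B S L D (E ∪ pairSet K B S L D i j) ∧ 450 * s''.graph.numEdges + rest ≤ c'') →
      s'.reg 14 = j → Wp (loop 18 tripleStep) s' (c - P₁.cost) (fun s'' c'' ↦
      s''.Building K B S L D (E ∪ pairSet K B S L D i j) ∧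
      s''.reg 14 = j ∧ 450 * s''.graph.numEdges + rest ≤ c'') := by
    intro s' h' h14'
    refine (Wp.sameOn (R := (· < 15)) (A := fun _ ↦ False)
      (by simp [tripleStep, ne, skip, addTripleEdges, addRootedEdge, addEdge]) h').mono ?_
    rintro s'' c'' ⟨g1, g2, g3⟩
    exact ⟨g2, (g1.1 14 (by norm_num)).trans h14', g3⟩
  refine Wp.seq (P := P₁) (Wp.of_loopFree hfree (by omega) (hmono _ ?_ ?_))
  · by_cases hL : L i = L j
    · have hrun' : P₁.run s = (copy 18 2).run (addPairEdges.run s₁) := by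
        rw [hrun]
        simp [k25, neq_eq_zero_iff, hL]
      obtain ⟨h1, h2⟩ := addPairEdges_spec kd (kg.symm ▸ h.stores)
        ((ksame.1 _ (by norm_num)).trans h11)
        ((ksame.1 _ (by norm_num)).trans h12) ((ksame.1 _ (by norm_num)).trans h13) k15 k17
        (hdata.src_lt i hi) (hdata.tgt_lt i hi) (hdata.src_lt j hj) (hdata.tgt_lt j hj)
      have hsame : s₁.SameOn (· < 18) (fun a ↦ a < 10 ∨ 20 ≤ a) (P₁.run s) := by
        rw [hrun']
        exact LoopFree.run_sameOn (P := addPairEdges ⨟ copy 18 2)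
          (by simp [ne, skip, addPairEdges, addRootedEdge, addEdge])
          (by simp [ne, skip, addPairEdges, addRootedEdge, addEdge]) s₁
      have hgr : (P₁.run s).graph = (addPairEdges.run s₁).graph := by
        rw [hrun']
        exact graph_setReg (by norm_num)
      have hdata' := kd.of_sameOn hsame (fun r hr ↦ by omega) (fun a ha ↦ Or.inl ha)
      refine (tripleLoop_spec (rest := rest) ⟨hdata', hgr ▸ h1⟩ hi hj
        ((hsame.1 _ (by norm_num)).trans ((ksame.1 _ (by norm_num)).trans h11))
        ((hsame.1 _ (by norm_num)).trans ((ksame.1 _ (by norm_num)).trans h12))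
        ((hsame.1 _ (by norm_num)).trans ((ksame.1 _ (by norm_num)).trans h13))
        ((hsame.1 _ (by norm_num)).trans k15) ((hsame.1 _ (by norm_num)).trans k17) ?_ ?_).mono ?_
      · rw [← hdata'.reg_2]
        simp [hrun']
      · rw [kg] at h2
        rw [hgr]
        omega
      · rintro s'' c'' ⟨g1, g2⟩
        refine ⟨g1.of_eq ?_, g2⟩
        rw [Set.union_assoc]
        congr 1
        ext x
        simp [pairSet, hL]
    · have hrun' : P₁.run s = s₁.setReg 18 0 := by
        rw [hrun]
        simp [k25, neq_eq_zero_iff, hL]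
      have heq : pairSet K B S L D i j = ∅ := by
        ext x
        simp [pairSet, hL]
      rw [hrun', heq, Set.union_empty]
      refine ⟨s₁.setReg 18 0, 1, c - P₁.cost - 1, .loop_false (by simp), by omega, ⟨?_, ?_⟩, ?_⟩
      · exact ⟨kd.reg_2, kd.arr_2, kd.arr_3, kd.arr_4, kd.arr_5, kd.arr_6, kd.src_lt, kd.tgt_lt⟩
      · rw [graph_setReg (by norm_num), kg]
        exact h.stores
      · rw [graph_setReg (by norm_num), kg]
        omega
  · have := (LoopFree.run_sameOn (P := Program.cond 25 (const 18 0) (addPairEdges ⨟ copy 18 2))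
      (R := (· < 15)) (A := fun _ ↦ False)
      (by simp [ne, skip, addPairEdges, addRootedEdge, addEdge])
      (by simp [ne, skip, addPairEdges, addRootedEdge, addEdge]) s₁).1 14 (by norm_num)
    rw [hrun, this, k14]

theorem rowStep_spec {i rest : ℕ} (h : s.Building K B S L D E) (hi : i < K)
    (h10 : s.reg 10 = i + 1)
    (hc : 450 * s.graph.numEdges + ((2000 * K + 3999 + 1) * K + 10) + rest ≤ c) :
    Wp rowStep s c fun s' c' ↦
      s'.Building K B S L D (E ∪ {x | ∃ j < K, x ∈ pairSet K B S L D i j}) ∧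
      s'.reg 10 = i ∧ 450 * s'.graph.numEdges + rest ≤ c' := by
  have hdata := h.data
  set P₁ := const 27 1 ⨟ sub 10 10 27 ⨟ load 11 2 10 ⨟ load 12 3 10 ⨟ load 13 4 10 ⨟ copy 14 2
    with hP₁
  have hsame : s.SameOn (· < 10) (fun _ ↦ True) (P₁.run s) :=
    LoopFree.run_sameOn (by simp [hP₁]) (by simp [hP₁]) s
  have hdata' := hdata.of_sameOn hsame (fun r hr ↦ hr) (fun a ha ↦ trivial)
  have hgr : (P₁.run s).graph = s.graph := by simp [hP₁, graph_setReg]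
  have h10' : (P₁.run s).reg 10 = i := by simp [hP₁, h10]
  have hcost : P₁.cost = 6 := by simp [hP₁]
  refine Wp.seq (P := P₁) (Wp.of_loopFree (by simp [hP₁]) (by omega) ?_)
  refine (Wp.sameOn (R := (· < 11)) (A := fun _ ↦ False)
    (by simp [pairStep, tripleStep, ne, skip, addPairEdges, addTripleEdges, addRootedEdge, addEdge])
    (buildLoop_spec (T := pairSet K B S L D i) (w := 2000 * K + 3999) (rest := rest) (R := (· < 14))
      (A := fun a ↦ a < 10 ∨ 20 ≤ a)
      (by simp [pairStep, tripleStep, ne, skip, addPairEdges, addTripleEdges, addRootedEdge,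
        addEdge]) ⟨hdata', hgr ▸ h.stores⟩
      (by rw [← hdata.reg_2]; simp [hP₁]) (by rw [hgr]; omega) ?_)).mono ?_
  · exact fun s' c' E' j rest' hb hs' hj h14 hc' ↦ pairStep_spec hb hi hj
      ((hs'.1 _ (by norm_num)).trans (by simp [hP₁, h10, hdata.arr_2]))
      ((hs'.1 _ (by norm_num)).trans (by simp [hP₁, h10, hdata.arr_3]))
      ((hs'.1 _ (by norm_num)).trans (by simp [hP₁, h10, hdata.arr_4])) h14 hc'
  · rintro s'' c'' ⟨g1, g2, g3⟩
    exact ⟨g2, (g1.1 10 (by norm_num)).trans h10', g3⟩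

theorem buildGraph_spec {rest : ℕ} (h : s.Building K B S L D ∅)
    (hc : 450 * s.graph.numEdges + ((2000 * K + 3999 + 1) * K + 10 + 1) * K + 2 + rest ≤ c) :
    Wp buildGraph s c fun s' c' ↦
      s.SameOn (fun r ↦ r < 10 ∨ r = 40 ∨ r = 41) (fun a ↦ a < 10 ∨ 20 ≤ a) s' ∧
      s'.graph.Stores (productSet K B S L D) ∧ 450 * s'.graph.numEdges + rest ≤ c' := by
  have hsame : s.SameOn (· < 10) (fun _ ↦ True) ((copy 10 2).run s) :=
    LoopFree.run_sameOn (by simp) (by simp) s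
  have hdata' := h.data.of_sameOn hsame (fun r hr ↦ hr) (fun a ha ↦ trivial)
  have hgr : ((copy 10 2).run s).graph = s.graph := by simp [graph_setReg]
  refine Wp.sameOn (by simp [buildGraph, rowStep, pairStep, tripleStep, ne, skip, addPairEdges,
    addTripleEdges, addRootedEdge, addEdge]) ?_
  refine Wp.seq (Wp.of_loopFree (by simp) (by simp; omega) ?_)
  refine (buildLoop_spec (T := fun i ↦ {x | ∃ j < K, x ∈ pairSet K B S L D i j})
      (w := (2000 * K + 3999 + 1) * K + 10) (rest := rest) (R := (· < 10))
      (A := fun a ↦ a < 10 ∨ 20 ≤ a)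
      (by simp [rowStep, pairStep, tripleStep, ne, skip, addPairEdges, addTripleEdges,
        addRootedEdge, addEdge]) ⟨hdata', hgr ▸ h.stores⟩
      (by rw [← h.data.reg_2]; simp) (by rw [hgr]; simp; omega)
      fun s' c' E' i rest' hb hs' hi h10 hc' ↦ rowStep_spec hb hi h10 hc').mono ?_
  rintro s'' c'' ⟨g1, g2⟩
  refine ⟨?_, g2⟩
  have := g1.stores
  rwa [Set.empty_union] at this

end RAM

namespace RAM

open LinkedGraph
open Program hiding cond

/-! ### Reading the input -/

/-- Replace the state in register `r` by its number, introducing a new number if necessary. -/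
def number (r : ℕ) : Program :=
  load 14 1 r ⨟ .cond 14 (copy r 14) (add 5 5 1 ⨟ store 1 r 5 ⨟ copy r 5)

/-- Append a transition with source, label and target in the registers `x`, `l` and `y`. -/
def append (x l y : ℕ) : Program := store 2 2 x ⨟ store 3 2 l ⨟ store 4 2 y ⨟ add 2 2 1

/-- Append the transition in the registers `10`, `11` and `12` and self-loops at its end points. -/
def appendLoops : Program :=
  append 10 11 12 ⨟ const 13 0 ⨟ append 10 13 10 ⨟ append 12 13 12

/-- Load a transition. -/
def fetch : Program :=
  load 10 0 4 ⨟ add 4 4 1 ⨟ load 11 0 4 ⨟ add 4 4 1 ⨟ load 12 0 4 ⨟ add 4 4 1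

def readStep : Program :=
  fetch ⨟ number 10 ⨟ number 12 ⨟
  appendLoops ⨟ sub 6 6 1

/-- The number of transitions is in cell `2` and the transitions start at cell `3`. Register `5`
starts at `1`, so state numbers start at `2`, which keeps `0` and `1` free for the flags of pairs.
-/
def readTransitions : Program :=
  (const 1 1 ⨟ const 3 2 ⨟ load 3 0 3 ⨟ const 4 3 ⨟ const 5 1 ⨟ const 2 0 ⨟ copy 6 3) ⨟
  loop 6 readStep

/-- Store the multiples of the number in register `x` in the array `a`. -/
def multiples (a x : ℕ) : Program :=
  (const 10 0 ⨟ const 11 0 ⨟ copy 12 7) ⨟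
  loop 12 (store a 10 11 ⨟ add 10 10 1 ⨟ add 11 11 x ⨟ sub 12 12 1)

/-- At most `2 * m` states occur in transitions, whereas |Q| is not bounded in terms of `m`; hence
the renumbering, and the base `2 * m + 2`. The first table is computed by repeated addition and
leaves the square of the base in register `11`, from which the second is built, so nothing is
multiplied. -/
def setup : Program :=
  readTransitions ⨟ (add 7 3 3 ⨟ add 7 7 1 ⨟ add 7 7 1) ⨟ multiples 5 7 ⨟ copy 8 11 ⨟ multiples 6 8

/-- `f` assigns distinct numbers between `2` and `n` to finitely many numbers, and `0` to the
others. -/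
structure Numbering (f : ℕ → ℕ) (n : ℕ) : Prop where
  one_le : 1 ≤ n
  two_le : ∀ x, f x ≠ 0 → 2 ≤ f x
  le : ∀ x, f x ≤ n
  inj : ∀ x y, f x ≠ 0 → f x = f y → x = y

variable {f : ℕ → ℕ} {n m : ℕ} {s : Config} {c : ℕ} {S L D w : ℕ → ℕ}

theorem Numbering.insert (h : Numbering f n) {x : ℕ} :
    Numbering (Function.update f x (n + 1)) (n + 1) where
  one_le := by omega
  two_le y hy := by
    have := h.one_le
    simp only [Function.update_apply] at hy ⊢
    split_ifs at hy ⊢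
    · omega
    · exact h.two_le y hy
  le y := by
    have := h.le y
    simp only [Function.update_apply]
    split_ifs <;> omega
  inj y z hy hyz := by
    have h1 := h.le y
    have h2 := h.le z
    have h3 := h.inj y z
    simp only [Function.update_apply] at hy hyz
    split_ifs at hy hyz
    · simp_all
    · omega
    · omega
    · exact h3 hy hyz

theorem number_spec {r : ℕ} (h : Numbering (s.arr 1) (s.reg 5)) (h1 : s.reg 1 = 1) (hr : r ≠ 5)
    (hr' : r ≠ 14) :
    Numbering (((number r).run s).arr 1) (((number r).run s).reg 5) ∧
      ((number r).run s).reg 5 ≤ s.reg 5 + 1 ∧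
      ((number r).run s).arr 1 (s.reg r) ≠ 0 ∧
      ((number r).run s).reg r = ((number r).run s).arr 1 (s.reg r) ∧
      (∀ x, s.arr 1 x ≠ 0 → ((number r).run s).arr 1 x = s.arr 1 x) ∧
      (∀ q, q ≠ 5 → q ≠ 14 → q ≠ r → ((number r).run s).reg q = s.reg q) ∧
      ∀ a, a ≠ 1 → ((number r).run s).arr a = s.arr a := by
  by_cases hx : s.arr 1 (s.reg r) = 0
  · have h0 := h.insert (x := s.reg r)
    have e1 : ((number r).run s).arr 1 = Function.update (s.arr 1) (s.reg r) (s.reg 5 + 1) := by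
      simp [number, hr', hx, h1, hr]
    have e2 : ((number r).run s).reg 5 = s.reg 5 + 1 := by
      simp [number, hr', hx, h1, hr.symm]
    rw [e1, e2]
    refine ⟨h0, le_rfl, by simp, ?_, ?_, ?_, ?_⟩
    · simp [number, hr', hx, h1]
    · intro x hx'
      rw [Function.update_of_ne]
      rintro rfl
      exact hx' hx
    · intro q q1 q2 q3
      simp [number, hr', hx, h1, q1, q2, q3]
    · intro a ha
      simp [number, hr', hx, ha]
  · have e1 : ((number r).run s).arr 1 = s.arr 1 := by simp [number, hx]
    have e2 : ((number r).run s).reg 5 = s.reg 5 := by simp [number, hx, hr.symm]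
    rw [e1, e2]
    refine ⟨h, by omega, hx, by simp [number, hx], fun _ _ ↦ rfl, ?_, ?_⟩
    · intro q q1 q2 q3
      simp [number, hx, q2, q3]
    · intro a ha
      simp [number, hx]

theorem reg_append (x l y r : ℕ) :
    ((append x l y).run s).reg r = if r = 2 then s.reg 2 + s.reg 1 else s.reg r := by
  simp [append]

theorem arr_append (x l y a : ℕ) :
    ((append x l y).run s).arr a = if a = 2 then Function.update (s.arr 2) (s.reg 2) (s.reg x) else
      if a = 3 then Function.update (s.arr 3) (s.reg 2) (s.reg l) else
      if a = 4 then Function.update (s.arr 4) (s.reg 2) (s.reg y) else s.arr a := by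
  by_cases h4 : a = 4
  · subst h4; simp [append]
  by_cases h3 : a = 3
  · subst h3; simp [append]
  by_cases h2 : a = 2
  · subst h2; simp [append]
  simp [append, h2, h3, h4]

theorem reg_appendLoops (r : ℕ) :
    (appendLoops.run s).reg r = if r = 2 then s.reg 2 + s.reg 1 + s.reg 1 + s.reg 1 else
      if r = 13 then 0 else s.reg r := by
  simp only [appendLoops, run, reg_append, Config.reg_setReg]
  split_ifs <;> simp_all

theorem arr_appendLoops (a : ℕ) :
    (appendLoops.run s).arr a =
      if a = 2 then Function.update (Function.update (Function.update (s.arr 2) (s.reg 2)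
        (s.reg 10)) (s.reg 2 + s.reg 1) (s.reg 10)) (s.reg 2 + s.reg 1 + s.reg 1) (s.reg 12) else
      if a = 3 then Function.update (Function.update (Function.update (s.arr 3) (s.reg 2)
        (s.reg 11)) (s.reg 2 + s.reg 1) 0) (s.reg 2 + s.reg 1 + s.reg 1) 0 else
      if a = 4 then Function.update (Function.update (Function.update (s.arr 4) (s.reg 2)
        (s.reg 12)) (s.reg 2 + s.reg 1) (s.reg 10)) (s.reg 2 + s.reg 1 + s.reg 1) (s.reg 12) else
      s.arr a := by
  simp only [appendLoops, run, arr_append, reg_append, Config.reg_setReg, Config.arr_setReg]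
  norm_num
  split_ifs <;> simp_all

/-- The arrays `S`, `L` and `D` list the first `t` transitions in the input `w`, with states
replaced by their numbers, and self-loops with label `0` at their end points. -/
def Lists (w f S L D : ℕ → ℕ) (t : ℕ) : Prop :=
  ∀ i < t, f (w (3 + 3 * i)) ≠ 0 ∧ f (w (5 + 3 * i)) ≠ 0 ∧
    (S (3 * i) = f (w (3 + 3 * i)) ∧ L (3 * i) = w (4 + 3 * i) ∧ D (3 * i) = f (w (5 + 3 * i))) ∧
    (S (3 * i + 1) = f (w (3 + 3 * i)) ∧ L (3 * i + 1) = 0 ∧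
      D (3 * i + 1) = f (w (3 + 3 * i))) ∧
    (S (3 * i + 2) = f (w (5 + 3 * i)) ∧ L (3 * i + 2) = 0 ∧ D (3 * i + 2) = f (w (5 + 3 * i)))

/-- Numbers once given never change, so the entries already listed remain valid for the extended
numbering `g`. -/
theorem Lists.succ {g : ℕ → ℕ} {t : ℕ} (h : Lists w f S L D t)
    (hf : ∀ x, f x ≠ 0 → g x = f x) (h1 : g (w (3 + 3 * t)) ≠ 0) (h2 : g (w (5 + 3 * t)) ≠ 0) :
    Lists w g
      (Function.update (Function.update (Function.update S (3 * t) (g (w (3 + 3 * t))))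
        (3 * t + 1) (g (w (3 + 3 * t)))) (3 * t + 1 + 1) (g (w (5 + 3 * t))))
      (Function.update (Function.update (Function.update L (3 * t) (w (4 + 3 * t)))
        (3 * t + 1) 0) (3 * t + 1 + 1) 0)
      (Function.update (Function.update (Function.update D (3 * t) (g (w (5 + 3 * t))))
        (3 * t + 1) (g (w (3 + 3 * t)))) (3 * t + 1 + 1) (g (w (5 + 3 * t)))) (t + 1) := by
  intro i hi
  rcases Nat.lt_succ_iff_lt_or_eq.1 hi with hi | rfl
  · obtain ⟨g1, g2, g3, g4, g5⟩ := h i hi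
    rw [hf _ g1, hf _ g2]
    refine ⟨g1, g2, ?_, ?_, ?_⟩
    · simpa (disch := omega) only [Function.update_apply, if_neg] using g3
    · simpa (disch := omega) only [Function.update_apply, if_neg] using g4
    · simpa (disch := omega) only [Function.update_apply, if_neg] using g5
  · refine ⟨h1, h2, ?_, ?_, ?_⟩
    · simp only [Function.update_of_ne (show 3 * i ≠ 3 * i + 1 + 1 by omega),
        Function.update_of_ne (show 3 * i ≠ 3 * i + 1 by omega), Function.update_self, true_and]
    · simp
    · simp

structure Config.Reading (w : ℕ → ℕ) (m t : ℕ) (s : Config) : Prop where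
  arr_0 : s.arr 0 = w
  reg_1 : s.reg 1 = 1
  reg_2 : s.reg 2 = 3 * t
  reg_3 : s.reg 3 = m
  reg_4 : s.reg 4 = 3 + 3 * t
  reg_5 : s.reg 5 ≤ 1 + 2 * t
  reg_6 : s.reg 6 + t = m
  numbering : Numbering (s.arr 1) (s.reg 5)
  lists : Lists w (s.arr 1) (s.arr 2) (s.arr 3) (s.arr 4) t

theorem Config.Reading.appendLoops {s₃ : Config} {t : ℕ} (h : s.Reading w m t)
    (h6 : s.reg 6 ≠ 0) (p1 : Numbering (s₃.arr 1) (s₃.reg 5)) (p2 : s₃.reg 5 ≤ s.reg 5 + 2)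
    (r1 : s₃.reg 1 = 1) (r2 : s₃.reg 2 = 3 * t) (r3 : s₃.reg 3 = m)
    (r4 : s₃.reg 4 = 3 + 3 * (t + 1)) (r6 : s₃.reg 6 = s.reg 6)
    (r10 : s₃.reg 10 = s₃.arr 1 (w (3 + 3 * t))) (r11 : s₃.reg 11 = w (4 + 3 * t))
    (r12 : s₃.reg 12 = s₃.arr 1 (w (5 + 3 * t))) (ka3 : ∀ a, a ≠ 1 → s₃.arr a = s.arr a)
    (hf : ∀ x, s.arr 1 x ≠ 0 → s₃.arr 1 x = s.arr 1 x) (hn10 : s₃.arr 1 (w (3 + 3 * t)) ≠ 0)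
    (hn12 : s₃.arr 1 (w (5 + 3 * t)) ≠ 0) :
    ((appendLoops ⨟ sub 6 6 1).run s₃).Reading w m (t + 1) := by
  have h5 := h.reg_5
  have h6' := h.reg_6
  refine ⟨?_, ?_, ?_, ?_, ?_, ?_, ?_, ?_, ?_⟩
  · simp [arr_appendLoops, ka3, h.arr_0]
  · simp [reg_appendLoops, r1]
  · simp [reg_appendLoops, r1, r2]
    omega
  · simp [reg_appendLoops, r3]
  · simp [reg_appendLoops, r4]
  · simp [reg_appendLoops]
    omega
  · simp [reg_appendLoops, r6, r1]
    omega
  · simpa [reg_appendLoops, arr_appendLoops] using p1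
  · have h5 := h.lists.succ hf hn10 hn12
    rw [← r10, ← r11, ← r12, ← r2, ← ka3 2 (by norm_num), ← ka3 3 (by norm_num),
      ← ka3 4 (by norm_num)] at h5
    simpa [arr_appendLoops, r1] using h5

theorem reg_fetch (r : ℕ) (h1 : s.reg 1 = 1) :
    (fetch.run s).reg r = if r = 4 then s.reg 4 + 3 else if r = 10 then s.arr 0 (s.reg 4) else
      if r = 11 then s.arr 0 (s.reg 4 + 1) else if r = 12 then s.arr 0 (s.reg 4 + 2) else
      s.reg r := by
  simp only [fetch, run, Config.reg_setReg, Config.arr_setReg]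
  norm_num [h1]
  split_ifs <;> simp_all

theorem readStep_spec {t : ℕ} (h : s.Reading w m t) (h6 : s.reg 6 ≠ 0) :
    (readStep.run s).Reading w m (t + 1) := by
  have hfetch := fun r ↦ reg_fetch r h.reg_1
  simp only [h.arr_0, h.reg_4] at hfetch
  set s₁ := fetch.run s with hs₁
  have k10 : s₁.reg 10 = w (3 + 3 * t) := by simp [hfetch]
  have k11 : s₁.reg 11 = w (4 + 3 * t) := by
    simp only [hfetch]
    norm_num
    congr 1
    omega
  have k12 : s₁.reg 12 = w (5 + 3 * t) := by
    simp only [hfetch]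
    norm_num
    congr 1
    omega
  have k4 : s₁.reg 4 = 3 + 3 * (t + 1) := by
    simp only [hfetch]
    norm_num
    omega
  have kr : ∀ r < 10, r ≠ 4 → s₁.reg r = s.reg r := by
    intro r hr hr'
    rw [hfetch]
    split_ifs <;> omega
  have ka : s₁.arr = s.arr := rfl
  obtain ⟨n1, n2, n3, n4, n5, n6, n7⟩ := number_spec (s := s₁) (r := 10)
    (by rw [ka, kr 5 (by norm_num) (by norm_num)]; exact h.numbering)
    (by rw [kr 1 (by norm_num) (by norm_num), h.reg_1]) (by norm_num) (by norm_num)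
  set s₂ := (number 10).run s₁
  obtain ⟨p1, p2, p3, p4, p5, p6, p7⟩ := number_spec (s := s₂) (r := 12) n1
    (by rw [n6 1 (by norm_num) (by norm_num) (by norm_num), kr 1 (by norm_num) (by norm_num),
      h.reg_1]) (by norm_num) (by norm_num)
  set s₃ := (number 12).run s₂
  have q12 : s₂.reg 12 = w (5 + 3 * t) := by
    rw [n6 12 (by norm_num) (by norm_num) (by norm_num), k12]
  have kr3 : ∀ r, r ≠ 5 → r ≠ 14 → r ≠ 10 → r ≠ 12 → s₃.reg r = s₁.reg r := fun r h1 h2 h3 h4 ↦ by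
    rw [p6 r h1 h2 h4, n6 r h1 h2 h3]
  have r10 : s₃.reg 10 = s₃.arr 1 (w (3 + 3 * t)) := by
    rw [p6 10 (by norm_num) (by norm_num) (by norm_num), n4, k10, p5]
    rw [← k10]
    exact n3
  have r12 : s₃.reg 12 = s₃.arr 1 (w (5 + 3 * t)) := by rw [p4, q12]
  have r11 : s₃.reg 11 = w (4 + 3 * t) := by
    rw [kr3 11 (by norm_num) (by norm_num) (by norm_num) (by norm_num), k11]
  have r1 : s₃.reg 1 = 1 := by
    rw [kr3 1 (by norm_num) (by norm_num) (by norm_num) (by norm_num), kr 1 (by norm_num)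
      (by norm_num), h.reg_1]
  have r2 : s₃.reg 2 = 3 * t := by
    rw [kr3 2 (by norm_num) (by norm_num) (by norm_num) (by norm_num), kr 2 (by norm_num)
      (by norm_num), h.reg_2]
  have r3 : s₃.reg 3 = m := by
    rw [kr3 3 (by norm_num) (by norm_num) (by norm_num) (by norm_num), kr 3 (by norm_num)
      (by norm_num), h.reg_3]
  have r4 : s₃.reg 4 = 3 + 3 * (t + 1) := by
    rw [kr3 4 (by norm_num) (by norm_num) (by norm_num) (by norm_num), k4]
  have r6 : s₃.reg 6 = s.reg 6 := by
    rw [kr3 6 (by norm_num) (by norm_num) (by norm_num) (by norm_num), kr 6 (by norm_num)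
      (by norm_num)]
  have ka3 : ∀ a, a ≠ 1 → s₃.arr a = s.arr a := fun a ha ↦ by rw [p7 a ha, n7 a ha, ka]
  have hf : ∀ x, s.arr 1 x ≠ 0 → s₃.arr 1 x = s.arr 1 x := fun x hx ↦ by
    have h1 := n5 x hx
    rw [p5 x (by rw [h1]; exact hx), h1]
    rfl
  have hn10 : s₃.arr 1 (w (3 + 3 * t)) ≠ 0 := by
    rw [k10] at n3
    rw [p5 _ n3]
    exact n3
  have hn12 : s₃.arr 1 (w (5 + 3 * t)) ≠ 0 := by rw [← q12]; exact p3
  have h5 := h.reg_5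
  have h6' := h.reg_6
  have k5 := kr 5 (by norm_num) (by norm_num)
  have k5' : s₂.reg 5 ≤ s₁.reg 5 + 1 := n2
  exact h.appendLoops h6 p1 (p2.trans (by omega)) r1 r2 r3 r4 r6 r10 r11 r12 ka3 hf hn10 hn12

theorem readTransitions_spec (h0 : s.arr 0 = w) (h1 : s.arr 1 = fun _ ↦ 0) (hm : w 2 = m)
    (hc : 60 * m + 9 ≤ c) :
    Wp readTransitions s c fun s' c' ↦ s'.Reading w m m ∧ c ≤ c' + (60 * m + 9) := by
  have hcost : readStep.cost ≤ 59 := by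
    simp [readStep, fetch, number, appendLoops, append]
  refine Wp.seq (Wp.of_loopFree (by simp) (by simp; omega) ?_)
  refine Wp.loop (fun s' c' ↦ ∃ t, s'.Reading w m t ∧ 60 * s'.reg 6 + 1 ≤ c' ∧
    c ≤ c' + (60 * t + 8)) ?_ ?_ ?_
  · refine ⟨0, ⟨by simp [h0], by simp, by simp, by simp [h0, hm], by simp, by simp,
      by simp [h0, hm], ?_, fun i hi ↦ by omega⟩, by simp [h0, hm]; omega, by simp; omega⟩
    simp only [run, Config.arr_setReg, h1]
    refine ⟨by simp, ?_, ?_, ?_⟩ <;> simp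
  · rintro s' c' ⟨t, h, h2, h3⟩ h6
    have h4 := readStep_spec h h6
    have h5 := h.reg_6
    have h7 := h4.reg_6
    refine ⟨by omega, Wp.of_loopFree (by simp [readStep, fetch, number, appendLoops, append])
      (by omega) ⟨t + 1, h4, by omega, by omega⟩⟩
  · rintro s' c' ⟨t, h, h2, h3⟩ h6
    have h5 := h.reg_6
    obtain rfl : t = m := by omega
    exact ⟨by omega, h, by omega⟩

theorem multiples_spec {a x : ℕ} (h1 : s.reg 1 = 1) (hx : x < 10)
    (hc : 5 * s.reg 7 + 4 ≤ c) :
    Wp (multiples a x) s c fun s' c' ↦ s.SameOn (fun r ↦ r < 10 ∨ 12 < r) (· ≠ a) s' ∧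
      (∀ i < s.reg 7, s'.arr a i = i * s.reg x) ∧ s'.reg 11 = s.reg 7 * s.reg x ∧
      c ≤ c' + (5 * s.reg 7 + 4) := by
  have hP : (multiples a x).Preserves (fun r ↦ r < 10 ∨ 12 < r) (· ≠ a) := by simp [multiples]
  refine Wp.sameOn hP ?_
  have h7 : x ≠ 10 ∧ x ≠ 11 ∧ x ≠ 12 := by omega
  refine Wp.seq (Wp.of_loopFree (by simp) (by simp; omega) ?_)
  refine Wp.loop (fun s' c' ↦ ∃ t, (∀ i < t, s'.arr a i = i * s.reg x) ∧ s'.reg 1 = 1 ∧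
    s'.reg x = s.reg x ∧ s'.reg 10 = t ∧ s'.reg 11 = t * s.reg x ∧ s'.reg 12 + t = s.reg 7 ∧
    5 * s'.reg 12 + 1 ≤ c' ∧ c ≤ c' + (5 * t + 3)) ?_ ?_ ?_
  · refine ⟨0, by simp, by simp [h1], by simp [h7], by simp, by simp, by simp, ?_, ?_⟩
    all_goals simp
    all_goals omega
  · rintro s' c' ⟨t, g1, g2, g3, g4, g5, g6, g7, g8⟩ hne
    refine ⟨by omega, Wp.of_loopFree (by simp) (by simp; omega) ⟨t + 1, ?_, by simp [g2],
      by simp [h7, g3], by simp [g2, g4], by simp [h7, g3, g5, Nat.succ_mul],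
      by simp [g2]; omega, by simp [g2]; omega, by simp; omega⟩⟩
    intro i hi
    simp only [run, Config.arr_setReg, Config.arr_setArr, Config.reg_setReg, Config.reg_setArr,
      if_true, Function.update_apply, g4, g5]
    split_ifs with h
    · rw [h]
    · exact g1 i (by omega)
  · rintro s' c' ⟨t, g1, g2, g3, g4, g5, g6, g7, g8⟩ h0
    obtain rfl : t = s.reg 7 := by omega
    exact ⟨by omega, g1, g5, by omega⟩

/-- The number `f` of the states, and the transitions `S`, `L` and `D`, that are computed from the
input `w` by `setup`. -/
structure Config.IsSetup (w : ℕ → ℕ) (m : ℕ) (s : Config) : Prop where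
  numbering : Numbering (s.arr 1) (1 + 2 * m)
  lists : Lists w (s.arr 1) (s.arr 2) (s.arr 3) (s.arr 4) m
  reg_2 : s.reg 2 = 3 * m
  arr_5 : ∀ x < 2 * m + 2, s.arr 5 x = x * (2 * m + 2)
  arr_6 : ∀ x < 2 * m + 2, s.arr 6 x = x * ((2 * m + 2) * (2 * m + 2))

theorem Numbering.mono (h : Numbering f n) (hnm : n ≤ m) : Numbering f m where
  one_le := h.one_le.trans hnm
  two_le := h.two_le
  le x := (h.le x).trans hnm
  inj := h.inj

theorem setup_spec (h0 : s.arr 0 = w) (h1 : s.arr 1 = fun _ ↦ 0) (hm : w 2 = m)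
    (hc : 100 * m + 100 ≤ c) :
    Wp setup s c fun s' c' ↦ s.SameOn (fun r ↦ r = 0 ∨ 14 < r) (fun a ↦ a = 0 ∨ 6 < a) s' ∧
      s'.IsSetup w m ∧ c ≤ c' + (100 * m + 100) := by
  have hP : setup.Preserves (fun r ↦ r = 0 ∨ 14 < r) (fun a ↦ a = 0 ∨ 6 < a) := by
    simp [setup, readTransitions, readStep, fetch, number, appendLoops, append, multiples]
  refine Wp.sameOn hP ?_
  refine Wp.seq ((readTransitions_spec h0 h1 hm (by omega)).mono ?_)
  rintro s₁ c₁ ⟨h, hc₁⟩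
  refine Wp.seq (Wp.of_loopFree (by simp) (by simp; omega) ?_)
  set s₂ := (add 7 3 3 ⨟ add 7 7 1 ⨟ add 7 7 1).run s₁ with hs₂
  have k7 : s₂.reg 7 = 2 * m + 2 := by
    simp [hs₂, h.reg_3, h.reg_1]
    omega
  have k1 : s₂.reg 1 = 1 := by simp [hs₂, h.reg_1]
  have k2 : s₂.reg 2 = 3 * m := by simp [hs₂, h.reg_2]
  have ka : s₂.arr = s₁.arr := rfl
  have kc : (add 7 3 3 ⨟ add 7 7 1 ⨟ add 7 7 1).cost = 3 := by simp
  rw [kc]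
  clear_value s₂
  refine Wp.seq ((multiples_spec k1 (by norm_num) (by omega)).mono ?_)
  rintro s₃ c₃ ⟨g1, g2, g3, g4⟩
  refine Wp.seq (Wp.of_loopFree (by simp) (by simp; omega) ?_)
  rw [k7] at g2 g3 g4
  set s₄ := (copy 8 11).run s₃ with hs₄
  have l7 : s₄.reg 7 = 2 * m + 2 := by simp [hs₄, g1.1 7 (by norm_num), k7]
  have l1 : s₄.reg 1 = 1 := by simp [hs₄, g1.1 1 (by norm_num), k1]
  have l2 : s₄.reg 2 = 3 * m := by simp [hs₄, g1.1 2 (by norm_num), k2]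
  have l8 : s₄.reg 8 = (2 * m + 2) * (2 * m + 2) := by simp [hs₄, g3]
  have lc : (copy 8 11).cost = 1 := by simp
  have la : s₄.arr = s₃.arr := rfl
  rw [lc]
  clear_value s₄
  refine (multiples_spec l1 (by norm_num) (by omega)).mono ?_
  rintro s₅ c₅ ⟨g5, g6, g7, g8⟩
  rw [l7] at g6 g7 g8
  have hn := h.reg_5
  have ha : ∀ a < 5, s₅.arr a = s₁.arr a := fun a ha ↦ by
    rw [g5.2 a (by omega), la, g1.2 a (by omega), ka]
  refine ⟨⟨?_, ?_, ?_, ?_, ?_⟩, by omega⟩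
  · rw [ha 1 (by norm_num)]
    exact h.numbering.mono hn
  · rw [ha 1 (by norm_num), ha 2 (by norm_num), ha 3 (by norm_num), ha 4 (by norm_num)]
    exact h.lists
  · rw [g5.1 2 (by norm_num), l2]
  · intro x hx
    rw [g5.2 5 (by norm_num), la, g2 x hx]
  · intro x hx
    rw [g6 x hx, l8]

end RAM

namespace εNFA

variable {α σ : Type*} {A : εNFA α σ}

/-! ### Product graphs of an automaton -/

/-- The state `p` is an end point of a transition. -/
def Occurs (A : εNFA α σ) (p : σ) : Prop :=
  ∃ e ∈ A.transitions, e.1 = p ∨ e.2.2 = p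

/-- The transitions of `A`, and self-loops labeled by `ε` at the end points of transitions. -/
def loopedTransitions (A : εNFA α σ) : Set (σ × Option α × σ) :=
  {e | e ∈ A.transitions ∨ (e.2.1 = none ∧ e.1 = e.2.2 ∧ A.Occurs e.1)}

/-- `A.ProductEdge u v m`: there is an edge from `u` to `v` with mark `m` in the disjoint union of
the graph of pairs of states (with a flag) and the graph of triples of states. -/
inductive ProductEdge (A : εNFA α σ) :
    (σ × σ × Bool) ⊕ (σ × σ × σ) → (σ × σ × Bool) ⊕ (σ × σ × σ) → ℕ → Prop
  | pair {a : Option α} {s₁ d₁ s₂ d₂ : σ} : (s₁, a, d₁) ∈ A.loopedTransitions →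
      (s₂, a, d₂) ∈ A.loopedTransitions →
      ProductEdge A (.inl (s₁, s₂, false)) (.inl (d₁, d₂, false)) 0
  | unflag {a : Option α} {s₁ d₁ s₂ d₂ : σ} : (s₁, a, d₁) ∈ A.loopedTransitions →
      (s₂, a, d₂) ∈ A.loopedTransitions → a ≠ none →
      ProductEdge A (.inl (s₁, s₂, true)) (.inl (d₁, d₂, false)) 0
  | forkLetter {a : Option α} {s d₁ d₂ : σ} : (s, a, d₁) ∈ A.loopedTransitions →
      (s, a, d₂) ∈ A.loopedTransitions → a ≠ none → d₁ ≠ d₂ →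
      ProductEdge A (.inl (s, s, false)) (.inl (d₁, d₂, false)) 2
  | forkEps {s d₁ d₂ : σ} : (s, none, d₁) ∈ A.loopedTransitions →
      (s, none, d₂) ∈ A.loopedTransitions → s ≠ d₁ → s ≠ d₂ → d₁ ≠ d₂ →
      ProductEdge A (.inl (s, s, false)) (.inl (d₁, d₂, false)) 2
  | flagged {s₁ d₁ s₂ : σ} : (s₁, none, d₁) ∈ A.loopedTransitions →
      (s₂, none, s₂) ∈ A.loopedTransitions →
      ProductEdge A (.inl (s₁, s₂, true)) (.inl (d₁, s₂, true)) 0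
  | flag {s d : σ} : (s, none, d) ∈ A.loopedTransitions → (s, none, s) ∈ A.loopedTransitions →
      s ≠ d → ProductEdge A (.inl (s, s, false)) (.inl (d, s, true)) 2
  | triple {a : Option α} {s₁ d₁ s₂ d₂ s₃ d₃ : σ} : (s₁, a, d₁) ∈ A.loopedTransitions →
      (s₂, a, d₂) ∈ A.loopedTransitions → (s₃, a, d₃) ∈ A.loopedTransitions →
      ProductEdge A (.inr (s₁, s₂, s₃)) (.inr (d₁, d₂, d₃)) 0
  | jump {a : Option α} {s₁ d₁ s₂ s₃ d₃ : σ} : (s₁, a, d₁) ∈ A.loopedTransitions →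
      (s₂, a, d₃) ∈ A.loopedTransitions → (s₃, a, d₃) ∈ A.loopedTransitions → a ≠ none →
      d₁ ≠ d₃ → ProductEdge A (.inr (s₁, s₂, s₃)) (.inr (d₁, d₁, d₃)) 1

/-- Reachability in the product graphs. -/
def ProductReach (A : εNFA α σ) :
    (σ × σ × Bool) ⊕ (σ × σ × σ) → (σ × σ × Bool) ⊕ (σ × σ × σ) → Prop :=
  Relation.ReflTransGen fun u v ↦ ∃ m, A.ProductEdge u v m

/-- An edge with mark `m` lies on a cycle. -/
def HasMarkedCycle (A : εNFA α σ) (m : ℕ) : Prop :=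
  ∃ u v, A.ProductEdge u v m ∧ A.ProductReach v u

/-- There is a path from `p` to `q` labeled by `v`. -/
def Reads (A : εNFA α σ) (p : σ) (v : List α) (q : σ) : Prop :=
  ∃ π, A.IsTransitionPath p π q ∧ pathLabel π = v

theorem Reads.trans {p q r : σ} {v w : List α} (h : A.Reads p v q) (h' : A.Reads q w r) :
    A.Reads p (v ++ w) r := by
  obtain ⟨π, h1, rfl⟩ := h
  obtain ⟨ρ, h2, rfl⟩ := h'
  exact ⟨π ++ ρ, isTransitionPath_append.2 ⟨q, h1, h2⟩, pathLabel_append ..⟩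

theorem Reads.refl (A : εNFA α σ) (p : σ) : A.Reads p [] p := ⟨[], rfl, rfl⟩

theorem reads_of_mem_loopedTransitions {e : σ × Option α × σ} (h : e ∈ A.loopedTransitions) :
    A.Reads e.1 e.2.1.toList e.2.2 := by
  obtain ⟨p, a, q⟩ := e
  rcases h with h | ⟨h1, h2, -⟩
  · refine ⟨[(p, a, q)], ⟨h, rfl, rfl⟩, ?_⟩
    cases a <;> rfl
  · obtain rfl : a = none := h1
    obtain rfl : p = q := h2
    exact .refl A p

theorem mem_transitions_of_ne_none {p q : σ} {a : Option α}
    (h : (p, a, q) ∈ A.loopedTransitions) (ha : a ≠ none) : (p, a, q) ∈ A.transitions :=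
  h.resolve_right fun h ↦ ha h.1

theorem mem_transitions_of_ne {p q : σ} {a : Option α}
    (h : (p, a, q) ∈ A.loopedTransitions) (hpq : p ≠ q) : (p, a, q) ∈ A.transitions :=
  h.resolve_right fun h ↦ hpq h.2.1

/-- The parts of the product graphs. -/
theorem ProductReach.isLeft_eq {u v : (σ × σ × Bool) ⊕ (σ × σ × σ)} (h : A.ProductReach u v) :
    u.isLeft = v.isLeft := by
  induction h with
  | refl => rfl
  | tail _ h ih =>
    obtain ⟨m, h⟩ := h
    rw [ih]
    cases h <;> rfl

theorem ProductEdge.reads {x₁ x₂ y₁ y₂ : σ} {b c : Bool} {m : ℕ}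
    (h : A.ProductEdge (.inl (x₁, x₂, b)) (.inl (y₁, y₂, c)) m) :
    ∃ w, A.Reads x₁ w y₁ ∧ A.Reads x₂ w y₂ := by
  cases h with
  | pair h1 h2 => exact ⟨_, reads_of_mem_loopedTransitions h1, reads_of_mem_loopedTransitions h2⟩
  | unflag h1 h2 => exact ⟨_, reads_of_mem_loopedTransitions h1, reads_of_mem_loopedTransitions h2⟩
  | forkLetter h1 h2 =>
    exact ⟨_, reads_of_mem_loopedTransitions h1, reads_of_mem_loopedTransitions h2⟩
  | forkEps h1 h2 =>
    exact ⟨_, reads_of_mem_loopedTransitions h1, reads_of_mem_loopedTransitions h2⟩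
  | flagged h1 h2 => exact ⟨_, reads_of_mem_loopedTransitions h1, reads_of_mem_loopedTransitions h2⟩
  | flag h1 h2 => exact ⟨_, reads_of_mem_loopedTransitions h1, reads_of_mem_loopedTransitions h2⟩

theorem ProductReach.reads {x₁ x₂ : σ} {b : Bool} {v : (σ × σ × Bool) ⊕ (σ × σ × σ)}
    (h : A.ProductReach (.inl (x₁, x₂, b)) v) :
    ∃ y₁ y₂ c, v = .inl (y₁, y₂, c) ∧ ∃ w, A.Reads x₁ w y₁ ∧ A.Reads x₂ w y₂ := by
  induction h with
  | refl => exact ⟨_, _, _, rfl, [], .refl _ _, .refl _ _⟩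
  | @tail v v' h1 h ih =>
    obtain ⟨y₁, y₂, c, rfl, w, h2, h3⟩ := ih
    obtain ⟨m, h⟩ := h
    have h4 : v'.isLeft := (ProductReach.isLeft_eq (.single ⟨m, h⟩)).symm
    obtain ⟨⟨z₁, z₂, d⟩, rfl⟩ := Sum.isLeft_iff.1 h4
    obtain ⟨w', h5, h6⟩ := h.reads
    exact ⟨_, _, _, rfl, w ++ w', h2.trans h5, h3.trans h6⟩

/-- A path from a flagged pair to an unflagged one reads, in its second component, a letter before
any `ε`. -/
theorem ProductReach.reads_of_flagged {x₁ x₂ y₁ y₂ : σ}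
    (h : A.ProductReach (.inl (x₁, x₂, true)) (.inl (y₁, y₂, false))) :
    ∃ a z v, (x₂, some a, z) ∈ A.transitions ∧ A.Reads x₁ (a :: v) y₁ ∧ A.Reads z v y₂ := by
  suffices key : ∀ u, A.ProductReach (.inl (x₁, x₂, true)) u → ∃ y₁ y₂ c, u = .inl (y₁, y₂, c) ∧
      ((c = true ∧ y₂ = x₂ ∧ A.Reads x₁ [] y₁) ∨
        ∃ a z v, (x₂, some a, z) ∈ A.transitions ∧ A.Reads x₁ (a :: v) y₁ ∧ A.Reads z v y₂) by
    obtain ⟨z₁, z₂, c, h1, h2⟩ := key _ h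
    simp only [Sum.inl.injEq, Prod.mk.injEq] at h1
    obtain ⟨rfl, rfl, rfl⟩ := h1
    simpa using h2
  intro u hu
  induction hu with
  | refl => exact ⟨_, _, _, rfl, .inl ⟨rfl, rfl, .refl _ _⟩⟩
  | @tail u u' h1 h ih =>
    obtain ⟨y₁, y₂, c, rfl, h2⟩ := ih
    obtain ⟨m, hm⟩ := h
    have h4 : u'.isLeft := (ProductReach.isLeft_eq (.single ⟨m, hm⟩)).symm
    obtain ⟨⟨z₁, z₂, d⟩, rfl⟩ := Sum.isLeft_iff.1 h4
    refine ⟨z₁, z₂, d, rfl, ?_⟩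
    rcases h2 with ⟨rfl, rfl, h2⟩ | ⟨a, z, v, h2, h3, h5⟩
    · cases hm with
      | @unflag a _ _ _ _ h5 h6 h7 =>
        obtain ⟨a, rfl⟩ := Option.ne_none_iff_exists'.1 h7
        exact .inr ⟨a, z₂, [], mem_transitions_of_ne_none h6 h7,
          h2.trans (reads_of_mem_loopedTransitions h5), .refl _ _⟩
      | flagged h5 h6 => exact .inl ⟨rfl, rfl, h2.trans (reads_of_mem_loopedTransitions h5)⟩
    · obtain ⟨w, h6, h7⟩ := hm.reads
      exact .inr ⟨a, z, v ++ w, h2, h3.trans h6, h5.trans h7⟩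

theorem hasTwinCycles_of_ne {e₁ e₂ : σ × Option α × σ} {r : σ} {v w : List α}
    (h1 : e₁ ∈ A.transitions) (h2 : e₂ ∈ A.transitions) (hr1 : e₁.1 = r) (hr2 : e₂.1 = r)
    (hne : e₁ ≠ e₂) (h3 : A.Reads e₁.2.2 v r) (h4 : A.Reads e₂.2.2 w r)
    (hl : e₁.2.1.toList ++ v = e₂.2.1.toList ++ w) : A.HasTwinCycles := by
  obtain ⟨π, h5, rfl⟩ := h3
  obtain ⟨ρ, h6, rfl⟩ := h4
  refine ⟨r, e₁ :: π, e₂ :: ρ, fun h ↦ hne (List.cons.inj h).1, ⟨h1, hr1, h5⟩, ⟨h2, hr2, h6⟩, ?_⟩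
  have key : ∀ (e : σ × Option α × σ) π, pathLabel (e :: π) = e.2.1.toList ++ pathLabel π := by
    rintro ⟨p, a, q⟩ π
    cases a <;> simp [pathLabel]
  rw [key, key, hl]

/-- Each kind of edge with mark 2 starts two cycles with different first transitions. When an ε
competes with a letter, the flag guarantees this: it freezes the second component until both
components read a letter. -/
theorem hasTwinCycles_of_hasMarkedCycle (h : A.HasMarkedCycle 2) : A.HasTwinCycles := by
  obtain ⟨u, v, h, h'⟩ := h
  cases h with
  | forkLetter h1 h2 h3 h4 =>
    obtain ⟨_, _, _, h5, w, h6, h7⟩ := h'.reads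
    cases h5
    exact hasTwinCycles_of_ne (mem_transitions_of_ne_none h1 h3) (mem_transitions_of_ne_none h2 h3)
      rfl rfl (by simp [h4]) h6 h7 rfl
  | forkEps h1 h2 h3 h3' h4 =>
    obtain ⟨_, _, _, h5, w, h6, h7⟩ := h'.reads
    cases h5
    exact hasTwinCycles_of_ne (mem_transitions_of_ne h1 h3) (mem_transitions_of_ne h2 h3')
      rfl rfl (by simp [h4]) h6 h7 rfl
  | flag h1 h2 h3 =>
    obtain ⟨a, z, v, h4, h5, h6⟩ := h'.reads_of_flagged
    exact hasTwinCycles_of_ne (mem_transitions_of_ne h1 h3) h4 rfl rfl (by simp) h5 h6 rfl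

theorem ProductEdge.reads_inr {x₁ x₂ x₃ y₁ y₂ y₃ : σ} {m : ℕ}
    (h : A.ProductEdge (.inr (x₁, x₂, x₃)) (.inr (y₁, y₂, y₃)) m) :
    ∃ w, A.Reads x₁ w y₁ ∧ (A.Reads x₂ w y₂ ∨ y₂ = y₁) ∧ A.Reads x₃ w y₃ := by
  cases h with
  | triple h1 h2 h3 => exact ⟨_, reads_of_mem_loopedTransitions h1,
      .inl (reads_of_mem_loopedTransitions h2), reads_of_mem_loopedTransitions h3⟩
  | jump h1 h2 h3 => exact ⟨_, reads_of_mem_loopedTransitions h1, .inr rfl,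
      reads_of_mem_loopedTransitions h3⟩

/-- A jump resets the second component to the first, so after any number of jumps that component
continues a path from `x₂` or from `x₁`. On a cycle through `(p, p, q)` both cases agree. -/
theorem ProductReach.reads_inr {x₁ x₂ x₃ : σ} {v : (σ × σ × Bool) ⊕ (σ × σ × σ)}
    (h : A.ProductReach (.inr (x₁, x₂, x₃)) v) :
    ∃ y₁ y₂ y₃, v = .inr (y₁, y₂, y₃) ∧ ∃ w, A.Reads x₁ w y₁ ∧
      (A.Reads x₂ w y₂ ∨ A.Reads x₁ w y₂) ∧ A.Reads x₃ w y₃ := by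
  induction h with
  | refl => exact ⟨_, _, _, rfl, [], .refl _ _, .inl (.refl _ _), .refl _ _⟩
  | @tail v v' h1 h ih =>
    obtain ⟨y₁, y₂, y₃, rfl, w, h2, h3, h3'⟩ := ih
    obtain ⟨m, h⟩ := h
    have h4 : v'.isLeft = false := (ProductReach.isLeft_eq (.single ⟨m, h⟩)).symm
    obtain ⟨⟨z₁, z₂, z₃⟩, rfl⟩ := Sum.isRight_iff.1 (Sum.isLeft_eq_false.1 h4)
    obtain ⟨w', h5, h6, h7⟩ := h.reads_inr
    refine ⟨_, _, _, rfl, w ++ w', h2.trans h5, ?_, h3'.trans h7⟩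
    rcases h6 with h6 | rfl
    · exact h3.imp (·.trans h6) (·.trans h6)
    · exact .inr (h2.trans h5)

theorem Reads.letterPaths_nonempty {p q r : σ} {a : α} {v : List α} (h : A.Reads p v q)
    (hr : (q, some a, r) ∈ A.transitions) : (A.letterPaths (v ++ [a]) p r).Nonempty := by
  obtain ⟨π, h1, rfl⟩ := h
  refine ⟨π ++ [(q, some a, r)], isTransitionPath_append.2 ⟨q, h1, hr, rfl, rfl⟩, ?_, ?_⟩
  · rw [pathLabel_append]
    rfl
  · exact LetterEnded.append_of_ne_nil (.singleton q r a) (by simp)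

/-- The return walk from `(d₁, d₁, d₃)` reads `w` to the sources of the three transitions of the
jump; appending its letter gives the paths d₁ → d₁, d₁ → d₃ and d₃ → d₃. -/
theorem hasBridgedCycles_of_hasMarkedCycle (h : A.HasMarkedCycle 1) : A.HasBridgedCycles := by
  obtain ⟨u, v, h, h'⟩ := h
  cases h with
  | jump h1 h2 h3 h4 h5 =>
    obtain ⟨_, _, _, h6, w, h7, h8, h9⟩ := h'.reads_inr
    cases h6
    obtain ⟨a, rfl⟩ := Option.ne_none_iff_exists'.1 h4
    exact ⟨w ++ [a], _, _, h5, h7.letterPaths_nonempty (mem_transitions_of_ne_none h1 h4),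
      (or_self_iff.1 h8).letterPaths_nonempty (mem_transitions_of_ne_none h2 h4),
      h9.letterPaths_nonempty (mem_transitions_of_ne_none h3 h4)⟩

/-- There is a path from `p` to `q` all of whose transitions are labeled by `ε`. -/
def EpsReach (A : εNFA α σ) : σ → σ → Prop :=
  Relation.ReflTransGen fun p q ↦ (p, none, q) ∈ A.transitions

theorem epsReach_of_reads_nil {p q : σ} (h : A.Reads p [] q) : A.EpsReach p q := by
  obtain ⟨π, h1, h2⟩ := h
  induction π generalizing p with
  | nil => exact h1 ▸ .refl
  | cons e π ih =>
    obtain ⟨p, _ | a, r⟩ := e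
    · obtain ⟨h3, rfl, h4⟩ := h1
      exact .head h3 (ih h4 (by simpa [pathLabel] using h2))
    · simp [pathLabel] at h2

theorem exists_epsReach_of_reads_cons {p q : σ} {a : α} {v : List α} (h : A.Reads p (a :: v) q) :
    ∃ s t, A.EpsReach p s ∧ (s, some a, t) ∈ A.transitions ∧ A.Reads t v q := by
  obtain ⟨π, h1, h2⟩ := h
  induction π generalizing p with
  | nil => simp [pathLabel] at h2
  | cons e π ih =>
    obtain ⟨p, _ | b, r⟩ := e
    · obtain ⟨h3, rfl, h4⟩ := h1
      obtain ⟨s, t, h5, h6⟩ := ih h4 (by simpa [pathLabel] using h2)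
      exact ⟨s, t, .head h3 h5, h6⟩
    · obtain ⟨h3, rfl, h4⟩ := h1
      obtain ⟨rfl, h5⟩ := List.cons.inj (show b :: pathLabel π = a :: v from h2)
      exact ⟨_, r, .refl, h3, π, h4, h5⟩

theorem occurs_src {p q : σ} {a : Option α} (h : (p, a, q) ∈ A.transitions) : A.Occurs p :=
  ⟨_, h, .inl rfl⟩

theorem occurs_tgt {p q : σ} {a : Option α} (h : (p, a, q) ∈ A.transitions) : A.Occurs q :=
  ⟨_, h, .inr rfl⟩

theorem Occurs.stay {p : σ} (h : A.Occurs p) : (p, none, p) ∈ A.loopedTransitions :=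
  .inr ⟨rfl, rfl, h⟩

theorem EpsReach.occurs {p q : σ} (h : A.EpsReach p q) (hp : A.Occurs p) : A.Occurs q := by
  cases h with
  | refl => exact hp
  | tail _ h => exact occurs_tgt h

/-- The added self-loops let one component move along ε-transitions while the others wait; `f`
places the moving component. -/
theorem EpsReach.productReach {p q : σ} (h : A.EpsReach p q)
    (f : σ → (σ × σ × Bool) ⊕ (σ × σ × σ))
    (hf : ∀ p q, (p, none, q) ∈ A.transitions → A.ProductEdge (f p) (f q) 0) :
    A.ProductReach (f p) (f q) := by
  induction h with
  | refl => exact .refl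
  | tail _ h ih => exact .tail ih ⟨0, hf _ _ h⟩

theorem EpsReach.productReach_pair {p q r s : σ} (h : A.EpsReach p q) (h' : A.EpsReach r s)
    (hp : A.Occurs p) (hr : A.Occurs r) :
    A.ProductReach (.inl (p, r, false)) (.inl (q, s, false)) :=
  (h.productReach (fun x ↦ .inl (x, r, false)) fun _ _ h ↦ .pair (.inl h) hr.stay).trans
  (h'.productReach (fun x ↦ .inl (q, x, false)) fun _ _ h' ↦ .pair (h.occurs hp).stay (.inl h'))

theorem EpsReach.productReach_triple {p q p' q' p'' q'' : σ} (h : A.EpsReach p q)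
    (h' : A.EpsReach p' q') (h'' : A.EpsReach p'' q'') (hp : A.Occurs p) (hp' : A.Occurs p')
    (hp'' : A.Occurs p'') :
    A.ProductReach (.inr (p, p', p'')) (.inr (q, q', q'')) :=
  (h.productReach (fun x ↦ .inr (x, p', p''))
    fun _ _ h ↦ .triple (.inl h) hp'.stay hp''.stay).trans <|
  (h'.productReach (fun x ↦ .inr (q, x, p''))
    fun _ _ h' ↦ .triple (h.occurs hp).stay (.inl h') hp''.stay).trans
  (h''.productReach (fun x ↦ .inr (q, q', x))
    fun _ _ h'' ↦ .triple (h.occurs hp).stay (h'.occurs hp').stay (.inl h''))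

theorem Reads.productReach_pair {p q r s : σ} {v : List α} (h : A.Reads p v q)
    (h' : A.Reads r v s) (hp : A.Occurs p) (hr : A.Occurs r) :
    A.ProductReach (.inl (p, r, false)) (.inl (q, s, false)) := by
  induction v generalizing p r with
  | nil => exact (epsReach_of_reads_nil h).productReach_pair (epsReach_of_reads_nil h') hp hr
  | cons a v ih =>
    obtain ⟨x, y, h1, h2, h3⟩ := exists_epsReach_of_reads_cons h
    obtain ⟨x', y', h1', h2', h3'⟩ := exists_epsReach_of_reads_cons h'
    exact (h1.productReach_pair h1' hp hr).trans (.head ⟨0, .pair (.inl h2) (.inl h2')⟩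
      (ih h3 h3' (occurs_tgt h2) (occurs_tgt h2')))

theorem Reads.productReach_triple {p q p' q' p'' q'' : σ} {v : List α} (h : A.Reads p v q)
    (h' : A.Reads p' v q') (h'' : A.Reads p'' v q'') (hp : A.Occurs p) (hp' : A.Occurs p')
    (hp'' : A.Occurs p'') :
    A.ProductReach (.inr (p, p', p'')) (.inr (q, q', q'')) := by
  induction v generalizing p p' p'' with
  | nil =>
    exact (epsReach_of_reads_nil h).productReach_triple (epsReach_of_reads_nil h')
      (epsReach_of_reads_nil h'') hp hp' hp''
  | cons a v ih =>
    obtain ⟨x, y, h1, h2, h3⟩ := exists_epsReach_of_reads_cons h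
    obtain ⟨x', y', h1', h2', h3'⟩ := exists_epsReach_of_reads_cons h'
    obtain ⟨x'', y'', h1'', h2'', h3''⟩ := exists_epsReach_of_reads_cons h''
    exact (h1.productReach_triple h1' h1'' hp hp' hp'').trans
      (.head ⟨0, .triple (.inl h2) (.inl h2') (.inl h2'')⟩
      (ih h3 h3' h3'' (occurs_tgt h2) (occurs_tgt h2') (occurs_tgt h2'')))

/-- From a flagged pair whose second component continues with a letter. -/
theorem Reads.productReach_flagged {p q r s t : σ} {a : α} {v : List α} (h : A.Reads p (a :: v) q)
    (hr : (r, some a, s) ∈ A.transitions) (h' : A.Reads s v t) :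
    A.ProductReach (.inl (p, r, true)) (.inl (q, t, false)) := by
  obtain ⟨x, y, h1, h2, h3⟩ := exists_epsReach_of_reads_cons h
  exact (h1.productReach (fun x ↦ .inl (x, r, true))
    fun _ _ h ↦ .flagged (.inl h) (occurs_src hr).stay).trans
    (.head ⟨0, .unflag (.inl h2) (.inl hr) (by simp)⟩
      (h3.productReach_pair h' (occurs_tgt h2) (occurs_tgt hr)))

theorem exists_fork {X : Type*} {π ρ : List X} (h : ¬ π <+: ρ) (h' : ¬ ρ <+: π) :
    ∃ μ e f π' ρ', e ≠ f ∧ π = μ ++ e :: π' ∧ ρ = μ ++ f :: ρ' := by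
  induction π generalizing ρ with
  | nil => exact absurd List.nil_prefix h
  | cons e π ih =>
    cases ρ with
    | nil => exact absurd List.nil_prefix h'
    | cons f ρ =>
      by_cases hef : e = f
      · subst hef
        obtain ⟨μ, e', f', π', ρ', h1, rfl, rfl⟩ := ih
          (fun h1 ↦ h (List.cons_prefix_cons.2 ⟨rfl, h1⟩))
          (fun h1 ↦ h' (List.cons_prefix_cons.2 ⟨rfl, h1⟩))
        exact ⟨e :: μ, e', f', π', ρ', h1, rfl, rfl⟩
      · exact ⟨[], e, f, π, ρ, hef, rfl, rfl⟩

theorem IsEpsCycleFree.ne (hε : A.IsEpsCycleFree) {p q : σ} (h : (p, none, q) ∈ A.transitions) :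
    p ≠ q := by
  rintro rfl
  exact hε ⟨p, [(p, none, p)], by simp, ⟨h, rfl, rfl⟩, rfl⟩

/-- Being prefix-incomparable, the two cycles have a common part up to a state `r`, where they
continue with different transitions. This fork is the marked edge; the remainders lead back to `(p,
p)`, and the common part, read in both components, to `(r, r)`. -/
theorem hasMarkedCycle_two (hε : A.IsEpsCycleFree) (h : A.HasLetterTwinCycles) :
    A.HasMarkedCycle 2 := by
  obtain ⟨v, p, π, hπ, ρ, hρ, hne⟩ := h
  have hl := hπ.2.1.trans hρ.2.1.symm
  obtain ⟨μ, e, f, π', ρ', hef, rfl, rfl⟩ := exists_fork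
    (fun h ↦ hne (hρ.2.2.eq_of_prefix hl h)) (fun h ↦ hne (hπ.2.2.eq_of_prefix hl.symm h).symm)
  obtain ⟨r, h1, h2, rfl, h3⟩ := isTransitionPath_append.1 hπ.1
  obtain ⟨r', h1', h2', rfl, h3'⟩ := isTransitionPath_append.1 hρ.1
  have hr := h1.target_unique h1'
  obtain ⟨r, a, d⟩ := e
  obtain ⟨r', b, d'⟩ := f
  obtain rfl : r = r' := hr
  rw [pathLabel_append, pathLabel_append, List.append_cancel_left_eq] at hl
  have hocc : ∀ {x : σ} {τ}, A.IsTransitionPath x τ p → A.Occurs x → A.Occurs p := by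
    intro x τ
    induction τ generalizing x with
    | nil => rintro rfl hx; exact hx
    | cons e τ ih => exact fun h _ ↦ ih h.2.2 ⟨e, h.1, .inr rfl⟩
  have hp : A.Occurs p := hocc h3 (occurs_tgt h2)
  have hback : A.ProductReach (.inl (p, p, false)) (.inl (r, r, false)) :=
    Reads.productReach_pair ⟨μ, h1, rfl⟩ ⟨μ, h1, rfl⟩ hp hp
  have hpair : ∀ {x y : σ} {v : List α}, A.Occurs x → A.Occurs y → A.Reads x v p →
      A.Reads y v p → A.ProductReach (.inl (x, y, false)) (.inl (r, r, false)) :=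
    fun hx hy h h' ↦ (h.productReach_pair h' hx hy).trans hback
  replace h3 : A.Reads d (pathLabel π') p := ⟨π', h3, rfl⟩
  replace h3' : A.Reads d' (pathLabel ρ') p := ⟨ρ', h3', rfl⟩
  rcases a with _ | a <;> rcases b with _ | b
  · have hl : pathLabel π' = pathLabel ρ' := hl
    exact ⟨_, _, .forkEps (.inl h2) (.inl h2') (hε.ne h2) (hε.ne h2') (by simpa using hef),
      hpair (occurs_tgt h2) (occurs_tgt h2') h3 (hl ▸ h3')⟩
  -- An ε against a letter: the path taking the ε becomes the first component, the other waits under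
  -- the flag.
  · have hl : pathLabel π' = b :: pathLabel ρ' := hl
    rw [hl] at h3
    exact ⟨_, _, .flag (.inl h2) (occurs_src h2).stay (hε.ne h2),
      (h3.productReach_flagged h2' h3').trans hback⟩
  · have hl : a :: pathLabel π' = pathLabel ρ' := hl
    rw [← hl] at h3'
    exact ⟨_, _, .flag (.inl h2') (occurs_src h2).stay (hε.ne h2'),
      (h3'.productReach_flagged h2 h3).trans hback⟩
  · obtain ⟨rfl, hl'⟩ := List.cons.inj (show a :: pathLabel π' = b :: pathLabel ρ' from hl)
    exact ⟨_, _, .forkLetter (.inl h2) (.inl h2') (by simp) (by simpa using hef),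
      hpair (occurs_tgt h2) (occurs_tgt h2') h3 (hl' ▸ h3')⟩

theorem exists_last_of_letterPaths_nonempty {p q : σ} {v : List α} {a : α}
    (h : (A.letterPaths (v ++ [a]) p q).Nonempty) :
    ∃ s, A.Reads p v s ∧ (s, some a, q) ∈ A.transitions := by
  obtain ⟨π, h1, h2, h3⟩ := h
  rcases List.eq_nil_or_concat π with rfl | ⟨π, ⟨s, b, r⟩, rfl⟩
  · simp [pathLabel] at h2
  · rw [List.concat_eq_append] at h1 h2 h3
    obtain ⟨s', h4, h5, rfl, h6⟩ := isTransitionPath_append.1 h1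
    obtain rfl : r = q := h6
    obtain ⟨b, rfl⟩ := Option.ne_none_iff_exists'.1 (h3.of_append (s, b, r) (by simp))
    have h7 : pathLabel π ++ [b] = v ++ [a] := by rw [← h2, pathLabel_append]; rfl
    obtain ⟨h8, h9⟩ := List.append_inj' h7 rfl
    obtain rfl : b = a := by simpa using h9
    exact ⟨s, ⟨π, h4, h8⟩, h5⟩

/-- The word is nonempty since `p ≠ q`, and by letter-endedness all three paths finish with a
transition reading its last letter. These transitions form the jump. -/
theorem hasMarkedCycle_one (h : A.HasBridgedCycles) : A.HasMarkedCycle 1 := by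
  obtain ⟨v, p, q, hpq, h1, h2, h3⟩ := h
  rcases List.eq_nil_or_concat v with rfl | ⟨v, a, rfl⟩
  · obtain ⟨π, hπ⟩ := h2
    rw [letterPaths_nil] at hπ
    exact absurd hπ.2 hpq
  · rw [List.concat_eq_append] at h1 h2 h3
    obtain ⟨s₁, h1, h1'⟩ := exists_last_of_letterPaths_nonempty h1
    obtain ⟨s₂, h2, h2'⟩ := exists_last_of_letterPaths_nonempty h2
    obtain ⟨s₃, h3, h3'⟩ := exists_last_of_letterPaths_nonempty h3
    exact ⟨_, _, .jump (.inl h1') (.inl h2') (.inl h3') (by simp) hpq,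
      h1.productReach_triple h2 h3 (occurs_tgt h1') (occurs_tgt h1') (occurs_tgt h3')⟩

end εNFA

namespace RAM

open LinkedGraph

variable {α σ : Type*} {A : εNFA α σ} {K B : ℕ} {S L D : ℕ → ℕ} {φ : σ → ℕ} {lam : Option α → ℕ}

/-! ### The product graphs in memory -/

/-- Uniqueness of digits in base `B`; the leading digit needs no bound. -/
theorem code_inj {x y z x' y' z' : ℕ} (hy : y < B) (hz : z < B) (hy' : y' < B) (hz' : z' < B)
    (h : code B x y z = code B x' y' z') : x = x' ∧ y = y' ∧ z = z' := by
  have key : ∀ {u v u' v' : ℕ}, v < B → v' < B → u * B + v = u' * B + v' → u = u' ∧ v = v' := by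
    intro u v u' v' hv hv' h
    have h1 := congrArg (· / B) h
    have h2 := congrArg (· % B) h
    simp only [Nat.mul_add_mod', Nat.mod_eq_of_lt hv, Nat.mod_eq_of_lt hv'] at h2
    subst h2
    have hB : 0 < B := by omega
    exact ⟨Nat.eq_of_mul_eq_mul_right hB (by omega), rfl⟩
  have h1 : (x * B + y) * B + z = (x' * B + y') * B + z' := by
    unfold code at h
    linarith
  obtain ⟨h2, h3⟩ := key hz hz' h1
  obtain ⟨h4, h5⟩ := key hy hy' h2
  exact ⟨h4, h5, h3⟩

/-- The first `K` entries of `S`, `L` and `D` list the transitions of `A`, and self-loops labeled by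
`ε`, with states and labels numbered by `φ` and `lam`. -/
structure Presents (A : εNFA α σ) (K B : ℕ) (S L D : ℕ → ℕ) (φ : σ → ℕ) (lam : Option α → ℕ) :
    Prop where
  inj : ∀ p q, A.Occurs p → A.Occurs q → φ p = φ q → p = q
  two_le : ∀ p, A.Occurs p → 2 ≤ φ p
  lt : ∀ p, φ p < B
  lam_inj : Function.Injective lam
  lam_none : lam none = 0
  mem : ∀ k < K, ∃ e ∈ A.loopedTransitions, S k = φ e.1 ∧ L k = lam e.2.1 ∧ D k = φ e.2.2
  ex : ∀ e ∈ A.loopedTransitions, ∃ k < K, S k = φ e.1 ∧ L k = lam e.2.1 ∧ D k = φ e.2.2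

/-- The number of a vertex of the product graphs. -/
def vertexCode (B : ℕ) (φ : σ → ℕ) : (σ × σ × Bool) ⊕ (σ × σ × σ) → ℕ
  | .inl (x, y, b) => code B (φ x) (φ y) (if b then 1 else 0)
  | .inr (x, y, z) => code B (φ x) (φ y) (φ z)

/-- All components of the vertex are end points of transitions. -/
def VertexOccurs (A : εNFA α σ) : (σ × σ × Bool) ⊕ (σ × σ × σ) → Prop
  | .inl (x, y, _) => A.Occurs x ∧ A.Occurs y
  | .inr (x, y, z) => A.Occurs x ∧ A.Occurs y ∧ A.Occurs z

theorem occurs_of_mem_loopedTransitions {p q : σ} {a : Option α}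
    (h : (p, a, q) ∈ A.loopedTransitions) : A.Occurs p ∧ A.Occurs q := by
  rcases h with h | ⟨-, h1, h2⟩
  · exact ⟨εNFA.occurs_src h, εNFA.occurs_tgt h⟩
  · obtain rfl : p = q := h1
    exact ⟨h2, h2⟩

theorem vertexOccurs_of_productEdge {u v : (σ × σ × Bool) ⊕ (σ × σ × σ)} {m : ℕ}
    (h : A.ProductEdge u v m) : VertexOccurs A u ∧ VertexOccurs A v := by
  have key := @occurs_of_mem_loopedTransitions α σ A
  cases h with
  | pair h1 h2 => exact ⟨⟨(key h1).1, (key h2).1⟩, (key h1).2, (key h2).2⟩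
  | unflag h1 h2 => exact ⟨⟨(key h1).1, (key h2).1⟩, (key h1).2, (key h2).2⟩
  | forkLetter h1 h2 => exact ⟨⟨(key h1).1, (key h2).1⟩, (key h1).2, (key h2).2⟩
  | forkEps h1 h2 => exact ⟨⟨(key h1).1, (key h2).1⟩, (key h1).2, (key h2).2⟩
  | flagged h1 h2 => exact ⟨⟨(key h1).1, (key h2).1⟩, (key h1).2, (key h2).2⟩
  | flag h1 h2 => exact ⟨⟨(key h1).1, (key h2).1⟩, (key h1).2, (key h2).2⟩
  | triple h1 h2 h3 =>
    exact ⟨⟨(key h1).1, (key h2).1, (key h3).1⟩, (key h1).2, (key h2).2, (key h3).2⟩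
  | jump h1 h2 h3 =>
    exact ⟨⟨(key h1).1, (key h2).1, (key h3).1⟩, (key h1).2, (key h1).2, (key h3).2⟩

/-- Pairs and triples share one code space: the last digit is below 2 for a pair and at least 2 for
a triple. -/
theorem Presents.vertexCode_inj (h : Presents A K B S L D φ lam)
    {u v : (σ × σ × Bool) ⊕ (σ × σ × σ)} (hu : VertexOccurs A u) (hv : VertexOccurs A v)
    (huv : vertexCode B φ u = vertexCode B φ v) : u = v := by
  have flag : ∀ (b : Bool) (p : σ), A.Occurs p → (if b then 1 else 0) < φ p := by
    intro b p hp
    have := h.two_le p hp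
    split_ifs <;> omega
  rcases u with ⟨x, y, b⟩ | ⟨x, y, z⟩ <;> rcases v with ⟨x', y', b'⟩ | ⟨x', y', z'⟩
  · obtain ⟨h1, h2, h3⟩ := code_inj (h.lt _) ((flag b x hu.1).trans (h.lt _)) (h.lt _)
      ((flag b' x hu.1).trans (h.lt _)) huv
    obtain rfl := h.inj _ _ hu.1 hv.1 h1
    obtain rfl := h.inj _ _ hu.2 hv.2 h2
    cases b <;> cases b' <;> simp_all
  · obtain ⟨h1, h2, h3⟩ := code_inj (h.lt _) ((flag b x hu.1).trans (h.lt _)) (h.lt _)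
      (h.lt _) huv
    have := flag b z' hv.2.2
    omega
  · obtain ⟨h1, h2, h3⟩ := code_inj (h.lt _) (h.lt _) (h.lt _)
      ((flag b' x hu.1).trans (h.lt _)) huv
    have := flag b' z hu.2.2
    omega
  · obtain ⟨h1, h2, h3⟩ := code_inj (h.lt _) (h.lt _) (h.lt _) (h.lt _) huv
    obtain rfl := h.inj _ _ hu.1 hv.1 h1
    obtain rfl := h.inj _ _ hu.2.1 hv.2.1 h2
    obtain rfl := h.inj _ _ hu.2.2 hv.2.2 h3
    rfl

/-- This leaves `0` free as the artificial root. -/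
theorem Presents.vertexCode_ne_zero (h : Presents A K B S L D φ lam)
    {u : (σ × σ × Bool) ⊕ (σ × σ × σ)} (hu : VertexOccurs A u) : vertexCode B φ u ≠ 0 := by
  have key : ∀ p y z, A.Occurs p → code B (φ p) y z ≠ 0 := by
    intro p y z hp
    have h1 := h.two_le p hp
    have h2 := h.lt p
    have h3 : 0 < φ p * (B * B) :=
      Nat.mul_pos (by omega) (Nat.mul_pos (by omega) (by omega))
    unfold code
    omega
  rcases u with ⟨x, y, b⟩ | ⟨x, y, z⟩
  · exact key _ _ _ hu.1
  · exact key _ _ _ hu.1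

theorem Presents.mem_productSet (h : Presents A K B S L D φ lam) (x : ℕ × ℕ × ℕ) :
    x ∈ productSet K B S L D ↔
      ∃ u v m, A.ProductEdge u v m ∧ x = (vertexCode B φ u, vertexCode B φ v, m) := by
  constructor
  · rintro ⟨i, hi, j, hj, hL, hx⟩
    obtain ⟨⟨s₁, a, d₁⟩, h1, S1, L1, D1⟩ := h.mem i hi
    obtain ⟨⟨s₂, a', d₂⟩, h2, S2, L2, D2⟩ := h.mem j hj
    obtain rfl := h.lam_inj (L1.symm.trans (hL.trans L2))
    have o1 := occurs_of_mem_loopedTransitions h1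
    have o2 := occurs_of_mem_loopedTransitions h2
    have ha : lam a = 0 ↔ a = none := by
      rw [← h.lam_none]
      exact h.lam_inj.eq_iff
    rcases hx with hx | ⟨k, hk, hL', hx⟩
    · simp only [pairEdges, S1, L1, D1, S2, D2, Set.mem_ofPred_eq, ne_eq, ha] at hx
      rcases hx with rfl | ⟨h3, rfl | ⟨h4, h5, rfl⟩⟩ | ⟨rfl, h3, h4, h5, h6, rfl⟩ |
        ⟨rfl, h3, rfl | ⟨h4, h5, rfl⟩⟩
      · exact ⟨_, _, _, .pair h1 h2, rfl⟩
      · exact ⟨_, _, _, .unflag h1 h2 h3, rfl⟩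
      · obtain rfl := h.inj _ _ o1.1 o2.1 h4
        exact ⟨_, _, _, .forkLetter h1 h2 h3 fun h ↦ h5 (by rw [h]), rfl⟩
      · obtain rfl := h.inj _ _ o1.1 o2.1 h4
        exact ⟨_, _, _, .forkEps h1 h2 (fun h ↦ h6 (by rw [← h])) (fun h ↦ h3 (by rw [← h]))
          (fun h ↦ h5 (by rw [h])), rfl⟩
      · obtain rfl := h.inj _ _ o2.1 o2.2 h3
        exact ⟨_, _, _, .flagged h1 h2, rfl⟩
      · obtain rfl := h.inj _ _ o2.1 o2.2 h3
        obtain rfl := h.inj _ _ o1.1 o2.1 h4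
        exact ⟨_, _, _, .flag h1 h2 (fun h ↦ h5 (by rw [← h])), rfl⟩
    · obtain ⟨⟨s₃, a', d₃⟩, h3, S3, L3, D3⟩ := h.mem k hk
      obtain rfl := h.lam_inj (L1.symm.trans (hL'.trans L3))
      have o3 := occurs_of_mem_loopedTransitions h3
      simp only [tripleEdges, S1, L1, D1, S2, D2, S3, D3, Set.mem_ofPred_eq, ne_eq, ha] at hx
      rcases hx with rfl | ⟨h4, h5, h6, rfl⟩
      · exact ⟨_, _, _, .triple h1 h2 h3, rfl⟩
      · obtain rfl := h.inj _ _ o2.2 o3.2 h5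
        exact ⟨_, _, _, .jump h1 h2 h3 h4 fun h ↦ h6 (by rw [h]), rfl⟩
  · rintro ⟨u, v, m, he, rfl⟩
    have ha : ∀ a, lam a = 0 ↔ a = none := fun a ↦ by
      rw [← h.lam_none]
      exact h.lam_inj.eq_iff
    have hne : ∀ {p q}, A.Occurs p → A.Occurs q → (φ p = φ q ↔ p = q) := fun hp hq ↦
      ⟨h.inj _ _ hp hq, fun h ↦ by rw [h]⟩
    have hpair : ∀ {a s₁ d₁ s₂ d₂ x}, (s₁, a, d₁) ∈ A.loopedTransitions →
        (s₂, a, d₂) ∈ A.loopedTransitions →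
        x ∈ pairEdges B (lam a) (φ s₁) (φ d₁) (φ s₂) (φ d₂) → x ∈ productSet K B S L D := by
      intro a s₁ d₁ s₂ d₂ x h1 h2 hx
      obtain ⟨i, hi, S1, L1, D1⟩ := h.ex _ h1
      obtain ⟨j, hj, S2, L2, D2⟩ := h.ex _ h2
      refine ⟨i, hi, j, hj, L1.trans L2.symm, .inl ?_⟩
      rwa [S1, L1, D1, S2, D2]
    have htriple : ∀ {a s₁ d₁ s₂ d₂ s₃ d₃ x}, (s₁, a, d₁) ∈ A.loopedTransitions →
        (s₂, a, d₂) ∈ A.loopedTransitions → (s₃, a, d₃) ∈ A.loopedTransitions →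
        x ∈ tripleEdges B (lam a) (φ s₁) (φ d₁) (φ s₂) (φ d₂) (φ s₃) (φ d₃) →
        x ∈ productSet K B S L D := by
      intro a s₁ d₁ s₂ d₂ s₃ d₃ x h1 h2 h3 hx
      obtain ⟨i, hi, S1, L1, D1⟩ := h.ex _ h1
      obtain ⟨j, hj, S2, L2, D2⟩ := h.ex _ h2
      obtain ⟨k, hk, S3, L3, D3⟩ := h.ex _ h3
      refine ⟨i, hi, j, hj, L1.trans L2.symm, .inr ⟨k, hk, L1.trans L3.symm, ?_⟩⟩
      rwa [S1, L1, D1, S2, D2, S3, D3]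
    have key := @occurs_of_mem_loopedTransitions α σ A
    cases he with
    | pair h1 h2 => exact hpair h1 h2 (.inl rfl)
    | unflag h1 h2 h3 => exact hpair h1 h2 (.inr (.inl ⟨(ha _).not.2 h3, .inl rfl⟩))
    | forkLetter h1 h2 h3 h4 =>
      exact hpair h1 h2 (.inr (.inl ⟨(ha _).not.2 h3,
        .inr ⟨rfl, (hne (key h1).2 (key h2).2).not.2 h4, rfl⟩⟩))
    | forkEps h1 h2 h3 h4 h5 =>
      exact hpair h1 h2 (.inr (.inr (.inl ⟨h.lam_none, (hne (key h2).1 (key h2).2).not.2 h4, rfl,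
        (hne (key h1).2 (key h2).2).not.2 h5, (hne (key h1).1 (key h1).2).not.2 h3, rfl⟩)))
    | flagged h1 h2 => exact hpair h1 h2 (.inr (.inr (.inr ⟨h.lam_none, rfl, .inl rfl⟩)))
    | flag h1 h2 h3 =>
      exact hpair h1 h2 (.inr (.inr (.inr ⟨h.lam_none, rfl,
        .inr ⟨rfl, (hne (key h1).1 (key h1).2).not.2 h3, rfl⟩⟩)))
    | triple h1 h2 h3 => exact htriple h1 h2 h3 (.inl rfl)
    | jump h1 h2 h3 h4 h5 =>
      exact htriple h1 h2 h3 (.inr ⟨(ha _).not.2 h4, rfl,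
        (hne (key h1).2 (key h3).2).not.2 h5, rfl⟩)

variable {g : LinkedGraph}

theorem Presents.exists_productEdge (h : Presents A K B S L D φ lam)
    (hg : g.Stores (productSet K B S L D)) {e : ℕ} (h1 : 1 ≤ e) (h2 : e ≤ g.numEdges)
    (h3 : g.src e ≠ 0) : ∃ u v, A.ProductEdge u v (g.mark e) ∧ g.src e = vertexCode B φ u ∧
      g.tgt e = vertexCode B φ v := by
  have : (g.src e, g.tgt e, g.mark e) ∈ g.edges := ⟨e, h1, h2, rfl⟩
  rw [hg.edges_eq] at this
  rcases this with h4 | ⟨x, -, hx⟩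
  · obtain ⟨u, v, m, h5, h6⟩ := (h.mem_productSet _).1 h4
    simp only [Prod.mk.injEq] at h6
    obtain ⟨h6, h7, rfl⟩ := h6
    exact ⟨u, v, h5, h6, h7⟩
  · exact absurd (Prod.mk.inj hx).1.symm h3

theorem Presents.reach_of_productReach (h : Presents A K B S L D φ lam)
    (hg : g.Stores (productSet K B S L D)) {u v : (σ × σ × Bool) ⊕ (σ × σ × σ)}
    (huv : A.ProductReach u v) : g.Reach (vertexCode B φ u) (vertexCode B φ v) := by
  induction huv with
  | refl => exact .refl
  | tail _ h' ih =>
    obtain ⟨m, h'⟩ := h'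
    have h1 := (h.mem_productSet _).2 ⟨_, _, _, h', rfl⟩
    have h2 : _ ∈ g.edges := hg.edges_eq ▸ Set.mem_union_left _ h1
    obtain ⟨e, h3, h4, h5⟩ := h2
    simp only [Prod.mk.injEq] at h5
    exact .tail ih ⟨e, h3, h4, h5.1, h5.2.1⟩

/-- The root has a code of its own, so no walk that starts at a genuine vertex uses one of the
root's edges. -/
theorem Presents.exists_productReach (h : Presents A K B S L D φ lam)
    (hg : g.Stores (productSet K B S L D)) {u : (σ × σ × Bool) ⊕ (σ × σ × σ)} {y : ℕ}
    (hu : VertexOccurs A u) (hy : g.Reach (vertexCode B φ u) y) :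
    ∃ v, VertexOccurs A v ∧ y = vertexCode B φ v ∧ A.ProductReach u v := by
  induction hy with
  | refl => exact ⟨u, hu, rfl, .refl⟩
  | tail _ h' ih =>
    obtain ⟨v, hv, rfl, huv⟩ := ih
    obtain ⟨e, h1, h2, h3, rfl⟩ := h'
    obtain ⟨v', w, h4, h5, h6⟩ := h.exists_productEdge hg h1 h2
      (h3 ▸ h.vertexCode_ne_zero hv)
    have ho := vertexOccurs_of_productEdge h4
    obtain rfl := h.vertexCode_inj ho.1 hv (h5.symm.trans h3)
    exact ⟨w, ho.2, h6, huv.tail ⟨_, h4⟩⟩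

theorem Presents.src_ne_zero (h : Presents A K B S L D φ lam)
    (hg : g.Stores (productSet K B S L D)) {e : ℕ} (h1 : 1 ≤ e) (h2 : e ≤ g.numEdges)
    (h3 : g.mark e ≠ 0) :
    g.src e ≠ 0 := by
  have : (g.src e, g.tgt e, g.mark e) ∈ g.edges := ⟨e, h1, h2, rfl⟩
  rw [hg.edges_eq] at this
  rcases this with h4 | ⟨x, -, hx⟩
  · obtain ⟨u, v, m, h5, h6⟩ := (h.mem_productSet _).1 h4
    rw [(Prod.mk.inj h6).1]
    exact h.vertexCode_ne_zero (vertexOccurs_of_productEdge h5).1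
  · simp only [Prod.mk.injEq] at hx
    exact absurd hx.2.2.symm h3

theorem Presents.exists_onCycle (h : Presents A K B S L D φ lam)
    (hg : g.Stores (productSet K B S L D)) {m : ℕ} (hm : m ≠ 0) (hA : A.HasMarkedCycle m) :
    ∃ e, g.OnCycle e ∧ g.mark e = m := by
  obtain ⟨u, v, h1, h2⟩ := hA
  have h3 := (h.mem_productSet _).2 ⟨_, _, _, h1, rfl⟩
  have h4 : _ ∈ g.edges := hg.edges_eq ▸ Set.mem_union_left _ h3
  obtain ⟨e, h5, h6, h7⟩ := h4
  simp only [Prod.mk.injEq] at h7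
  obtain ⟨h7, h8, h9⟩ := h7
  refine ⟨e, ⟨h5, h6, h9 ▸ hm, ?_⟩, h9⟩
  rw [h7, h8]
  exact h.reach_of_productReach hg h2

/-- The marked cycle and the attained edge are connected, so both lie in the pair graph or both in
the triple graph. Within either part all nonzero marks are equal, so the cycle carries the attained
mark. -/
theorem Presents.hasMarkedCycle_of_attained (h : Presents A K B S L D φ lam)
    (hg : g.Stores (productSet K B S L D)) {m : ℕ} (hm : m ≠ 0) (hA : g.Attained m) :
    A.HasMarkedCycle m ∧ (m = 1 ∨ m = 2) := by
  obtain ⟨e₀, e, h1, h2, rfl, h3, h4⟩ := hA.resolve_left hm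
  obtain ⟨u, v, h5, h6, h7⟩ := h.exists_productEdge hg h3.pos h3.le
    (h.src_ne_zero hg h3.pos h3.le h3.mark)
  obtain ⟨u₀, v₀, h8, h9, -⟩ := h.exists_productEdge hg h1 h2 (h.src_ne_zero hg h1 h2 hm)
  have ho := vertexOccurs_of_productEdge h5
  have ho' := vertexOccurs_of_productEdge h8
  have h10 := h3.reach
  rw [h6, h7] at h10
  rw [h7, h9] at h4
  obtain ⟨w, hw, h11, h12⟩ := h.exists_productReach hg ho.2 h10
  obtain rfl := h.vertexCode_inj ho.1 hw h11
  obtain ⟨w, hw', h13, h14⟩ := h.exists_productReach hg ho.2 h4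
  obtain rfl := h.vertexCode_inj ho'.1 hw' h13
  have h15 : u.isLeft = u₀.isLeft := h12.isLeft_eq.symm.trans h14.isLeft_eq
  have key : ∀ {u v : (σ × σ × Bool) ⊕ (σ × σ × σ)} {m : ℕ}, A.ProductEdge u v m → m ≠ 0 →
      m = if u.isLeft then 2 else 1 := by
    intro u v m h hm
    cases h <;> first | rfl | exact absurd rfl hm
  have h16 : g.mark e = g.mark e₀ := by rw [key h5 h3.mark, key h8 hm, h15]
  refine ⟨⟨u, v, h16 ▸ h5, h12⟩, ?_⟩
  rw [key h8 hm]
  split_ifs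
  · exact .inr rfl
  · exact .inl rfl

theorem LinkedGraph.Stores.reach_src {E : Set (ℕ × ℕ × ℕ)} (hg : g.Stores E) {e : ℕ} (h1 : 1 ≤ e)
    (h2 : e ≤ g.numEdges) : g.Reach 0 (g.src e) := by
  have : (g.src e, g.tgt e, g.mark e) ∈ g.edges := ⟨e, h1, h2, rfl⟩
  rw [hg.edges_eq] at this
  rcases this with h4 | ⟨x, -, hx⟩
  · have h5 : (0, g.src e, 0) ∈ g.edges := hg.edges_eq ▸ Set.mem_union_right _ ⟨_, h4, rfl⟩
    obtain ⟨e', h6, h7, h8⟩ := h5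
    simp only [Prod.mk.injEq] at h8
    exact .single ⟨e', h6, h7, h8.1, h8.2.1⟩
  · rw [← (Prod.mk.inj hx).1]
    exact .refl

end RAM

namespace RAM

open LinkedGraph

variable {α σ : Type*} {A : εNFA α σ} {s : Config} {m : ℕ}

/-! ### The input -/

theorem getD_flatMap {X : Type*} (a b c : X → ℕ) (T : List X) (R : List ℕ) (i : ℕ)
    (hi : i < T.length) :
    (T.flatMap (fun e ↦ [a e, b e, c e]) ++ R).getD (3 * i) 0 = a T[i] ∧
      (T.flatMap (fun e ↦ [a e, b e, c e]) ++ R).getD (3 * i + 1) 0 = b T[i] ∧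
      (T.flatMap (fun e ↦ [a e, b e, c e]) ++ R).getD (3 * i + 2) 0 = c T[i] := by
  induction T generalizing i with
  | nil => simp at hi
  | cons e T ih =>
    cases i with
    | zero => simp
    | succ i =>
      obtain ⟨h1, h2, h3⟩ := ih i (by simpa using hi)
      have hm : 3 * (i + 1) = 3 * i + 1 + 1 + 1 := by ring
      simp only [hm, List.flatMap_cons, List.cons_append, List.nil_append, List.getD_cons_succ,
        List.getElem_cons_succ]
      exact ⟨h1, h2, h3⟩

theorem presents_of_isEncoding [Fintype α] [Fintype σ] {w : List ℕ} (h : A.IsEncoding w)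
    (hm : w.getD 2 0 = m) (hs : s.IsSetup (fun i ↦ w.getD i 0) m) :
    m = A.numTransitions ∧ ∃ (φ : σ → ℕ) (lam : Option α → ℕ),
      Presents A (3 * m) (2 * m + 2) (s.arr 2) (s.arr 3) (s.arr 4) φ lam := by
  obtain ⟨st, lt, T, I, F, ⟨hT, hT'⟩, -, -, rfl⟩ := h
  set lam : Option α → ℕ := fun a ↦ a.elim 0 (fun a ↦ (lt a : ℕ) + 1) with hlam
  obtain rfl : T.length = m := by simpa using hm
  set f := s.arr 1 with hf
  have hdec := getD_flatMap (fun e : σ × Option α × σ ↦ (st e.1 : ℕ)) (fun e ↦ lam e.2.1)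
    (fun e ↦ (st e.2.2 : ℕ)) T
    ([I.length] ++ I.map (fun q ↦ (st q : ℕ)) ++ [F.length] ++ F.map (fun q ↦ (st q : ℕ)))
  have hlist : ∀ (i : ℕ) (hi : i < T.length), f (st T[i].1) ≠ 0 ∧ f (st T[i].2.2) ≠ 0 ∧
      (s.arr 2 (3 * i) = f (st T[i].1) ∧ s.arr 3 (3 * i) = lam T[i].2.1 ∧
        s.arr 4 (3 * i) = f (st T[i].2.2)) ∧
      (s.arr 2 (3 * i + 1) = f (st T[i].1) ∧ s.arr 3 (3 * i + 1) = 0 ∧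
        s.arr 4 (3 * i + 1) = f (st T[i].1)) ∧
      (s.arr 2 (3 * i + 2) = f (st T[i].2.2) ∧ s.arr 3 (3 * i + 2) = 0 ∧
        s.arr 4 (3 * i + 2) = f (st T[i].2.2)) := by
    intro i hi
    have h1 := hs.lists i hi
    obtain ⟨h2, h3, h4⟩ := hdec i hi
    have e1 : 3 + 3 * i = 3 * i + 1 + 1 + 1 := by ring
    have e2 : 4 + 3 * i = 3 * i + 1 + 1 + 1 + 1 := by ring
    have e3 : 5 + 3 * i = 3 * i + 2 + 1 + 1 + 1 := by ring
    simp only [e1, e2, e3, List.cons_append, List.nil_append, List.append_assoc,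
      List.getD_cons_succ] at h1 h2 h3 h4
    rw [h2, h3, h4] at h1
    exact h1
  have hocc : ∀ p, A.Occurs p → f (st p) ≠ 0 ∧ ∃ k < 3 * T.length,
      s.arr 2 k = f (st p) ∧ s.arr 3 k = 0 ∧ s.arr 4 k = f (st p) := by
    rintro p ⟨e, he, hp⟩
    obtain ⟨i, hi, rfl⟩ := List.mem_iff_getElem.1 ((hT' e).2 he)
    obtain ⟨h1, h2, -, h3, h4⟩ := hlist i hi
    rcases hp with rfl | rfl
    · exact ⟨h1, 3 * i + 1, by omega, h3⟩
    · exact ⟨h2, 3 * i + 2, by omega, h4⟩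
  have hmem : ∀ (i : ℕ) (hi : i < T.length), T[i] ∈ A.transitions := fun i hi ↦
    (hT' _).1 (List.getElem_mem hi)
  refine ⟨?_, fun q ↦ f (st q), lam, ⟨?_, ?_, ?_, ?_, rfl, ?_, ?_⟩⟩
  · classical
    have : A.transitions = (T.toFinset : Set (σ × Option α × σ)) := by
      ext e
      simp [hT']
    rw [εNFA.numTransitions, this, Set.ncard_coe_finset, List.toFinset_card_of_nodup hT]
  · intro p q hp hq hpq
    exact st.injective (Fin.ext (hs.numbering.inj _ _ (hocc p hp).1 hpq))
  · exact fun p hp ↦ hs.numbering.two_le _ (hocc p hp).1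
  · intro p
    exact Nat.lt_of_le_of_lt (hs.numbering.le (st p)) (by omega)
  · rintro (_ | a) (_ | b) hab
    · rfl
    · simp [hlam] at hab
    · simp [hlam] at hab
    · have : (lt a : ℕ) = lt b := by simpa [hlam] using hab
      rw [lt.injective (Fin.ext this)]
  · intro k hk
    obtain ⟨i, j, hj, rfl⟩ : ∃ i j, j < 3 ∧ k = 3 * i + j := ⟨k / 3, k % 3, by omega, by omega⟩
    have hi : i < T.length := by omega
    obtain ⟨-, -, h1, h2, h3⟩ := hlist i hi
    interval_cases j
    · exact ⟨T[i], .inl (hmem i hi), h1⟩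
    · exact ⟨(T[i].1, none, T[i].1), .inr ⟨rfl, rfl, _, hmem i hi, .inl rfl⟩, h2⟩
    · exact ⟨(T[i].2.2, none, T[i].2.2), .inr ⟨rfl, rfl, _, hmem i hi, .inr rfl⟩, h3⟩
  · rintro ⟨p, a, q⟩ (he | ⟨h1, h2, h3⟩)
    · obtain ⟨i, hi, hie⟩ := List.mem_iff_getElem.1 ((hT' _).2 he)
      obtain ⟨-, -, h1, -⟩ := hlist i hi
      rw [hie] at h1
      exact ⟨3 * i, by omega, h1⟩
    · obtain rfl : a = none := h1
      obtain rfl : p = q := h2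
      exact (hocc p h3).2

theorem Presents.hasData {K B : ℕ} {S L D : ℕ → ℕ} {φ : σ → ℕ} {lam : Option α → ℕ}
    (h : Presents A K B S L D φ lam) (h2 : s.reg 2 = K) (hS : s.arr 2 = S) (hL : s.arr 3 = L)
    (hD : s.arr 4 = D) (h5 : ∀ x < B, s.arr 5 x = x * B) (h6 : ∀ x < B, s.arr 6 x = x * (B * B)) :
    s.HasData K B S L D where
  reg_2 := h2
  arr_2 := hS
  arr_3 := hL
  arr_4 := hD
  arr_5 := h5
  arr_6 := h6
  src_lt k hk := by
    obtain ⟨e, -, he, -⟩ := h.mem k hk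
    exact he ▸ h.lt _
  tgt_lt k hk := by
    obtain ⟨e, -, -, -, he⟩ := h.mem k hk
    exact he ▸ h.lt _

theorem stores_empty (h30 : s.reg 30 = 0) (h10 : s.arr 10 = fun _ ↦ 0) : s.graph.Stores ∅ where
  wf := by
    refine ⟨?_, ?_, ?_, ?_, ?_, ?_⟩ <;> simp only [Config.graph, h30, h10] <;> intros <;> omega
  edges_eq := by
    ext x
    simp only [edges, Config.graph, h30, Set.image_empty, Set.union_empty,
      Set.mem_empty_iff_false, iff_false]
    rintro ⟨e, h1, h2, -⟩
    omega

end RAM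

/-! ### Assembling the decision procedure -/

theorem mainTheorem1 :
    ∃ (P : RAM.Program) (C : ℕ),
      ∀ (α σ : Type*) [Fintype α] [Fintype σ] (A : εNFA α σ) (w : List ℕ),
        A.IsTrim → A.IsEpsCycleFree → A.IsEncoding w →
        ∃ (s : RAM.Config) (t : ℕ),
          RAM.Exec P (RAM.input w) s t ∧
          t ≤ C * (A.numTransitions ^ 3 + 1) ∧
          ((s.reg 0 = 0 ∧ A.FinitelyAmbiguous) ∨
            (s.reg 0 = 1 ∧ A.PolynomiallyAmbiguous ∧ ¬ A.FinitelyAmbiguous) ∨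
            (s.reg 0 = 2 ∧ A.ExponentiallyAmbiguous)) := by
  -- The total is at most 54000 m³ + 36000 m² + 133 m + 302 with m = |E|, and m, m² ≤ m³.
  refine ⟨.seq RAM.setup (.seq RAM.buildGraph RAM.maxCycleMark), 100000, ?_⟩
  intro α σ _ _ A w hA hε hw
  set m := w.getD 2 0 with hm
  have hm3 : m ≤ m ^ 3 := Nat.le_self_pow (by norm_num) m
  have hm2 : m ^ 2 ≤ m ^ 3 := by
    rcases Nat.eq_zero_or_pos m with h | h
    · simp [h]
    · exact Nat.pow_le_pow_right h (by norm_num)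
  have hcost : ((2000 * (3 * m) + 3999 + 1) * (3 * m) + 10 + 1) * (3 * m) =
    54000 * m ^ 3 + 36000 * m ^ 2 + 33 * m := by ring
  suffices h : RAM.Wp (.seq RAM.setup (.seq RAM.buildGraph RAM.maxCycleMark)) (RAM.input w)
      (100000 * (m ^ 3 + 1)) (fun s _ ↦ m = A.numTransitions ∧
        ((s.reg 0 = 0 ∧ A.FinitelyAmbiguous) ∨
          (s.reg 0 = 1 ∧ A.PolynomiallyAmbiguous ∧ ¬ A.FinitelyAmbiguous) ∨
          (s.reg 0 = 2 ∧ A.ExponentiallyAmbiguous))) by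
    obtain ⟨s, t, c, h1, h2, h3, h4⟩ := h
    exact ⟨s, t, h1, by rw [← h3]; omega, h4⟩
  refine RAM.Wp.seq ((RAM.setup_spec (w := fun i ↦ w.getD i 0) (m := m) rfl rfl rfl
    (by omega)).mono ?_)
  rintro s₁ c₁ ⟨h1, h2, h3⟩
  obtain ⟨hmA, φ, lam, hP⟩ := RAM.presents_of_isEncoding hw rfl h2
  have h30 : s₁.reg 30 = 0 := h1.1 30 (by norm_num)
  have hbuild : s₁.Building (3 * m) (2 * m + 2) (s₁.arr 2) (s₁.arr 3) (s₁.arr 4) ∅ :=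
    ⟨hP.hasData h2.reg_2 rfl rfl rfl h2.arr_5 h2.arr_6,
      RAM.stores_empty h30 (h1.2 10 (by norm_num))⟩
  have hedges : s₁.graph.numEdges = 0 := h30
  refine RAM.Wp.seq ((RAM.buildGraph_spec (rest := 200) hbuild
    (by rw [hedges, hcost]; omega)).mono ?_)
  rintro s₂ c₂ ⟨h4, h5, h6⟩
  refine (RAM.maxCycleMark_spec h5.wf ?_ ?_ ?_ ?_ (fun e ↦ h5.reach_src) h6).mono ?_
  · rw [h4.1 0 (by norm_num), h1.1 0 (by norm_num)]
    rfl
  · rw [h4.1 40 (by norm_num), h1.1 40 (by norm_num)]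
    rfl
  · rw [h4.1 41 (by norm_num), h1.1 41 (by norm_num)]
    rfl
  · intro a ha
    rw [h4.2 a (by omega), h1.2 a (by omega)]
    funext i
    simp [RAM.input, show a ≠ 0 by omega]
  rintro s₃ c₃ ⟨h7, h8⟩
  refine ⟨hmA, ?_⟩
  have hle : ∀ k, k ≠ 0 → A.HasMarkedCycle k → k ≤ s₃.reg 0 := by
    intro k hk h
    obtain ⟨e, he, rfl⟩ := hP.exists_onCycle h5 hk h
    exact h8 e he
  -- Letter-ended twin cycles force mark 2, whereas mark 2 only returns twin cycles. That suffices: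
  -- absence of the former gives the polynomial bound, and presence of the latter excludes it.
  have htwin : A.HasLetterTwinCycles → 2 ≤ s₃.reg 0 := fun h ↦
    hle 2 (by norm_num) (εNFA.hasMarkedCycle_two hε h)
  have hbridge : A.HasBridgedCycles → 1 ≤ s₃.reg 0 := fun h ↦
    hle 1 (by norm_num) (εNFA.hasMarkedCycle_one h)
  by_cases h0 : s₃.reg 0 = 0
  · exact .inl ⟨h0, εNFA.finitelyAmbiguous_of_not_hasBridgedCycles hε
      (fun h ↦ by have := htwin h; omega) (fun h ↦ by have := hbridge h; omega)⟩
  · obtain ⟨h9, h10 | h10⟩ := hP.hasMarkedCycle_of_attained h5 h0 h7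
    · rw [h10] at h9
      exact .inr (.inl ⟨h10, εNFA.polynomiallyAmbiguous_of_not_hasLetterTwinCycles hε
        (fun h ↦ by have := htwin h; omega),
        (εNFA.hasBridgedCycles_of_hasMarkedCycle h9).not_finitelyAmbiguous hA⟩)
    · rw [h10] at h9
      have hpoly := (εNFA.hasTwinCycles_of_hasMarkedCycle h9).not_polynomiallyAmbiguous hε hA
      exact .inr (.inr ⟨h10, fun h ↦ hpoly h.polynomiallyAmbiguous, hpoly⟩)
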